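/- Let $\alpha\in(0,1)$, $\beta\ge 0$, $q\in L_1(0,1)$ and $N(u)=\sum_{p\ge 1}a_pu^p$ with real $a_p$, the power series converging for all $u\in\mathbb R$; put $\widetilde N(u)=\sum_{p\ge1}|a_p|u^p$, $\|q\|_{0,1}=\int_0^1|q|\,dx$, $\|u\|_\infty=\max_{[0,1]}|u|$. Consider the problem $$u''-[\beta\delta(x-\alpha)+q(x)]u+\lambda u-N(u)=0\ \text{ on }(0,1),\qquad u(0)=u(1)=0,\ u'(0)=1, \tag{P}$$ that is: $u$ is continuous on $[0,1]$, $u'$ is absolutely continuous on each of $[0,\alpha]$ and $[\alpha,1]$ (one-sided at the end points), $u''=qu-\lambda u+N(u)$ almost everywhere, $u'(\alpha+0)-u'(\alpha-0)=\beta u(\alpha)$, and the boundary conditions hold. For $k\ge0$ let $A_k(N;v_0,\dots,v_k)=\frac1{k!}\frac{d^k}{dt^k}N\bigl(\sum_{p}v_pt^p\bigr)\big|_{t=0}$ be the Adomian polynomials. Basic problem. For $n\ge 1$ let $\lambda_n^{(0)}$ be the root in $[\pi^2n^2,\pi^2(n+1)^2)$ of $\sqrt\lambda\sin\sqrt\lambda=-\beta\sin(\sqrt\lambda\,\alpha)\sin(\sqrt\lambda(1-\alpha))$,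 let $\omega=\omega_n=\sqrt{\lambda_n^{(0)}}$, let $u_n^{(0)}(x)=\sin(\omega x)/\omega$ for $x\le\alpha$ and $u_n^{(0)}(x)=c_n^{(0)}\sin(\omega(1-x))$ for $x>\alpha$, where $c_n^{(0)}=\frac{\sin(\omega\alpha)}{\omega\sin(\omega(1-\alpha))}$ if $\sin(\omega(1-\alpha))\ne0$ and $c_n^{(0)}=-\cos(\omega)/\omega$ otherwise. FD-method. For $j\ge1$ put $$F_n^{(j)}=-\sum_{p=0}^{j-1}\lambda_n^{(j-p)}u_n^{(p)}+q\,u_n^{(j-1)}+A_{j-1}(N;u_n^{(0)},\dots,u_n^{(j-1)}),$$ $$\lambda_n^{(j)}=\frac{\lambda_n^{(0)}}{M_n}\Bigl(-\sum_{p=1}^{j-1}\lambda_n^{(j-p)}\int_0^1u_n^{(0)}u_n^{(p)}dx+\int_0^1q\,u_n^{(j-1)}u_n^{(0)}dx+\int_0^1A_{j-1}(N;u_n^{(0)},\dots,u_n^{(j-1)})\,u_n^{(0)}dx\Bigr),$$ with $M_n=\lambda_n^{(0)}\int_0^1(u_n^{(0)})^2dx$; $u_n^{(j)}(x)=\int_0^x\frac{\sin(\omega(x-\xi))}{\omega}F_n^{(j)}(\xi)d\xi$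 for $x\le\alpha$ and $u_n^{(j)}(x)=c_n^{(j)}\sin(\omega(1-x))-\int_x^1\frac{\sin(\omega(x-\xi))}{\omega}F_n^{(j)}(\xi)d\xi$ for $x>\alpha$, where $c_n^{(j)}$ is determined by $$c_n^{(j)}\sin(\omega(1-\alpha))=\int_0^1\tfrac{\sin(\omega(\alpha-\xi))}{\omega}F_n^{(j)}d\xi,\quad c_n^{(j)}\cos(\omega(1-\alpha))=-\int_0^1\tfrac{\cos(\omega(\alpha-\xi))}{\omega}F_n^{(j)}d\xi-\beta\int_0^\alpha\tfrac{\sin(\omega(\alpha-\xi))}{\omega^2}F_n^{(j)}d\xi .$$ The approximations of rank $m$ are $\overset{m}{\lambda}_n=\sum_{j=0}^m\lambda_n^{(j)}$ and $\overset{m}{u}_n=\sum_{j=0}^mu_n^{(j)}$. Constants. Let $\tilde c_n=\sin^2(\omega\alpha)+\bigl(\cos(\omega\alpha)+\tfrac\beta\omega\sin(\omega\alpha)\bigr)^2$, $a(n)=\bigl(1+\sqrt{1+(1+\beta/\omega)^2}\bigr)/\omega$, $b(n)=\max\{1,\omega/M_n,\omega\sqrt{\tilde c_n}/M_n\}$,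 $\bar v_0=b(n)\|u_n^{(0)}\|_\infty$, $\widetilde N_1(v)=\widetilde N(\|u_n^{(0)}\|_\infty+v)$, $\bar v_1=(1+\bar v_0)\bigl(\|q\|_{0,1}+\widetilde N_1'(0)\bigr)\bar v_0$, and for $j\ge2$ $$\bar v_j=\sum_{p=1}^{j-1}\bar v_{j-p}\bar v_p+(1+\bar v_0)\bigl(\|q\|_{0,1}\bar v_{j-1}+A_{j-1}(\widetilde N_1;0,\bar v_1,\dots,\bar v_{j-1})\bigr).$$ Let $R=R(n)$ be the radius of convergence of $f(z)=\sum_{j\ge1}\bar v_jz^j$, and $r_n=a(n)/R$ (with $1/R=0$ if $R=\infty$). Theorem. There is a positive integer $n_0$ such that for all $n\ge n_0$: $R>0$ and $r_n<1$; both equations for $c_n^{(j)}$ are satisfied and all $u_n^{(j)}$ are continuous on $[0,1]$; the series $\sum_j\lambda_n^{(j)}$ and $\sum_ju_n^{(j)}$ converge absolutely (the second one in $\|\cdot\|_\infty$), and there is a solution $(\lambda_n,u_n)$ of (P) such that for some constants $c>0$ and $\varepsilon>0$, with $\alpha_j=c/j^{1+\varepsilon}$ and $C_{n,m}=\alpha_{m+1}M_n/(1-r_n)$,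 for all $m\ge0$ $$\|u_n-\overset{m}{u}_n\|_\infty\le\sum_{j=m+1}^\infty\|u_n^{(j)}\|_\infty\le C_{n,m}\min\Bigl\{\frac1{M_n},\frac1{\omega},\frac1{\omega\sqrt{\tilde c_n}}\Bigr\}r_n^{m+1},$$ $$|\lambda_n-\overset{m}{\lambda}_n|\le\sum_{j=m+1}^\infty|\lambda_n^{(j)}|\le\frac{C_{n,m}}{\bigl(M_n+\max\{1,\tilde c_n,\sqrt{\tilde c_n}\,M_n/\omega\}\bigr)R}\,r_n^m .$$ In particular the FD-method converges superexponentially to the exact solution $(\lambda_n,u_n)$, in the sense that both errors are $o(r_n^m)$ as $m\to\infty$. -/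

import Mathlib

open MeasureTheory Filter Topology Asymptotics
open scoped ENNReal

noncomputable section

namespace FDMethod

/-! ## Generic notions -/

/-- The function `u ↦ ∑ₚ a p * u ^ p` given by a power series. -/
def powerFun (a : ℕ → ℝ) (u : ℝ) : ℝ := ∑' p : ℕ, a p * u ^ p

/-- The majorant function `u ↦ ∑ₚ |a p| * u ^ p`. -/
def majorantFun (a : ℕ → ℝ) (u : ℝ) : ℝ := powerFun (fun p => |a p|) u

/-- The Adomian polynomial of order `k`:
`A_k(N; v₀, …, v_k) = (1 / k!) d^k/dt^k N(∑ₚ v_p t ^ p)` at `t = 0`. The terms with `p > k` do not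
influence this derivative and are left out. -/
def adomian (N : ℝ → ℝ) (k : ℕ) (v : ℕ → ℝ) : ℝ :=
  iteratedDeriv k (fun t : ℝ => N (∑ p ∈ Finset.range (k + 1), v p * t ^ p)) 0 / (k.factorial : ℝ)

/-- The maximum norm of a (continuous) function on `[0, 1]`. -/
def supNorm (u : ℝ → ℝ) : ℝ := ⨆ x : Set.Icc (0 : ℝ) 1, |u x|

/-- The `L₁(0, 1)`-norm. -/
def normL1 (q : ℝ → ℝ) : ℝ := ∫ x in (0 : ℝ)..1, |q x|

/-- `(lam, u)` solves
`u'' - [β δ(x - α) + q] u + lam u - N(u) = 0` on `(0, 1)`, `u(0) = u(1) = 0`, `u'(0) = 1`: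
`u` is continuous, on each of `[0, α]` and `[α, 1]` it has an absolutely continuous derivative
(`w₁`, respectively `w₂`; one-sided at the end points), the equation
`u'' = q u - lam u + N(u)` holds almost everywhere, and `u'(α + 0) - u'(α - 0) = β u(α)`. -/
def IsSolution (α β : ℝ) (q N : ℝ → ℝ) (lam : ℝ) (u : ℝ → ℝ) : Prop :=
  ContinuousOn u (Set.Icc 0 1) ∧ u 0 = 0 ∧ u 1 = 0 ∧
  ∃ w₁ w₂ : ℝ → ℝ,
    (∀ x ∈ Set.Icc 0 α, HasDerivWithinAt u (w₁ x) (Set.Icc 0 α) x) ∧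
    (∀ x ∈ Set.Icc α 1, HasDerivWithinAt u (w₂ x) (Set.Icc α 1) x) ∧
    AbsolutelyContinuousOnInterval w₁ 0 α ∧
    AbsolutelyContinuousOnInterval w₂ α 1 ∧
    (∀ᵐ x, x ∈ Set.Ioo 0 α → HasDerivAt w₁ (q x * u x - lam * u x + N (u x)) x) ∧
    (∀ᵐ x, x ∈ Set.Ioo α 1 → HasDerivAt w₂ (q x * u x - lam * u x + N (u x)) x) ∧
    w₁ 0 = 1 ∧ w₂ α - w₁ α = β * u α

/-! ## The basic problem -/

/-- The roots in `[π² n², π² (n + 1)²)` of the characteristic equation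
`√l sin √l = - β sin (√l α) sin (√l (1 - α))`. -/
def basicRoots (α β : ℝ) (n : ℕ) : Set ℝ :=
  {l | l ∈ Set.Ico (Real.pi ^ 2 * (n : ℝ) ^ 2) (Real.pi ^ 2 * ((n : ℝ) + 1) ^ 2) ∧
    √l * Real.sin √l = -β * Real.sin (√l * α) * Real.sin (√l * (1 - α))}

/-- `lam0 α β n` is the root of the characteristic equation in `[π² n², π² (n + 1)²)`. -/
def lam0 (α β : ℝ) (n : ℕ) : ℝ := sInf (basicRoots α β n)

/-- The square root of `lam0`. -/
def om (α β : ℝ) (n : ℕ) : ℝ := √(lam0 α β n)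

/-- The coefficient of the right branch of the basic eigenfunction. -/
def c0 (α β : ℝ) (n : ℕ) : ℝ :=
  open Classical in
  if Real.sin (om α β n * (1 - α)) ≠ 0 then
    Real.sin (om α β n * α) / (om α β n * Real.sin (om α β n * (1 - α)))
  else -(Real.cos (om α β n) / om α β n)

/-- The basic eigenfunction. -/
def u0 (α β : ℝ) (n : ℕ) (x : ℝ) : ℝ :=
  open Classical in
  if x ≤ α then Real.sin (om α β n * x) / om α β n
  else c0 α β n * Real.sin (om α β n * (1 - x))

/-- `c̃ₙ`, which equals `lam0 * c0 ^ 2`. -/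
def cTilde (α β : ℝ) (n : ℕ) : ℝ :=
  Real.sin (om α β n * α) ^ 2 +
    (Real.cos (om α β n * α) + β / om α β n * Real.sin (om α β n * α)) ^ 2

/-- `Mₙ`, defined by `Mₙ / lam0 = ∫₀¹ u0²`. -/
def bigM (α β : ℝ) (n : ℕ) : ℝ := lam0 α β n * ∫ x in (0 : ℝ)..1, u0 α β n x ^ 2

/-- The constant `a(n)`. -/
def aConst (α β : ℝ) (n : ℕ) : ℝ :=
  (√(1 + (1 + β / om α β n) ^ 2) + 1) / om α β n

/-- The constant `b(n)`. -/
def bConst (α β : ℝ) (n : ℕ) : ℝ :=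
  max 1 (max (om α β n / bigM α β n) (om α β n * √(cTilde α β n) / bigM α β n))

/-! ## The corrections of the FD-method -/

/-- The right-hand side `F^{(j)}` of the equation for the `j`-th correction (`j ≥ 1`), given the
sequences of corrections. -/
def rhs (q N : ℝ → ℝ) (lam : ℕ → ℝ) (u : ℕ → ℝ → ℝ) (j : ℕ) (x : ℝ) : ℝ :=
  -(∑ p ∈ Finset.range j, lam (j - p) * u p x) + q x * u (j - 1) x +
    adomian N (j - 1) (fun p => u p x)

/-- The formula for `λ^{(j)}` (`j ≥ 1`) in terms of the earlier corrections. -/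
def lamFormula (α β : ℝ) (q N : ℝ → ℝ) (n : ℕ) (lam : ℕ → ℝ) (u : ℕ → ℝ → ℝ) (j : ℕ) : ℝ :=
  lam0 α β n / bigM α β n *
    (-(∑ p ∈ Finset.Ico 1 j, lam (j - p) * ∫ x in (0 : ℝ)..1, u0 α β n x * u p x) +
      (∫ x in (0 : ℝ)..1, q x * u (j - 1) x * u0 α β n x) +
      ∫ x in (0 : ℝ)..1, adomian N (j - 1) (fun p => u p x) * u0 α β n x)

/-- Right-hand side of the equation `c^{(j)} sin (√lam0 (1 - α)) = …` (continuity at `α`). -/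
def cRhs₁ (α β : ℝ) (n : ℕ) (F : ℝ → ℝ) : ℝ :=
  ∫ x in (0 : ℝ)..1, Real.sin (om α β n * (α - x)) / om α β n * F x

/-- Right-hand side of the equation `c^{(j)} cos (√lam0 (1 - α)) = …` (jump at `α`). -/
def cRhs₂ (α β : ℝ) (n : ℕ) (F : ℝ → ℝ) : ℝ :=
  -(∫ x in (0 : ℝ)..1, Real.cos (om α β n * (α - x)) / om α β n * F x) -
    β * ∫ x in (0 : ℝ)..α, Real.sin (om α β n * (α - x)) / lam0 α β n * F x

/-- The coefficient `c^{(j)}` for the right-hand side `F = F^{(j)}`, computed from the first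
equation if its left-hand side does not degenerate, and from the second one otherwise. -/
def cFormula (α β : ℝ) (n : ℕ) (F : ℝ → ℝ) : ℝ :=
  open Classical in
  if Real.sin (om α β n * (1 - α)) ≠ 0 then cRhs₁ α β n F / Real.sin (om α β n * (1 - α))
  else cRhs₂ α β n F / Real.cos (om α β n * (1 - α))

/-- The formula for `u^{(j)}` for the right-hand side `F = F^{(j)}`. -/
def uFormula (α β : ℝ) (n : ℕ) (F : ℝ → ℝ) (x : ℝ) : ℝ :=
  open Classical in
  if x ≤ α then ∫ y in (0 : ℝ)..x, Real.sin (om α β n * (x - y)) / om α β n * F y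
  else cFormula α β n F * Real.sin (om α β n * (1 - x)) -
    ∫ y in x..1, Real.sin (om α β n * (x - y)) / om α β n * F y

/-- The corrections computed up to index `j` (entries beyond `j` are meaningless). -/
def fdPrefix (α β : ℝ) (q N : ℝ → ℝ) (n : ℕ) : ℕ → (ℕ → ℝ) × (ℕ → ℝ → ℝ)
  | 0 => (fun _ => lam0 α β n, fun _ => u0 α β n)
  | j + 1 =>
    let lam := (fdPrefix α β q N n j).1
    let u := (fdPrefix α β q N n j).2
    let lam' := Function.update lam (j + 1) (lamFormula α β q N n lam u (j + 1))
    (lam', Function.update u (j + 1) (uFormula α β n (rhs q N lam' u (j + 1))))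

/-- The `j`-th correction `λₙ^{(j)}` of the FD-method. -/
def fdLam (α β : ℝ) (q N : ℝ → ℝ) (n j : ℕ) : ℝ := (fdPrefix α β q N n j).1 j

/-- The `j`-th correction `uₙ^{(j)}` of the FD-method. -/
def fdU (α β : ℝ) (q N : ℝ → ℝ) (n j : ℕ) : ℝ → ℝ := (fdPrefix α β q N n j).2 j

/-- The function `Fₙ^{(j)}`, `j ≥ 1`. -/
def fdF (α β : ℝ) (q N : ℝ → ℝ) (n j : ℕ) : ℝ → ℝ :=
  rhs q N (fdLam α β q N n) (fdU α β q N n) j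

/-- The coefficient `cₙ^{(j)}`, `j ≥ 1`. -/
def fdC (α β : ℝ) (q N : ℝ → ℝ) (n j : ℕ) : ℝ := cFormula α β n (fdF α β q N n j)

/-- The approximation of rank `m` to the eigenvalue. -/
def fdLamApprox (α β : ℝ) (q N : ℝ → ℝ) (n m : ℕ) : ℝ :=
  ∑ j ∈ Finset.range (m + 1), fdLam α β q N n j

/-- The approximation of rank `m` to the eigenfunction. -/
def fdUApprox (α β : ℝ) (q N : ℝ → ℝ) (n m : ℕ) (x : ℝ) : ℝ :=
  ∑ j ∈ Finset.range (m + 1), fdU α β q N n j x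

/-! ### The corrections satisfy the recurrence formulas -/

theorem fdPrefix_eq (α β : ℝ) (q N : ℝ → ℝ) (n : ℕ) {i k : ℕ} (h : i ≤ k) :
    (fdPrefix α β q N n k).1 i = fdLam α β q N n i ∧
      (fdPrefix α β q N n k).2 i = fdU α β q N n i := by
  induction k, h using Nat.le_induction with
  | base => exact ⟨rfl, rfl⟩
  | succ k hk ih =>
    have hne : i ≠ k + 1 := by omega
    simpa [fdPrefix, Function.update_of_ne hne] using ih

theorem fdLam_zero (α β : ℝ) (q N : ℝ → ℝ) (n : ℕ) : fdLam α β q N n 0 = lam0 α β n := rfl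

theorem fdU_zero (α β : ℝ) (q N : ℝ → ℝ) (n : ℕ) : fdU α β q N n 0 = u0 α β n := rfl

theorem adomian_congr (N : ℝ → ℝ) {k : ℕ} {v w : ℕ → ℝ} (h : ∀ p ≤ k, v p = w p) :
    adomian N k v = adomian N k w := by
  have : ∀ t : ℝ, ∑ p ∈ Finset.range (k + 1), v p * t ^ p =
      ∑ p ∈ Finset.range (k + 1), w p * t ^ p := fun t =>
    Finset.sum_congr rfl fun p hp => by rw [h p (by simpa [Nat.lt_succ_iff] using hp)]
  simp only [adomian, this]

theorem fdLam_succ (α β : ℝ) (q N : ℝ → ℝ) (n j : ℕ) :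
    fdLam α β q N n (j + 1) =
      lamFormula α β q N n (fdLam α β q N n) (fdU α β q N n) (j + 1) := by
  have h := fun i (hi : i ≤ j) => fdPrefix_eq α β q N n hi
  have e : fdLam α β q N n (j + 1) = lamFormula α β q N n (fdPrefix α β q N n j).1
      (fdPrefix α β q N n j).2 (j + 1) := by
    simp [fdLam, fdPrefix]
  rw [e]
  unfold lamFormula
  have hA : ∀ x, adomian N (j + 1 - 1) (fun p => (fdPrefix α β q N n j).2 p x) =
      adomian N (j + 1 - 1) (fun p => fdU α β q N n p x) := fun x =>
    adomian_congr N fun p hp => by rw [(h p (by omega)).2]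
  have hS : ∑ p ∈ Finset.Ico 1 (j + 1), (fdPrefix α β q N n j).1 (j + 1 - p) *
        (∫ x in (0 : ℝ)..1, u0 α β n x * (fdPrefix α β q N n j).2 p x) =
      ∑ p ∈ Finset.Ico 1 (j + 1), fdLam α β q N n (j + 1 - p) *
        ∫ x in (0 : ℝ)..1, u0 α β n x * fdU α β q N n p x :=
    Finset.sum_congr rfl fun p hp => by
      have := Finset.mem_Ico.1 hp
      rw [(h p (by omega)).2, (h (j + 1 - p) (by omega)).1]
  rw [hS, (h (j + 1 - 1) (by omega)).2]
  simp only [hA]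

theorem fdU_succ (α β : ℝ) (q N : ℝ → ℝ) (n j : ℕ) :
    fdU α β q N n (j + 1) = uFormula α β n (fdF α β q N n (j + 1)) := by
  have h := fun i (hi : i ≤ j) => fdPrefix_eq α β q N n hi
  have e : fdU α β q N n (j + 1) = uFormula α β n (rhs q N (fdPrefix α β q N n (j + 1)).1
      (fdPrefix α β q N n j).2 (j + 1)) := by
    simp [fdU, fdPrefix]
  rw [e]
  congr 1
  funext x
  unfold fdF rhs
  have hA : adomian N (j + 1 - 1) (fun p => (fdPrefix α β q N n j).2 p x) =
      adomian N (j + 1 - 1) (fun p => fdU α β q N n p x) :=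
    adomian_congr N fun p hp => by rw [(h p (by omega)).2]
  have hS : ∑ p ∈ Finset.range (j + 1), (fdPrefix α β q N n (j + 1)).1 (j + 1 - p) *
        (fdPrefix α β q N n j).2 p x =
      ∑ p ∈ Finset.range (j + 1), fdLam α β q N n (j + 1 - p) * fdU α β q N n p x :=
    Finset.sum_congr rfl fun p hp => by
      have := Finset.mem_range.1 hp
      rw [(h p (by omega)).2,
        (fdPrefix_eq α β q N n (show j + 1 - p ≤ j + 1 by omega)).1]
  rw [hS, (h (j + 1 - 1) (by omega)).2, hA]

/-! ## The majorant sequence and its generating function -/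

/-- `v̄₀ = b(n) ‖u0‖`. -/
def v0 (α β : ℝ) (n : ℕ) : ℝ := bConst α β n * supNorm (u0 α β n)

/-- `Ñ₁(v) = Ñ(‖u0‖ + v)`. -/
def majorantFun₁ (α β : ℝ) (a : ℕ → ℝ) (n : ℕ) (v : ℝ) : ℝ :=
  majorantFun a (supNorm (u0 α β n) + v)

/-- The recurrence formula for `v̄_j`, `j ≥ 1`, in terms of the earlier values. -/
def vBarFormula (α β : ℝ) (q : ℝ → ℝ) (a : ℕ → ℝ) (n : ℕ) (v : ℕ → ℝ) (j : ℕ) : ℝ :=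
  if j = 1 then
    (1 + v0 α β n) * (normL1 q * v0 α β n + deriv (majorantFun₁ α β a n) 0 * v0 α β n)
  else
    ∑ p ∈ Finset.Ico 1 j, v (j - p) * v p +
      (1 + v0 α β n) * (normL1 q * v (j - 1) +
        adomian (majorantFun₁ α β a n) (j - 1) (fun p => if p = 0 then 0 else v p))

/-- The majorants computed up to index `j` (entries beyond `j` are meaningless). -/
def vBarPrefix (α β : ℝ) (q : ℝ → ℝ) (a : ℕ → ℝ) (n : ℕ) : ℕ → ℕ → ℝ
  | 0 => fun _ => v0 α β n
  | j + 1 =>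
    let v := vBarPrefix α β q a n j
    Function.update v (j + 1) (vBarFormula α β q a n v (j + 1))

/-- The majorant sequence `v̄_j`. -/
def vBar (α β : ℝ) (q : ℝ → ℝ) (a : ℕ → ℝ) (n j : ℕ) : ℝ := vBarPrefix α β q a n j j

theorem vBarPrefix_eq (α β : ℝ) (q : ℝ → ℝ) (a : ℕ → ℝ) (n : ℕ) {i k : ℕ} (h : i ≤ k) :
    vBarPrefix α β q a n k i = vBar α β q a n i := by
  induction k, h using Nat.le_induction with
  | base => rfl
  | succ k hk ih =>
    have hne : i ≠ k + 1 := by omega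
    simpa [vBarPrefix, Function.update_of_ne hne] using ih

theorem vBar_zero (α β : ℝ) (q : ℝ → ℝ) (a : ℕ → ℝ) (n : ℕ) :
    vBar α β q a n 0 = v0 α β n := rfl

theorem vBar_succ (α β : ℝ) (q : ℝ → ℝ) (a : ℕ → ℝ) (n j : ℕ) :
    vBar α β q a n (j + 1) = vBarFormula α β q a n (vBar α β q a n) (j + 1) := by
  have h := fun i (hi : i ≤ j) => vBarPrefix_eq α β q a n hi
  have e : vBar α β q a n (j + 1) =
      vBarFormula α β q a n (vBarPrefix α β q a n j) (j + 1) := by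
    simp [vBar, vBarPrefix]
  rw [e]
  unfold vBarFormula
  have hA : adomian (majorantFun₁ α β a n) (j + 1 - 1)
        (fun p => if p = 0 then 0 else vBarPrefix α β q a n j p) =
      adomian (majorantFun₁ α β a n) (j + 1 - 1)
        (fun p => if p = 0 then 0 else vBar α β q a n p) :=
    adomian_congr _ fun p hp => by rw [h p (by omega)]
  have hS : ∑ p ∈ Finset.Ico 1 (j + 1), vBarPrefix α β q a n j (j + 1 - p) *
        vBarPrefix α β q a n j p =
      ∑ p ∈ Finset.Ico 1 (j + 1), vBar α β q a n (j + 1 - p) * vBar α β q a n p :=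
    Finset.sum_congr rfl fun p hp => by
      have := Finset.mem_Ico.1 hp
      rw [h p (by omega), h (j + 1 - p) (by omega)]
  rw [hS, h (j + 1 - 1) (by omega), hA]

/-- The radius of convergence `R` of the generating function `f(z) = ∑_{j ≥ 1} v̄_j z ^ j`. -/
def genRadius (α β : ℝ) (q : ℝ → ℝ) (a : ℕ → ℝ) (n : ℕ) : ℝ≥0∞ :=
  (FormalMultilinearSeries.ofScalars ℝ
    (fun j : ℕ => if j = 0 then (0 : ℝ) else vBar α β q a n j)).radius

/-- `1 / R` as a real number (for `R > 0`), with `1 / ∞ = 0`. -/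
def invR (α β : ℝ) (q : ℝ → ℝ) (a : ℕ → ℝ) (n : ℕ) : ℝ := (genRadius α β q a n)⁻¹.toReal

/-- `rₙ = (1 + √(1 + (1 + β / √lam0)²)) / (√lam0 R) = a(n) / R`. -/
def ratio (α β : ℝ) (q : ℝ → ℝ) (a : ℕ → ℝ) (n : ℕ) : ℝ := aConst α β n * invR α β q a n

/-- `α_j = c / j ^ (1 + ε)`. -/
def alphaSeq (c ε : ℝ) (j : ℕ) : ℝ := c / (j : ℝ) ^ (1 + ε)

/-- `C_{n,m} = α_{m+1} Mₙ / (1 - rₙ)`. -/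
def bigC (α β : ℝ) (q : ℝ → ℝ) (a : ℕ → ℝ) (c ε : ℝ) (n m : ℕ) : ℝ :=
  alphaSeq c ε (m + 1) * bigM α β n / (1 - ratio α β q a n)

/-- The bound for the error of the eigenfunction. -/
def uBound (α β : ℝ) (q : ℝ → ℝ) (a : ℕ → ℝ) (c ε : ℝ) (n m : ℕ) : ℝ :=
  bigC α β q a c ε n m *
    min (1 / bigM α β n) (min (1 / om α β n) (1 / (om α β n * √(cTilde α β n)))) *
    ratio α β q a n ^ (m + 1)

/-- The bound for the error of the eigenvalue. -/
def lamBound (α β : ℝ) (q : ℝ → ℝ) (a : ℕ → ℝ) (c ε : ℝ) (n m : ℕ) : ℝ :=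
  bigC α β q a c ε n m /
      (bigM α β n +
        max 1 (max (cTilde α β n) (√(cTilde α β n) * bigM α β n / om α β n))) *
    invR α β q a n * ratio α β q a n ^ m

end FDMethod

end

open FDMethod

noncomputable section

namespace FDMethod

/-! Each correction solves a linear problem `u'' + λ⁽⁰⁾u = F` with the delta condition at `α`, where
`λ⁽⁰⁾` is an eigenvalue. It is solvable exactly because `λ⁽ʲ⁾` is chosen to make `F⁽ʲ⁾` orthogonal
to the basic eigenfunction (`orthogonal_rhs`, `c_compatibility`), and then `‖u⁽ʲ⁾‖ ≤ a(n) ‖F⁽ʲ⁾‖₁`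
(`supNorm_uFormula_le`) while `λ⁽ʲ⁾` is controlled through `b(n)` (`abs_lamFormula_le`). Adomian
polynomials are coefficients of a composition of power series (`adomian_eq`), hence monotone under
majorants. An induction gives `b(n) ‖u⁽ʲ⁾‖ ≤ a(n)ʲ v̄ⱼ` and `(1 + v̄₀) |λ⁽ʲ⁾| ≤ a(n)ʲ⁻¹ v̄ⱼ`
(`fd_estimates`).

The generating function of the `v̄ⱼ` satisfies `V = V² + z h(V)` with `h` entire and nonnegative
coefficients, that is `V = z φ(V)` with `φ = h / (1 - V)`. Lagrange inversion and a sharp bound for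
binomial probabilities give, for every `t` in `(0, 1)`, `vₘ ≤ c m^(-3/2) (h(t) / (t(1 - t)))ᵐ`
(`coeff_bound`). When `h(0) > 0`, the maximum over `t` of `t(1 - t) / h(t)` is exactly the radius
`R`: the bound gives one inequality, and evaluating the functional equation inside the disc of
convergence gives the other (`coeff_asymptotics`). Thus the estimate holds with the exact rate `1/R`
and a summable factor `αⱼ = c / j^(3/2)`.

For large `n`, `v̄₀` stays bounded, because `b(n)` is of order at most `ω` and `‖u⁽⁰⁾‖` of order at
most `1/ω`; so `1/R ≤ 4 h(1/2)` stays bounded while `a(n)` tends to zero, whence `rₙ < 1`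
(`exists_admissible`). The series then converge absolutely. Cauchy products sum the right-hand sides
to `-(λ - λ⁽⁰⁾)u + qu + N(u)`, so the sum solves an integral equation, which is the full problem in
another form (`isSolution_tsum`, `isSolution_of_eq`). Geometric tails yield the error bounds, and
`αₘ₊₁ → 0` yields the superexponential rate. -/

/-! ## Powers of power series and composition -/

/-- The coefficient of `X ^ k` in `(∑ v i X ^ i) ^ p`. -/
def powCoeff (v : ℕ → ℝ) (p k : ℕ) : ℝ := PowerSeries.coeff k (PowerSeries.mk v ^ p)

theorem powCoeff_zero (v : ℕ → ℝ) (k : ℕ) : powCoeff v 0 k = if k = 0 then 1 else 0 := by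
  simp [powCoeff, PowerSeries.coeff_one]

theorem powCoeff_succ (v : ℕ → ℝ) (p k : ℕ) :
    powCoeff v (p + 1) k =
      ∑ ij ∈ Finset.HasAntidiagonal.antidiagonal k, powCoeff v p ij.1 * v ij.2 := by
  simp [powCoeff, pow_succ, PowerSeries.coeff_mul]

theorem powCoeff_one (v : ℕ → ℝ) (k : ℕ) : powCoeff v 1 k = v k := by
  simp [powCoeff]

theorem powCoeff_rescale (v : ℕ → ℝ) (t : ℝ) (p k : ℕ) :
    powCoeff (fun i => t ^ i * v i) p k = t ^ k * powCoeff v p k := by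
  unfold powCoeff
  rw [← PowerSeries.rescale_mk, ← map_pow, PowerSeries.coeff_rescale]

/-- Majorants multiply. Only indices up to `K` enter, so the bound can be used inside inductions
where later terms are not yet controlled. -/
theorem abs_powCoeff_le {v w : ℕ → ℝ} (p : ℕ) {K : ℕ} (h : ∀ i ≤ K, |v i| ≤ w i) :
    ∀ k ≤ K, |powCoeff v p k| ≤ powCoeff w p k := by
  induction p with
  | zero => intro k _; simp only [powCoeff_zero]; split_ifs <;> simp
  | succ p ih =>
    intro k hk
    rw [powCoeff_succ, powCoeff_succ]
    refine (Finset.abs_sum_le_sum_abs _ _).trans (Finset.sum_le_sum fun ij hij => ?_)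
    have := Finset.HasAntidiagonal.mem_antidiagonal.1 hij
    rw [abs_mul]
    exact mul_le_mul (ih _ (by omega)) (h _ (by omega)) (abs_nonneg _)
      ((abs_nonneg _).trans (ih _ (by omega)))

theorem powCoeff_nonneg {w : ℕ → ℝ} (h : ∀ i, 0 ≤ w i) (p k : ℕ) : 0 ≤ powCoeff w p k :=
  (abs_nonneg _).trans (abs_powCoeff_le p (K := k)
    (fun i _ => (abs_of_nonneg (h i)).le) k le_rfl)

theorem powCoeff_congr {v w : ℕ → ℝ} (p : ℕ) {K : ℕ} (h : ∀ i ≤ K, v i = w i) :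
    ∀ k ≤ K, powCoeff v p k = powCoeff w p k := by
  induction p with
  | zero => intro k _; simp only [powCoeff_zero]
  | succ p ih =>
    intro k hk
    rw [powCoeff_succ, powCoeff_succ]
    refine Finset.sum_congr rfl fun ij hij => ?_
    have := Finset.HasAntidiagonal.mem_antidiagonal.1 hij
    rw [ih _ (by omega), h _ (by omega)]

theorem summable_hasSum_powCoeff {v : ℕ → ℝ} (hv : Summable fun i => |v i|) (p : ℕ) :
    (Summable fun k => |powCoeff v p k|) ∧ HasSum (powCoeff v p) ((∑' i, v i) ^ p) := by
  induction p with
  | zero =>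
    have h : ∀ k, k ≠ 0 → powCoeff v 0 k = 0 := fun k hk => by simp [powCoeff_zero, hk]
    constructor
    · exact summable_of_ne_finset_zero (s := {0}) fun k hk => by
        rw [h k (by simpa using hk), abs_zero]
    · have := hasSum_single 0 h
      simpa [powCoeff_zero] using this
  | succ p ih =>
    have e : powCoeff v (p + 1) = fun k =>
      ∑ ij ∈ Finset.HasAntidiagonal.antidiagonal k, powCoeff v p ij.1 * v ij.2 := funext (powCoeff_succ v p)
    have hs := summable_norm_sum_mul_antidiagonal_of_summable_norm (f := powCoeff v p) (g := v)
      (by simpa using ih.1) (by simpa using hv)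
    have ht := tsum_mul_tsum_eq_tsum_sum_antidiagonal_of_summable_norm (f := powCoeff v p) (g := v)
      (by simpa using ih.1) (by simpa using hv)
    rw [← e] at ht
    simp_rw [← powCoeff_succ] at hs
    refine ⟨by simpa using hs, ?_⟩
    rw [pow_succ, ← ih.2.tsum_eq, ht]
    exact hs.of_norm.hasSum

theorem powCoeff_eq_zero_of_lt {v : ℕ → ℝ} (h0 : v 0 = 0) {p k : ℕ} (h : k < p) :
    powCoeff v p k = 0 := by
  unfold powCoeff
  apply PowerSeries.coeff_of_lt_order
  refine lt_of_lt_of_le (by exact_mod_cast h) (PowerSeries.le_order_pow_of_constantCoeff_eq_zero p ?_)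
  simpa [← PowerSeries.coeff_zero_eq_constantCoeff_apply] using h0

theorem summable_abs_mul_pow {a : ℕ → ℝ} (ha : ∀ u : ℝ, Summable fun p : ℕ => a p * u ^ p)
    (u : ℝ) : Summable fun p : ℕ => |a p| * u ^ p := by
  have h := (ha u).abs
  refine h.of_norm_bounded fun p => ?_
  simp [abs_mul]

/-- The coefficients of the composition of an entire power series with a power series. -/
def compCoeff (a v : ℕ → ℝ) (k : ℕ) : ℝ := ∑' p, a p * powCoeff v p k

/-- Replacing `a`, `v` by absolute values and summing over `k` first leaves `|a p| (∑ |v i|) ^ p`,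
summable because the outer series is entire. -/
theorem summable_prod_comp {a v : ℕ → ℝ} (ha : ∀ u : ℝ, Summable fun p : ℕ => a p * u ^ p)
    (hv : Summable fun i => |v i|) :
    Summable fun x : ℕ × ℕ => a x.1 * powCoeff v x.1 x.2 := by
  have hw : ∀ i, |v i| ≤ |v i| := fun i => le_rfl
  have h1 : Summable fun x : ℕ × ℕ => |a x.1| * powCoeff (fun i => |v i|) x.1 x.2 := by
    rw [summable_prod_of_nonneg]
    · constructor
      · intro p
        exact ((summable_hasSum_powCoeff (v := fun i => |v i|)
          (by simpa using hv) p).2.summable).mul_left |a p|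
      · have : ∀ p, ∑' k, |a p| * powCoeff (fun i => |v i|) p k = |a p| * (∑' i, |v i|) ^ p := by
          intro p
          rw [tsum_mul_left,
            (summable_hasSum_powCoeff (v := fun i => |v i|) (by simpa using hv) p).2.tsum_eq]
        simp only [this]
        exact summable_abs_mul_pow ha _
    · intro x
      exact mul_nonneg (abs_nonneg _) (powCoeff_nonneg (fun i => abs_nonneg _) _ _)
  refine h1.of_norm_bounded fun x => ?_
  rw [Real.norm_eq_abs, abs_mul]
  exact mul_le_mul_of_nonneg_left
    (abs_powCoeff_le x.1 (K := x.2) (fun i _ => le_rfl) x.2 le_rfl) (abs_nonneg _)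

theorem hasSum_compCoeff {a v : ℕ → ℝ} (ha : ∀ u : ℝ, Summable fun p : ℕ => a p * u ^ p)
    (hv : Summable fun i => |v i|) :
    HasSum (compCoeff a v) (powerFun a (∑' i, v i)) := by
  have h := summable_prod_comp ha hv
  have h2 := (Equiv.prodComm ℕ ℕ).summable_iff.2 h
  have e1 : ∑' x : ℕ × ℕ, a x.1 * powCoeff v x.1 x.2 = powerFun a (∑' i, v i) := by
    rw [h.tsum_prod]
    simp only [tsum_mul_left, (summable_hasSum_powCoeff hv _).2.tsum_eq]
    rfl
  have e2 := h2.prod.hasSum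
  rw [← h2.tsum_prod] at e2
  rw [← e1, ← Equiv.tsum_eq (Equiv.prodComm ℕ ℕ) (fun x : ℕ × ℕ => a x.1 * powCoeff v x.1 x.2)]
  exact e2

/-! ## Adomian polynomials -/

theorem summable_mul_powCoeff {a : ℕ → ℝ} (ha : ∀ u : ℝ, Summable fun p : ℕ => a p * u ^ p)
    (v : ℕ → ℝ) (k : ℕ) : Summable fun p => a p * powCoeff v p k := by
  have hv : Summable fun i => |(fun i => if i ≤ k then v i else 0) i| :=
    summable_of_ne_finset_zero (s := Finset.range (k + 1)) fun i hi => by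
      simp at hi; simp [show ¬ i ≤ k by omega]
  have h2 := (Equiv.prodComm ℕ ℕ).summable_iff.2 (summable_prod_comp ha hv)
  refine (h2.prod_factor k).congr fun p => ?_
  simp only [Function.comp, Equiv.prodComm_apply, Prod.swap]
  rw [powCoeff_congr p (K := k) (w := v) (fun i hi => by simp [hi]) k le_rfl]

/-- The inner polynomial composed with `N` is a convergent power series in `t`, and its `k`-th
Taylor coefficient at `0` is the Adomian polynomial. This removes all derivatives from the rest of
the argument. -/
theorem adomian_eq {a : ℕ → ℝ} (ha : ∀ u : ℝ, Summable fun p : ℕ => a p * u ^ p)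
    (k : ℕ) (v : ℕ → ℝ) : adomian (powerFun a) k v = compCoeff a v k := by
  -- Truncation makes the inner series finite, hence summable for every `t`; coefficients up to
  -- index `k` do not see it.
  set W : ℕ → ℝ := fun i => if i ≤ k then v i else 0 with hW
  have hz : ∀ i, i ∉ Finset.range (k + 1) → W i = 0 := fun i hi => by
    simp at hi; simp [hW, show ¬ i ≤ k by omega]
  have key : ∀ t : ℝ, HasSum (fun j => t ^ j * compCoeff a W j)
      (powerFun a (∑ p ∈ Finset.range (k + 1), v p * t ^ p)) := by
    intro t
    have hs : Summable fun i => |t ^ i * W i| :=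
      summable_of_ne_finset_zero (s := Finset.range (k + 1)) fun i hi => by simp [hz i hi]
    have := hasSum_compCoeff ha hs
    rw [tsum_eq_sum (s := Finset.range (k + 1)) fun i hi => by simp [hz i hi]] at this
    have e : ∑ i ∈ Finset.range (k + 1), t ^ i * W i =
        ∑ p ∈ Finset.range (k + 1), v p * t ^ p := Finset.sum_congr rfl fun i hi => by
      simp at hi; simp [hW, show i ≤ k by omega, mul_comm]
    rw [e] at this
    convert this using 2 with j
    simp only [compCoeff, powCoeff_rescale]
    rw [← tsum_mul_left]
    exact tsum_congr fun p => by ring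
  have hps : HasFPowerSeriesAt
      (fun t : ℝ => powerFun a (∑ p ∈ Finset.range (k + 1), v p * t ^ p))
      (FormalMultilinearSeries.ofScalars ℝ (compCoeff a W)) 0 := by
    rw [hasFPowerSeriesAt_iff]
    refine Filter.Eventually.of_forall fun t => ?_
    simpa [FormalMultilinearSeries.coeff_ofScalars] using key t
  obtain ⟨r, hr⟩ := hps
  have := hr.factorial_smul 1 k
  unfold adomian
  rw [iteratedDeriv, ← this]
  simp only [FormalMultilinearSeries.apply_eq_pow_smul_coeff,
    FormalMultilinearSeries.coeff_ofScalars]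
  simp only [one_pow, one_smul, nsmul_eq_mul]
  rw [mul_div_cancel_left₀ _ (by positivity)]
  exact tsum_congr fun p => by
    rw [powCoeff_congr p (K := k) (w := v) (fun i hi => by simp [hW, hi]) k le_rfl]

theorem adomian_scale {a : ℕ → ℝ} (ha : ∀ u : ℝ, Summable fun p : ℕ => a p * u ^ p)
    (k : ℕ) (v : ℕ → ℝ) (t : ℝ) :
    adomian (powerFun a) k (fun i => t ^ i * v i) = t ^ k * adomian (powerFun a) k v := by
  rw [adomian_eq ha, adomian_eq ha]
  simp only [compCoeff, powCoeff_rescale]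
  rw [← tsum_mul_left]
  exact tsum_congr fun p => by ring

theorem majorantFun_eq (a : ℕ → ℝ) : majorantFun a = powerFun (fun p => |a p|) := rfl

theorem abs_adomian_le {a : ℕ → ℝ} (ha : ∀ u : ℝ, Summable fun p : ℕ => a p * u ^ p)
    {k : ℕ} {v w : ℕ → ℝ} (h : ∀ i ≤ k, |v i| ≤ w i) :
    |adomian (powerFun a) k v| ≤ adomian (majorantFun a) k w := by
  rw [adomian_eq ha, majorantFun_eq, adomian_eq (summable_abs_mul_pow ha)]
  have hs := summable_mul_powCoeff ha v k
  have h1 := norm_tsum_le_tsum_norm (f := fun p => a p * powCoeff v p k) (by simpa using hs.abs)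
  refine h1.trans ?_
  refine Summable.tsum_le_tsum (fun p => ?_) (by simpa using hs.abs)
    (summable_mul_powCoeff (summable_abs_mul_pow ha) w k)
  rw [norm_mul, Real.norm_eq_abs, Real.norm_eq_abs]
  exact mul_le_mul_of_nonneg_left (abs_powCoeff_le p h k le_rfl) (abs_nonneg _)

theorem powCoeff_apply_zero (v : ℕ → ℝ) (p : ℕ) : powCoeff v p 0 = v 0 ^ p := by
  simp [powCoeff]

/-- For `k ≥ 1` every product in the expansion contains a factor of positive index. One such factor
absorbs `b`, and all others only need `w ≤ v`. The entry of index `0` is therefore allowed to be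
equal in both sequences, without the factor `b`. -/
theorem mul_powCoeff_le {b : ℝ} (hb : 1 ≤ b) {v w : ℕ → ℝ} (hw : ∀ i, 0 ≤ w i)
    (h0 : w 0 = v 0) {K : ℕ} (h : ∀ i, 1 ≤ i → i ≤ K → b * w i ≤ v i) (p : ℕ) :
    ∀ k, 1 ≤ k → k ≤ K → b * powCoeff w p k ≤ powCoeff v p k := by
  have hvw : ∀ i ≤ K, |w i| ≤ v i := fun i hi => by
    rw [abs_of_nonneg (hw i)]
    rcases Nat.eq_zero_or_pos i with rfl | h'
    · exact h0.le
    · nlinarith [h i h' hi, hw i]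
  have hv : ∀ i ≤ K, 0 ≤ v i := fun i hi => (abs_nonneg _).trans (hvw i hi)
  induction p with
  | zero => intro k hk _; simp [powCoeff_zero, show k ≠ 0 by omega]
  | succ p ih =>
    intro k hk hkK
    rw [powCoeff_succ, powCoeff_succ, Finset.mul_sum]
    refine Finset.sum_le_sum fun ij hij => ?_
    have hij := Finset.HasAntidiagonal.mem_antidiagonal.1 hij
    rcases Nat.eq_zero_or_pos ij.2 with hz | hz
    · rw [hz, h0, ← mul_assoc]
      exact mul_le_mul_of_nonneg_right (ih _ (by omega) (by omega)) (hv 0 (by omega))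
    · rw [mul_left_comm]
      refine mul_le_mul ((le_abs_self _).trans (abs_powCoeff_le p hvw _ (by omega)))
        (h _ hz (by omega)) (mul_nonneg (by linarith) (hw _)) ?_
      exact (abs_nonneg _).trans (abs_powCoeff_le p hvw _ (by omega))

theorem mul_adomian_le {a : ℕ → ℝ} (ha : ∀ u : ℝ, Summable fun p : ℕ => a p * u ^ p)
    {b : ℝ} (hb : 1 ≤ b) {v w : ℕ → ℝ} (hw : ∀ i, 0 ≤ w i)
    (h0 : w 0 = v 0) {k : ℕ} (hk : 1 ≤ k) (h : ∀ i, 1 ≤ i → i ≤ k → b * w i ≤ v i) :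
    b * adomian (majorantFun a) k w ≤ adomian (majorantFun a) k v := by
  have ha' := summable_abs_mul_pow ha
  rw [majorantFun_eq, adomian_eq ha', adomian_eq ha', compCoeff, compCoeff, ← tsum_mul_left]
  refine Summable.tsum_le_tsum (fun p => ?_) ((summable_mul_powCoeff ha' w k).mul_left b)
    (summable_mul_powCoeff ha' v k)
  rw [mul_left_comm]
  exact mul_le_mul_of_nonneg_left (mul_powCoeff_le hb hw h0 h p k hk le_rfl) (abs_nonneg _)

theorem hasSum_adomian {a : ℕ → ℝ} (ha : ∀ u : ℝ, Summable fun p : ℕ => a p * u ^ p)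
    {v : ℕ → ℝ} (hv : Summable fun i => |v i|) :
    HasSum (fun k => adomian (powerFun a) k v) (powerFun a (∑' i, v i)) := by
  simp only [adomian_eq ha]
  exact hasSum_compCoeff ha hv

/-! ## Shifted majorant functions -/

/-- The sequence `s, 1, 0, 0, …`. -/
def shiftSeq (s : ℝ) (i : ℕ) : ℝ := if i = 0 then s else if i = 1 then 1 else 0

theorem shiftSeq_nonneg {s : ℝ} (hs : 0 ≤ s) (i : ℕ) : 0 ≤ shiftSeq s i := by
  unfold shiftSeq; split_ifs <;> simp [hs]

/-- The Taylor coefficients of `v ↦ Ñ(s + v)`. -/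
def shiftCoeff (a : ℕ → ℝ) (s : ℝ) : ℕ → ℝ := compCoeff (fun p => |a p|) (shiftSeq s)

theorem shiftCoeff_nonneg (a : ℕ → ℝ) {s : ℝ} (hs : 0 ≤ s) (k : ℕ) : 0 ≤ shiftCoeff a s k :=
  tsum_nonneg fun _ => mul_nonneg (abs_nonneg _) (powCoeff_nonneg (shiftSeq_nonneg hs) _ _)

theorem hasSum_shiftCoeff {a : ℕ → ℝ} (ha : ∀ u : ℝ, Summable fun p : ℕ => a p * u ^ p)
    (s u : ℝ) : HasSum (fun k => shiftCoeff a s k * u ^ k) (majorantFun a (s + u)) := by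
  have hz : ∀ i, i ∉ Finset.range 2 → u ^ i * shiftSeq s i = 0 := fun i hi => by
    simp at hi; simp [shiftSeq, show i ≠ 0 by omega, show i ≠ 1 by omega]
  have h := hasSum_compCoeff (v := fun i => u ^ i * shiftSeq s i) (summable_abs_mul_pow ha)
    (summable_of_ne_finset_zero (s := Finset.range 2) fun i hi => by simp [hz i hi])
  rw [tsum_eq_sum hz] at h
  simp only [Finset.sum_range_succ, Finset.sum_range_zero, shiftSeq] at h
  simp only [pow_zero, if_true, one_ne_zero, if_false, pow_one, mul_one, one_mul, zero_add] at h
  refine h.congr_fun fun k => ?_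
  simp only [shiftCoeff, compCoeff]
  rw [← tsum_mul_right]
  refine tsum_congr fun p => ?_
  have := powCoeff_rescale (shiftSeq s) u p k
  simp only [shiftSeq] at this ⊢
  rw [this]
  ring

theorem powerFun_shiftCoeff {a : ℕ → ℝ} (ha : ∀ u : ℝ, Summable fun p : ℕ => a p * u ^ p)
    (s : ℝ) : powerFun (shiftCoeff a s) = fun u => majorantFun a (s + u) :=
  funext fun u => (hasSum_shiftCoeff ha s u).tsum_eq

theorem powCoeff_X (p k : ℕ) :
    powCoeff (fun i => if i = 1 then 1 else 0) p k = if k = p then 1 else 0 := by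
  have : PowerSeries.mk (fun i : ℕ => if i = 1 then (1 : ℝ) else 0) = PowerSeries.X := by
    ext n; simp [PowerSeries.coeff_X]
  rw [powCoeff, this, PowerSeries.coeff_X_pow]

/-- The first Adomian polynomial of the sequence `0, 1` is the derivative at `0`, so no separate
differentiation of the series is needed. -/
theorem deriv_powerFun_zero {a : ℕ → ℝ} (ha : ∀ u : ℝ, Summable fun p : ℕ => a p * u ^ p) :
    deriv (powerFun a) 0 = a 1 := by
  have h := adomian_eq ha 1 (fun i => if i = 1 then 1 else 0)
  simp only [compCoeff, powCoeff_X] at h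
  rw [tsum_eq_single 1 (fun p hp => by simp [hp.symm])] at h
  simpa [adomian, iteratedDeriv_one, Finset.sum_range_succ] using h

theorem deriv_shift {a : ℕ → ℝ} (ha : ∀ u : ℝ, Summable fun p : ℕ => a p * u ^ p) (s : ℝ) :
    deriv (fun v => majorantFun a (s + v)) 0 = shiftCoeff a s 1 := by
  rw [← powerFun_shiftCoeff ha, deriv_powerFun_zero fun u => (hasSum_shiftCoeff ha s u).summable]

theorem majorantFun_nonneg (a : ℕ → ℝ) {s : ℝ} (hs : 0 ≤ s) : 0 ≤ majorantFun a s :=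
  tsum_nonneg fun _ => mul_nonneg (abs_nonneg _) (pow_nonneg hs _)

theorem majorantFun_mono {a : ℕ → ℝ} (ha : ∀ u : ℝ, Summable fun p : ℕ => a p * u ^ p)
    {s t : ℝ} (hs : 0 ≤ s) (hst : s ≤ t) : majorantFun a s ≤ majorantFun a t :=
  Summable.tsum_le_tsum (fun p => mul_le_mul_of_nonneg_left (pow_le_pow_left₀ hs hst p)
    (abs_nonneg _)) (summable_abs_mul_pow ha s) (summable_abs_mul_pow ha t)

theorem shiftCoeff_one_le {a : ℕ → ℝ} (ha : ∀ u : ℝ, Summable fun p : ℕ => a p * u ^ p)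
    {s : ℝ} (hs : 0 ≤ s) : shiftCoeff a s 1 ≤ majorantFun a (s + 1) := by
  have h := hasSum_shiftCoeff ha s 1
  simpa using le_hasSum h 1 fun k _ => by simpa using shiftCoeff_nonneg a hs k

/-- This is `Ñ(s) ≤ s Ñ'(s)`, valid termwise since `s ^ p ≤ p s ^ p` for `p ≥ 1` and there is no
constant term. It links the first correction, which involves `Ñ(‖u0‖)`, with the derivative used in
`v̄₁`. -/
theorem majorantFun_le_mul {a : ℕ → ℝ} (ha0 : a 0 = 0)
    (ha : ∀ u : ℝ, Summable fun p : ℕ => a p * u ^ p)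
    {s : ℝ} (hs : 0 ≤ s) : majorantFun a s ≤ s * shiftCoeff a s 1 := by
  have h1 : ∀ p, s ^ p ≤ powCoeff (shiftSeq s) (p + 1) 1 := fun p => by
    rw [powCoeff_succ]
    have : ((0 : ℕ), 1) ∈ Finset.HasAntidiagonal.antidiagonal 1 := by simp
    refine le_trans ?_ (Finset.single_le_sum (fun ij _ => ?_) this)
    · simp [powCoeff_apply_zero, shiftSeq]
    · exact mul_nonneg (powCoeff_nonneg (shiftSeq_nonneg hs) _ _) (shiftSeq_nonneg hs _)
  rw [shiftCoeff, compCoeff, ← tsum_mul_left]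
  refine Summable.tsum_le_tsum (fun p => ?_) (summable_abs_mul_pow ha s)
    ((summable_mul_powCoeff (summable_abs_mul_pow ha) _ _).mul_left s)
  rcases p with _ | p
  · simp [ha0]
  · rw [mul_left_comm, pow_succ, mul_comm (s ^ p)]
    exact mul_le_mul_of_nonneg_left (mul_le_mul_of_nonneg_left (h1 p) hs) (abs_nonneg _)

theorem adomian_shift (a : ℕ → ℝ) (s : ℝ) (k : ℕ) (v : ℕ → ℝ) :
    adomian (fun u => majorantFun a (s + u)) k (fun p => if p = 0 then 0 else v p) =
      adomian (majorantFun a) k (fun p => if p = 0 then s else v p) := by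
  unfold adomian
  congr 2
  funext t
  simp [Finset.sum_range_succ', add_comm]

/-! ## Binomial probabilities -/

/-- Differences of consecutive binomial weights of order `n` are weights of order `n + 1` times the
deviation from the mean, up to the variance. -/
theorem choose_mul_sub_eq {t : ℝ} {n i : ℕ} (hi : i ≤ n) :
    ((n : ℝ) + 1) * t * (1 - t) * ((n.choose i : ℝ) * t ^ i * (1 - t) ^ (n - i) -
        (n.choose (i + 1) : ℝ) * t ^ (i + 1) * (1 - t) ^ (n - (i + 1))) =
      ((n + 1).choose (i + 1) : ℝ) * t ^ (i + 1) * (1 - t) ^ (n + 1 - (i + 1)) *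
        ((i : ℝ) + 1 - (n + 1) * t) := by
  have h1 : ((n : ℝ) + 1) * (n.choose i : ℝ) = ((n + 1).choose (i + 1) : ℝ) * (i + 1) := by
    exact_mod_cast Nat.add_one_mul_choose_eq n i
  have h2 : ((n : ℝ) + 1) * (n.choose (i + 1) : ℝ) = ((n + 1).choose (i + 1) : ℝ) * (n - i) := by
    have h3 : ((n + 1).choose (i + 1) : ℝ) = n.choose i + n.choose (i + 1) := by
      exact_mod_cast Nat.choose_succ_succ n i
    rw [h3] at h1 ⊢
    linarith
  rcases hi.lt_or_eq with h | rfl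
  · obtain ⟨d, rfl⟩ := Nat.exists_eq_add_of_lt h
    rw [show i + d + 1 - i = d + 1 by omega, show i + d + 1 - (i + 1) = d by omega,
      show i + d + 1 + 1 - (i + 1) = d + 1 by omega]
    push_cast at h1 h2 ⊢
    linear_combination (t * (1 - t) * t ^ i * (1 - t) ^ (d + 1)) * h1 -
      (t * (1 - t) * t ^ (i + 1) * (1 - t) ^ d) * h2
  · simp
    ring

/-- Telescoping bounds a single weight by the mean absolute deviation of the binomial law of order
`n + 1` divided by its variance `D`; by Cauchy–Schwarz the deviation is at most `√D`. -/
theorem binomial_le {t : ℝ} (ht0 : 0 < t) (ht1 : t < 1) {n k : ℕ} (hk : k ≤ n) :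
    (n.choose k : ℝ) * t ^ k * (1 - t) ^ (n - k) ≤ 1 / √(((n : ℝ) + 1) * t * (1 - t)) := by
  have hs : 0 < 1 - t := by linarith
  set D : ℝ := ((n : ℝ) + 1) * t * (1 - t) with hD
  have hDpos : 0 < D := by positivity
  set b : ℕ → ℝ := fun i => (n.choose i : ℝ) * t ^ i * (1 - t) ^ (n - i) with hb
  set B : ℕ → ℝ := fun i => ((n + 1).choose i : ℝ) * t ^ i * (1 - t) ^ (n + 1 - i) with hB
  have hBnn : ∀ i, 0 ≤ B i := fun i => by positivity
  have hdiff : ∀ i ∈ Finset.range (n + 1),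
      |b i - b (i + 1)| = B (i + 1) * |((i + 1 : ℕ) : ℝ) - (n + 1) * t| / D := by
    intro i hi
    have := choose_mul_sub_eq (t := t) (n := n) (i := i) (by simpa [Nat.lt_succ_iff] using hi)
    have e : b i - b (i + 1) = B (i + 1) * (((i + 1 : ℕ) : ℝ) - (n + 1) * t) / D := by
      rw [eq_div_iff hDpos.ne', mul_comm]
      push_cast
      exact this
    rw [e, abs_div, abs_mul, abs_of_nonneg (hBnn _), abs_of_pos hDpos]
  have hsum : ∑ i ∈ Finset.range (n + 2), B i = 1 := by
    have := congrArg (Polynomial.eval t) (bernsteinPolynomial.sum ℝ (n + 1))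
    simpa [bernsteinPolynomial, Polynomial.eval_finsetSum] using this
  have hvar : ∑ i ∈ Finset.range (n + 2), B i * ((i : ℝ) - (n + 1) * t) ^ 2 = D := by
    have := congrArg (Polynomial.eval t) (bernsteinPolynomial.variance ℝ (n + 1))
    simp [bernsteinPolynomial, Polynomial.eval_finsetSum] at this
    rw [hD, ← this]
    exact Finset.sum_congr rfl fun i _ => by simp only [hB]; ring
  have hCS : (∑ i ∈ Finset.range (n + 2), B i * |(i : ℝ) - (n + 1) * t|) ^ 2 ≤ D := by
    have := Finset.sum_sq_le_sum_mul_sum_of_sq_le_mul (Finset.range (n + 2)) (f := B)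
      (g := fun i => B i * ((i : ℝ) - (n + 1) * t) ^ 2)
      (r := fun i => B i * |(i : ℝ) - (n + 1) * t|) (fun i _ => hBnn i)
      (fun i _ => mul_nonneg (hBnn i) (sq_nonneg _))
      (fun i _ => le_of_eq (by rw [mul_pow, sq_abs]; ring))
    rwa [hsum, hvar, one_mul] at this
  -- The sum runs up to the weight of index `n + 1`, which is zero.
  have htel : b k = ∑ i ∈ Finset.Ico k (n + 1), (b i - b (i + 1)) := by
    have := Finset.sum_Ico_sub b (show k ≤ n + 1 by omega)
    have h0 : b (n + 1) = 0 := by simp [hb]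
    rw [h0] at this
    rw [← neg_inj, ← Finset.sum_neg_distrib]
    simp only [neg_sub]
    rw [this]; ring
  have hle : b k ≤ (∑ i ∈ Finset.range (n + 2), B i * |(i : ℝ) - (n + 1) * t|) / D := by
    rw [htel]
    calc _ ≤ ∑ i ∈ Finset.Ico k (n + 1), |b i - b (i + 1)| :=
          Finset.sum_le_sum fun i _ => le_abs_self _
      _ ≤ ∑ i ∈ Finset.range (n + 1), |b i - b (i + 1)| :=
          Finset.sum_le_sum_of_subset_of_nonneg (fun i hi => by
            simp at hi ⊢; omega) fun i _ _ => abs_nonneg _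
      _ = ∑ i ∈ Finset.range (n + 1), B (i + 1) * |((i + 1 : ℕ) : ℝ) - (n + 1) * t| / D :=
          Finset.sum_congr rfl hdiff
      _ ≤ _ := by
          rw [← Finset.sum_div, Finset.sum_range_succ' _ (n + 1)]
          gcongr
          exact le_add_of_nonneg_right (mul_nonneg (hBnn 0) (abs_nonneg _))
  refine hle.trans ?_
  have hsq := Real.le_sqrt_of_sq_le hCS
  calc _ ≤ √D / D := by gcongr
    _ = 1 / √D := by rw [Real.sqrt_div_self']

/-! ## Lagrange inversion -/

-- Writing `P = r + X Q` gives `σ P = r + X σ (φ Q)`, so one coefficient of `σ P` is the preceding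
-- coefficient of `σ (φ Q)`, and induction applies to `φ Q`. Purely algebraic: no continuity of `σ`
-- is used.
open PowerSeries in
theorem lagrange_inversion (σ : PowerSeries ℝ →ₐ[ℝ] PowerSeries ℝ) (φ : PowerSeries ℝ)
    (hσ : σ X = X * σ φ) (m : ℕ) : ∀ P : PowerSeries ℝ,
    ((m : ℝ) + 1) * coeff (m + 1) (σ P) = coeff m (derivative ℝ P * φ ^ (m + 1)) := by
  have hdec : ∀ P : PowerSeries ℝ, ∃ (r : ℝ) (Q : PowerSeries ℝ), P = C r + X * Q ∧
      σ P = C r + X * σ (φ * Q) := by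
    intro P
    refine ⟨constantCoeff P, mk fun p => coeff (p + 1) P, ?_, ?_⟩
    · rw [add_comm]; exact eq_X_mul_shift_add_const P
    · conv_lhs => rw [eq_X_mul_shift_add_const P]
      have hC : σ (C (constantCoeff P)) = C (constantCoeff P) := σ.commutes (constantCoeff P)
      rw [map_add, map_mul, hC, hσ, map_mul]
      ring
  have hconst : ∀ P : PowerSeries ℝ, constantCoeff (σ P) = constantCoeff P := by
    intro P
    obtain ⟨r, Q, h1, h2⟩ := hdec P
    rw [h2, h1]; simp
  induction m with
  | zero =>
    intro P
    obtain ⟨r, Q, h1, h2⟩ := hdec P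
    rw [h2, h1]
    simp [coeff_succ_X_mul, hconst, mul_comm]
  | succ m ih =>
    intro P
    obtain ⟨r, Q, h1, h2⟩ := hdec P
    have ih' := ih (φ * Q)
    have hd : derivative ℝ P = Q + X * derivative ℝ Q := by
      rw [h1]; simp [Derivation.leibniz, add_comm]
    have e1 : coeff (m + 1 + 1) (σ P) = coeff (m + 1) (σ (φ * Q)) := by
      rw [h2]; simp [coeff_succ_X_mul]
    rw [e1, hd]
    have e2 := coeff_derivative (Q * φ ^ (m + 2)) m
    -- The product rule on both sides; it converts the induction hypothesis for `φ Q` into the claim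
    -- for `P`.
    have e3 : derivative ℝ (Q * φ ^ (m + 2)) + (m + 1) • (derivative ℝ Q * φ ^ (m + 2)) =
        (m + 2) • (derivative ℝ (φ * Q) * φ ^ (m + 1)) := by
      simp only [Derivation.leibniz, Derivation.leibniz_pow, smul_eq_mul, nsmul_eq_mul]
      push_cast
      ring
    have e4 := congrArg (coeff m) e3
    rw [map_add, map_nsmul, map_nsmul, e2, ← ih'] at e4
    simp only [nsmul_eq_mul] at e4
    have e5 : coeff (m + 1) ((Q + X * derivative ℝ Q) * φ ^ (m + 1 + 1)) =
        coeff (m + 1) (Q * φ ^ (m + 2)) + coeff m (derivative ℝ Q * φ ^ (m + 2)) := by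
      rw [add_mul, mul_assoc, map_add, coeff_succ_X_mul]
    rw [e5]
    have hm : ((m : ℝ) + 1) ≠ 0 := by positivity
    apply mul_left_cancel₀ hm
    push_cast at e4 ⊢
    linarith

/-! ## Coefficient asymptotics for the equation `V = V ^ 2 + X h(V)` -/

theorem mul_powCoeff_eq_zero {V : ℕ → ℝ} {p k : ℕ} (h0 : V 0 = 0) (h : ℕ → ℝ) (hp : p ∉ Finset.range (k + 1)) :
    h p * powCoeff V p k = 0 := by
  rw [powCoeff_eq_zero_of_lt h0 (by simpa using hp), mul_zero]

theorem compCoeff_eq_sum {V : ℕ → ℝ} (h0 : V 0 = 0) (h : ℕ → ℝ) (k : ℕ) :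
    compCoeff h V k = ∑ p ∈ Finset.range (k + 1), h p * powCoeff V p k :=
  tsum_eq_sum fun _ hp => mul_powCoeff_eq_zero h0 h hp

-- The equation `V = V² + X h(V)` is `V (1 - V) = X h(V)`, hence `V = X φ(V)` with `φ = h / (1 -
-- X)`; the all-ones series is `1 / (1 - X)`. Lagrange inversion is applied with `σ` the
-- substitution of `V`.
open PowerSeries in
theorem coeff_lagrange {V h : ℕ → ℝ} (h0 : V 0 = 0)
    (hV : ∀ j, V (j + 1) = powCoeff V 2 (j + 1) + compCoeff h V j) (m : ℕ) :
    ((m : ℝ) + 1) * V (m + 1) = coeff m ((mk h * mk 1) ^ (m + 1)) := by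
  have hs : HasSubst (mk V) := HasSubst.of_constantCoeff_zero' (by
    simpa [← coeff_zero_eq_constantCoeff_apply] using h0)
  set σ : PowerSeries ℝ →ₐ[ℝ] PowerSeries ℝ := substAlgHom hs with hσ
  have hX : σ X = mk V := substAlgHom_X hs
  have hcoeff : ∀ j, coeff j (σ (mk h)) = compCoeff h V j := by
    intro j
    rw [hσ, coe_substAlgHom, coeff_subst' hs]
    rw [compCoeff_eq_sum h0]
    rw [finsum_eq_sum_of_support_subset (s := Finset.range (j + 1))]
    · simp [powCoeff]
    · intro p hp
      by_contra hp'
      exact hp (by simpa [powCoeff] using mul_powCoeff_eq_zero h0 h (by simpa using hp'))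
  have heq : mk V = mk V ^ 2 + X * σ (mk h) := by
    ext j
    rcases j with _ | j
    · simp [h0]
    · rw [map_add, coeff_succ_X_mul, hcoeff, coeff_mk, hV j, powCoeff]
  have h1 : (mk h * mk 1) * (1 - X) = (mk h : PowerSeries ℝ) := by
    rw [mul_assoc, mk_one_mul_one_sub_eq_one, mul_one]
  have h2 := congrArg σ h1
  rw [map_mul, map_sub, map_one, hX] at h2
  have hne : (1 - mk V : PowerSeries ℝ) ≠ 0 := by
    intro h
    have := congrArg (coeff 0) h
    simp [h0] at this
  have hF : σ X = X * σ (mk h * mk 1) := by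
    apply mul_right_cancel₀ hne
    rw [mul_assoc, h2, hX]
    linear_combination heq
  have := lagrange_inversion σ (mk h * mk 1) hF m X
  rw [hX] at this
  simpa using this

theorem eq_zero_of_head_eq_zero {V h : ℕ → ℝ} (h0 : V 0 = 0)
    (hV : ∀ j, V (j + 1) = powCoeff V 2 (j + 1) + compCoeff h V j) (hh : h 0 = 0) (j : ℕ) :
    V j = 0 := by
  induction j using Nat.strong_induction_on with
  | _ j ih =>
    rcases j with _ | j
    · exact h0
    · rw [hV]
      have e1 : powCoeff V 2 (j + 1) = 0 := by
        rw [powCoeff_succ]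
        refine Finset.sum_eq_zero fun ij hij => ?_
        have := Finset.HasAntidiagonal.mem_antidiagonal.1 hij
        rw [powCoeff_one]
        rcases Nat.eq_zero_or_pos ij.1 with hz | hz
        · rw [hz, h0, zero_mul]
        · rw [ih ij.2 (by omega), mul_zero]
      have e2 : compCoeff h V j = 0 := by
        rw [compCoeff_eq_sum h0]
        refine Finset.sum_eq_zero fun p _ => ?_
        have : powCoeff V p j = powCoeff (fun _ => 0) p j :=
          powCoeff_congr p (K := j) (fun i hi => ih i (by omega)) j le_rfl
        rcases p with _ | p
        · rw [hh, zero_mul]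
        · rw [this, powCoeff_succ]; simp
      rw [e1, e2, add_zero]

theorem summable_abs_pow_mul {h : ℕ → ℝ} (hh : ∀ u : ℝ, Summable fun p : ℕ => h p * u ^ p)
    {t : ℝ} : Summable fun i => |t ^ i * h i| := by
  refine (hh t).abs.congr fun i => by rw [mul_comm]

/-- After multiplication by `t ^ m` the Lagrange coefficient splits into terms of `h(t) ^ (m + 1)`,
whose sum is at most the full series, and factors `t ^ k * choose (m + k) m`, bounded uniformly in
`k` by `binomial_le`. -/
theorem coeff_bound {V h : ℕ → ℝ} (h0 : V 0 = 0) (hnn : ∀ i, 0 ≤ h i)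
    (hh : ∀ u : ℝ, Summable fun p : ℕ => h p * u ^ p)
    (hV : ∀ j, V (j + 1) = powCoeff V 2 (j + 1) + compCoeff h V j)
    {t : ℝ} (ht0 : 0 < t) (ht1 : t < 1) (m : ℕ) :
    V (m + 1) ≤ √(t * (1 - t)) / ((m + 1 : ℕ) : ℝ) ^ (1 + 1 / 2 : ℝ) *
      (powerFun h t / (t * (1 - t))) ^ (m + 1) := by
  have hs : 0 < 1 - t := by linarith
  have hL := coeff_lagrange h0 hV m
  rw [mul_pow, PowerSeries.mk_one_pow_eq_mk_choose_add, PowerSeries.coeff_mul] at hL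
  simp only [PowerSeries.coeff_mk] at hL
  set D : ℝ := 1 / √(((m : ℝ) + 1) * t * (1 - t)) with hD
  have hDpos : 0 < D := by positivity
  have hsp := summable_hasSum_powCoeff (v := fun i => t ^ i * h i) (summable_abs_pow_mul hh)
    (m + 1)
  have hpf : ∑' i, t ^ i * h i = powerFun h t := tsum_congr fun i => by rw [mul_comm]
  have hnn' : ∀ i, 0 ≤ powCoeff (fun i => t ^ i * h i) (m + 1) i :=
    fun i => powCoeff_nonneg (fun i => mul_nonneg (pow_nonneg ht0.le i) (hnn i)) _ i
  have hchoose : ∀ k : ℕ, t ^ k * ((m + k).choose m : ℝ) ≤ D / (1 - t) ^ m := by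
    intro k
    have h1 := binomial_le ht0 ht1 (n := m + k) (k := k) (by omega)
    rw [show m + k - k = m by omega, Nat.choose_symm_add.symm] at h1
    rw [le_div_iff₀ (by positivity), mul_comm (t ^ k)]
    refine h1.trans ?_
    rw [hD]
    refine one_div_le_one_div_of_le (by positivity) (Real.sqrt_le_sqrt ?_)
    push_cast
    have : (0 : ℝ) ≤ k := by positivity
    have h2 : 0 < t * (1 - t) := by positivity
    nlinarith
  have hmain : t ^ m * (((m : ℝ) + 1) * V (m + 1)) ≤
      powerFun h t ^ (m + 1) * (D / (1 - t) ^ m) := by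
    rw [hL, Finset.mul_sum, ← hpf, ← hsp.2.tsum_eq, ← tsum_mul_right]
    have hbd : ∀ ij ∈ Finset.HasAntidiagonal.antidiagonal m,
        t ^ m * ((PowerSeries.coeff ij.1) (PowerSeries.mk h ^ (m + 1)) *
          ((m + ij.2).choose m : ℝ)) ≤
        powCoeff (fun i => t ^ i * h i) (m + 1) ij.1 * (D / (1 - t) ^ m) := by
      intro ij hij
      have hij := Finset.HasAntidiagonal.mem_antidiagonal.1 hij
      have e : t ^ m * ((PowerSeries.coeff ij.1) (PowerSeries.mk h ^ (m + 1)) *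
          ((m + ij.2).choose m : ℝ)) = powCoeff (fun i => t ^ i * h i) (m + 1) ij.1 *
            (t ^ ij.2 * ((m + ij.2).choose m : ℝ)) := by
        rw [powCoeff_rescale, powCoeff]
        nth_rewrite 1 [← hij]
        rw [pow_add]
        ring
      rw [e]
      exact mul_le_mul_of_nonneg_left (hchoose _) (hnn' _)
    refine (Finset.sum_le_sum hbd).trans ?_
    rw [Finset.Nat.sum_antidiagonal_eq_sum_range_succ_mk]
    exact (hsp.2.summable.mul_right _).sum_le_tsum _
      fun i _ => mul_nonneg (hnn' i) (by positivity)
  have hm : (0 : ℝ) < (m : ℝ) + 1 := by positivity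
  -- The exponent `3/2`: the factor `m + 1` is from Lagrange inversion, its square root from the
  -- binomial bound.
  have hrp : ((m + 1 : ℕ) : ℝ) ^ (1 + 1 / 2 : ℝ) = (m + 1) * √((m : ℝ) + 1) := by
    push_cast
    rw [Real.rpow_add hm, Real.rpow_one, ← Real.sqrt_eq_rpow]
  rw [hrp]
  have hDe : D = 1 / (√((m : ℝ) + 1) * √(t * (1 - t))) := by
    rw [hD, mul_assoc, Real.sqrt_mul hm.le]
  have hsq : √(t * (1 - t)) * √(t * (1 - t)) = t * (1 - t) :=
    Real.mul_self_sqrt (by positivity)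
  have hs1 : 0 < √((m : ℝ) + 1) := by positivity
  have hs2 : 0 < √(t * (1 - t)) := by positivity
  have e : √(t * (1 - t)) / ((m + 1) * √((m : ℝ) + 1)) *
      (powerFun h t / (t * (1 - t))) ^ (m + 1) =
      powerFun h t ^ (m + 1) * (D / (1 - t) ^ m) / (t ^ m * (m + 1)) := by
    rw [hDe, div_pow, mul_pow, pow_succ t, pow_succ (1 - t)]
    have : √(t * (1 - t)) = t * (1 - t) / √(t * (1 - t)) := by
      rw [eq_div_iff hs2.ne', hsq]
    rw [this]
    field_simp
    rw [Real.sq_sqrt (by positivity)]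
  rw [e, le_div_iff₀ (by positivity)]
  linarith

theorem nonneg_of_recurrence {V h : ℕ → ℝ} (h0 : V 0 = 0) (hnn : ∀ i, 0 ≤ h i)
    (hV : ∀ j, V (j + 1) = powCoeff V 2 (j + 1) + compCoeff h V j) (j : ℕ) : 0 ≤ V j := by
  induction j using Nat.strong_induction_on with
  | _ j ih =>
    rcases j with _ | j
    · exact h0.ge
    · rw [hV]
      refine add_nonneg ?_ ?_
      · rw [powCoeff_succ]
        refine Finset.sum_nonneg fun ij hij => ?_
        have := Finset.HasAntidiagonal.mem_antidiagonal.1 hij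
        rw [powCoeff_one]
        rcases Nat.eq_zero_or_pos ij.1 with hz | hz
        · rw [hz, h0, zero_mul]
        · rcases Nat.eq_zero_or_pos ij.2 with hz' | hz'
          · rw [hz', h0, mul_zero]
          · exact mul_nonneg (ih _ (by omega)) (ih _ (by omega))
      · rw [compCoeff_eq_sum h0]
        refine Finset.sum_nonneg fun p _ => mul_nonneg (hnn p) ?_
        exact (abs_nonneg _).trans (abs_powCoeff_le p (K := j)
          (fun i hi => (abs_of_nonneg (ih i (by omega))).le) j le_rfl)

/-! ### The functional equation and the exact radius of convergence. -/

theorem functional_equation {V h : ℕ → ℝ} (h0 : V 0 = 0)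
    (hh : ∀ u : ℝ, Summable fun p : ℕ => h p * u ^ p)
    (hV : ∀ j, V (j + 1) = powCoeff V 2 (j + 1) + compCoeff h V j)
    {z : ℝ} (hz : Summable fun i => |z ^ i * V i|) :
    ∑' i, z ^ i * V i = (∑' i, z ^ i * V i) ^ 2 + z * powerFun h (∑' i, z ^ i * V i) := by
  set f := ∑' i, z ^ i * V i with hf
  have h1 : HasSum (fun i => z ^ (i + 1) * V (i + 1)) f := by
    have := (hasSum_nat_add_iff' (f := fun i => z ^ i * V i) 1).2 hz.of_abs.hasSum
    simpa [h0] using this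
  have h2 : HasSum (fun i => z ^ (i + 1) * powCoeff V 2 (i + 1)) (f ^ 2) := by
    have h2 := (summable_hasSum_powCoeff hz 2).2
    have := (hasSum_nat_add_iff' (f := powCoeff (fun i => z ^ i * V i) 2) 1).2 h2
    simpa [powCoeff_rescale, powCoeff_apply_zero, h0] using this
  have h3 : HasSum (fun i => z * (z ^ i * compCoeff h V i)) (z * powerFun h f) := by
    refine HasSum.mul_left z ?_
    refine (hasSum_compCoeff hh hz).congr_fun fun i => ?_
    simp only [compCoeff, powCoeff_rescale]
    rw [← tsum_mul_left]
    exact tsum_congr fun p => by ring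
  refine h1.unique ((h2.add h3).congr_fun fun i => ?_)
  rw [hV]; ring

theorem powerFun_nonneg {h : ℕ → ℝ} (hnn : ∀ i, 0 ≤ h i) {t : ℝ} (ht : 0 ≤ t) :
    0 ≤ powerFun h t := tsum_nonneg fun p => mul_nonneg (hnn p) (pow_nonneg ht p)

theorem head_le_powerFun {h : ℕ → ℝ} (hnn : ∀ i, 0 ≤ h i)
    (hh : ∀ u : ℝ, Summable fun p : ℕ => h p * u ^ p) {t : ℝ} (ht : 0 ≤ t) :
    h 0 ≤ powerFun h t := by
  simpa [powerFun] using (hh t).le_tsum 0 fun p _ => mul_nonneg (hnn p) (pow_nonneg ht p)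

/-- The quotient vanishes at both end points and is positive at `1/2`, so its maximum over the
compact interval is interior. -/
theorem exists_maximizer {h : ℕ → ℝ} (hnn : ∀ i, 0 ≤ h i) (hpos : 0 < h 0)
    (hh : ∀ u : ℝ, Summable fun p : ℕ => h p * u ^ p) :
    ∃ τ ∈ Set.Ioo (0 : ℝ) 1, ∀ t ∈ Set.Icc (0 : ℝ) 1,
      t * (1 - t) / powerFun h t ≤ τ * (1 - τ) / powerFun h τ := by
  have hp : ∀ t ∈ Set.Icc (0 : ℝ) 1, 0 < powerFun h t := fun t ht =>
    hpos.trans_le (head_le_powerFun hnn hh ht.1)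
  have hc : ContinuousOn (powerFun h) (Set.Icc 0 1) := by
    refine continuousOn_tsum (u := fun p => h p) (fun p => by fun_prop)
      (by simpa using hh 1) fun p x hx => ?_
    rw [norm_mul, Real.norm_of_nonneg (hnn p), Real.norm_of_nonneg (pow_nonneg hx.1 p)]
    exact mul_le_of_le_one_right (hnn p) (pow_le_one₀ hx.1 hx.2)
  obtain ⟨τ, hτ, hmax⟩ := isCompact_Icc.exists_isMaxOn (s := Set.Icc (0 : ℝ) 1)
    ⟨0, by simp⟩ (f := fun t => t * (1 - t) / powerFun h t)
    (ContinuousOn.div (by fun_prop) hc fun t ht => (hp t ht).ne')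
  refine ⟨τ, ?_, fun t ht => hmax ht⟩
  have hhalf := hmax (show (1 / 2 : ℝ) ∈ Set.Icc (0 : ℝ) 1 by norm_num)
  simp only [Set.mem_ofPred_eq] at hhalf
  have hh' : 0 < (1 / 2 : ℝ) * (1 - 1 / 2) / powerFun h (1 / 2) :=
    div_pos (by norm_num) (hp _ (by norm_num))
  have hτ' := hh'.trans_le hhalf
  refine ⟨lt_of_le_of_ne hτ.1 ?_, lt_of_le_of_ne hτ.2 ?_⟩
  · rintro rfl; simp at hτ'
  · rintro rfl; simp at hτ'

/-- At a point `z` of convergence with `z > ρ`, the value `f` of the series lies in `(0, 1)` and the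
functional equation reads `z = f(1 - f) / h(f) ≤ ρ`, a contradiction. -/
theorem radius_le_of_maximizer {V h : ℕ → ℝ} (h0 : V 0 = 0) (hnn : ∀ i, 0 ≤ h i) (hpos : 0 < h 0)
    (hh : ∀ u : ℝ, Summable fun p : ℕ => h p * u ^ p)
    (hV : ∀ j, V (j + 1) = powCoeff V 2 (j + 1) + compCoeff h V j) {ρ : ℝ} (hρ : 0 < ρ)
    (hmax : ∀ t ∈ Set.Icc (0 : ℝ) 1, t * (1 - t) / powerFun h t ≤ ρ) :
    (FormalMultilinearSeries.ofScalars ℝ V).radius ≤ ENNReal.ofReal ρ := by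
  by_contra! hlt
  obtain ⟨z, hz1, hz2⟩ := ENNReal.lt_iff_exists_nnreal_btwn.1 hlt
  have hzρ : ρ < z := by
    rw [ENNReal.ofReal, ENNReal.coe_lt_coe] at hz1
    simpa [Real.toNNReal_lt_iff_lt_coe hρ.le] using hz1
  have hzpos : (0 : ℝ) < z := hρ.trans hzρ
  have hVnn := nonneg_of_recurrence h0 hnn hV
  have hs : Summable fun i => |(z : ℝ) ^ i * V i| := by
    have := (FormalMultilinearSeries.ofScalars ℝ V).summable_norm_mul_pow hz2
    refine this.congr fun i => ?_
    rw [FormalMultilinearSeries.ofScalars_norm, abs_mul, Real.norm_eq_abs, abs_of_nonneg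
      (show (0 : ℝ) ≤ (z : ℝ) ^ i by positivity), mul_comm]
  have hfe := functional_equation h0 hh hV hs
  set f := ∑' i, (z : ℝ) ^ i * V i
  have hV1 : V 1 = h 0 := by
    rw [hV 0, compCoeff_eq_sum h0, powCoeff_succ]
    simp [powCoeff_zero, powCoeff_one, Finset.Nat.antidiagonal_succ, h0]
  have hf0 : 0 < f := by
    refine lt_of_lt_of_le ?_ (hs.of_abs.le_tsum 1 fun i _ => mul_nonneg (by positivity) (hVnn i))
    rw [hV1]; positivity
  have hH : 0 < powerFun h f := hpos.trans_le (head_le_powerFun hnn hh hf0.le)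
  -- From `f - f² = z h(f) > 0`.
  have hf1 : f < 1 := by
    have : 0 < z * powerFun h f := by positivity
    nlinarith
  have hle := hmax f ⟨hf0.le, hf1.le⟩
  have : (z : ℝ) = f * (1 - f) / powerFun h f := by
    rw [eq_div_iff hH.ne']; linarith
  linarith

/-- At the maximiser `τ` the base in `coeff_bound` is exactly `1/R`, which keeps the power of `m` in
front of the exact geometric rate; any other `t` gives an upper estimate of `1/R`. -/
theorem coeff_asymptotics {V h : ℕ → ℝ} (h0 : V 0 = 0) (hnn : ∀ i, 0 ≤ h i)
    (hh : ∀ u : ℝ, Summable fun p : ℕ => h p * u ^ p)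
    (hV : ∀ j, V (j + 1) = powCoeff V 2 (j + 1) + compCoeff h V j) :
    0 < (FormalMultilinearSeries.ofScalars ℝ V).radius ∧
    (∀ t ∈ Set.Ioo (0 : ℝ) 1, (FormalMultilinearSeries.ofScalars ℝ V).radius⁻¹.toReal ≤
      powerFun h t / (t * (1 - t))) ∧
    ∃ c : ℝ, 0 < c ∧ ∀ m, V (m + 1) ≤ c / ((m + 1 : ℕ) : ℝ) ^ (1 + 1 / 2 : ℝ) *
      (FormalMultilinearSeries.ofScalars ℝ V).radius⁻¹.toReal ^ (m + 1) := by
  -- If `h(0) = 0` the whole sequence vanishes, the radius is infinite and `1/R` is read as `0`.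
  rcases (hnn 0).eq_or_lt with hz | hpos
  · have hV0 := eq_zero_of_head_eq_zero h0 hV hz.symm
    have hR : (FormalMultilinearSeries.ofScalars ℝ V).radius = ⊤ := by
      refine FormalMultilinearSeries.radius_eq_top_of_forall_nnreal_isBigO _ fun r => ?_
      simpa [hV0] using isBoundedUnder_const
    rw [hR]
    refine ⟨by simp, fun t ht => ?_, 1, one_pos, fun m => ?_⟩
    · have := powerFun_nonneg hnn ht.1.le
      have h1 : 0 < 1 - t := by linarith [ht.2]
      have h2 := ht.1
      simp only [ENNReal.inv_top, ENNReal.toReal_zero]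
      positivity
    · simp [hV0]
  · obtain ⟨τ, hτ, hmax⟩ := exists_maximizer hnn hpos hh
    have hHτ : 0 < powerFun h τ := hpos.trans_le (head_le_powerFun hnn hh hτ.1.le)
    have h1τ : 0 < 1 - τ := by linarith [hτ.2]
    have h0τ := hτ.1
    set ρ : ℝ := τ * (1 - τ) / powerFun h τ with hρ
    have hρpos : 0 < ρ := by positivity
    have hVnn := nonneg_of_recurrence h0 hnn hV
    have hbd := coeff_bound h0 hnn hh hV hτ.1 hτ.2
    have hinv : powerFun h τ / (τ * (1 - τ)) = ρ⁻¹ := by rw [hρ, inv_div]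
    rw [hinv] at hbd
    have hR : (FormalMultilinearSeries.ofScalars ℝ V).radius = ENNReal.ofReal ρ := by
      refine le_antisymm (radius_le_of_maximizer h0 hnn hpos hh hV hρpos hmax) ?_
      refine FormalMultilinearSeries.le_radius_of_bound _ (√(τ * (1 - τ))) fun j => ?_
      rw [FormalMultilinearSeries.ofScalars_norm, Real.norm_of_nonneg (hVnn j),
        Real.coe_toNNReal _ hρpos.le]
      rcases j with _ | m
      · rw [h0, zero_mul]; positivity
      · refine (mul_le_mul_of_nonneg_right (hbd m) (by positivity)).trans ?_
        rw [mul_assoc, ← mul_pow, inv_mul_cancel₀ hρpos.ne', one_pow, mul_one]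
        refine div_le_self (by positivity) (Real.one_le_rpow ?_ (by norm_num))
        push_cast
        have : (0 : ℝ) ≤ m := by positivity
        linarith
    have hI : (FormalMultilinearSeries.ofScalars ℝ V).radius⁻¹.toReal = ρ⁻¹ := by
      rw [hR, ENNReal.toReal_inv, ENNReal.toReal_ofReal hρpos.le]
    rw [hI]
    refine ⟨by rw [hR]; simpa using hρpos, fun t ht => ?_, √(τ * (1 - τ)), by positivity, hbd⟩
    have hle := hmax t ⟨ht.1.le, ht.2.le⟩
    have hHt : 0 < powerFun h t := hpos.trans_le (head_le_powerFun hnn hh ht.1.le)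
    have h1 : 0 < 1 - t := by linarith [ht.2]
    have h2 := ht.1
    rw [← inv_div]
    exact inv_anti₀ (by positivity) hle

/-! ## The majorant sequence -/

theorem supNorm_nonneg (u : ℝ → ℝ) : 0 ≤ supNorm u := Real.iSup_nonneg fun _ => abs_nonneg _

theorem normL1_nonneg (q : ℝ → ℝ) : 0 ≤ normL1 q :=
  intervalIntegral.integral_nonneg zero_le_one fun _ _ => abs_nonneg _

theorem one_le_bConst (α β : ℝ) (n : ℕ) : 1 ≤ bConst α β n := le_max_left _ _

theorem v0_nonneg (α β : ℝ) (n : ℕ) : 0 ≤ v0 α β n :=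
  mul_nonneg (zero_le_one.trans (one_le_bConst α β n)) (supNorm_nonneg _)

/-- The Taylor coefficients of `h` in the functional equation `f = f ^ 2 + z h(f)` of the
generating function. -/
def genCoeff (Q w s : ℝ) (a : ℕ → ℝ) (i : ℕ) : ℝ :=
  (1 + w) * (if i = 0 then Q * w + shiftCoeff a s 1 * w
    else (if i = 1 then Q else 0) + shiftCoeff a s i)

theorem genCoeff_nonneg {Q w s : ℝ} (hQ : 0 ≤ Q) (hw : 0 ≤ w) (hs : 0 ≤ s) (a : ℕ → ℝ) (i : ℕ) :
    0 ≤ genCoeff Q w s a i := by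
  have h := fun i => shiftCoeff_nonneg a hs i
  unfold genCoeff
  refine mul_nonneg (by linarith) ?_
  split_ifs
  · exact add_nonneg (mul_nonneg hQ hw) (mul_nonneg (h 1) hw)
  · exact add_nonneg hQ (h _)
  · exact add_nonneg le_rfl (h _)

theorem hasSum_genCoeff (Q w s : ℝ) {a : ℕ → ℝ}
    (ha : ∀ u : ℝ, Summable fun p : ℕ => a p * u ^ p) (u : ℝ) :
    HasSum (fun i => genCoeff Q w s a i * u ^ i)
      ((1 + w) * (Q * w + shiftCoeff a s 1 * w - shiftCoeff a s 0 + Q * u +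
        majorantFun a (s + u))) := by
  have h1 := hasSum_shiftCoeff ha s u
  have h2 : HasSum (fun i => if i = 0 then Q * w + shiftCoeff a s 1 * w - shiftCoeff a s 0 else 0)
    (Q * w + shiftCoeff a s 1 * w - shiftCoeff a s 0) := hasSum_ite_eq 0 _
  have h3 : HasSum (fun i => if i = 1 then Q * u else 0) (Q * u) := hasSum_ite_eq 1 _
  refine (((h2.add h3).add h1).mul_left (1 + w)).congr_fun fun i => ?_
  rcases i with _ | _ | i
  · simp [genCoeff]
  · simp [genCoeff]; ring
  · simp [genCoeff]; ring

theorem powerFun_genCoeff_le {Q w s : ℝ} (hw : 0 ≤ w) (hs : 0 ≤ s) {a : ℕ → ℝ}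
    (ha : ∀ u : ℝ, Summable fun p : ℕ => a p * u ^ p) (u : ℝ) :
    powerFun (genCoeff Q w s a) u ≤
      (1 + w) * (Q * w + majorantFun a (s + 1) * w + Q * u + majorantFun a (s + u)) := by
  rw [powerFun, (hasSum_genCoeff Q w s ha u).tsum_eq]
  refine mul_le_mul_of_nonneg_left ?_ (by linarith)
  have h1 := mul_le_mul_of_nonneg_right (shiftCoeff_one_le ha hs) hw
  have h2 := shiftCoeff_nonneg a hs 0
  linarith

theorem majorantFun₁_eq (α β : ℝ) {a : ℕ → ℝ}
    (ha : ∀ u : ℝ, Summable fun p : ℕ => a p * u ^ p) (n : ℕ) :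
    majorantFun₁ α β a n = powerFun (shiftCoeff a (supNorm (u0 α β n))) :=
  (powerFun_shiftCoeff ha _).symm

/-- The coefficients of the generating function. -/
def genSeq (α β : ℝ) (q : ℝ → ℝ) (a : ℕ → ℝ) (n j : ℕ) : ℝ :=
  if j = 0 then 0 else vBar α β q a n j

/-- The recurrence of the majorants is the coefficientwise form of `f = f² + z h(f)`. The constant
Taylor coefficient of `Ñ₁` never enters: `v̄₁` has its own formula, and in later steps only Adomian
polynomials of order at least one occur. -/
theorem genSeq_recurrence (α β : ℝ) (q : ℝ → ℝ) {a : ℕ → ℝ}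
    (ha : ∀ u : ℝ, Summable fun p : ℕ => a p * u ^ p) (n j : ℕ) :
    genSeq α β q a n (j + 1) = powCoeff (genSeq α β q a n) 2 (j + 1) +
      compCoeff (genCoeff (normL1 q) (v0 α β n) (supNorm (u0 α β n)) a) (genSeq α β q a n) j := by
  have h0 : genSeq α β q a n 0 = 0 := rfl
  have hd : deriv (majorantFun₁ α β a n) 0 = shiftCoeff a (supNorm (u0 α β n)) 1 :=
    deriv_shift ha _
  have e0 : genSeq α β q a n (j + 1) = vBar α β q a n (j + 1) := rfl
  have eP : powCoeff (genSeq α β q a n) 2 (j + 1) =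
      ∑ p ∈ Finset.Ico 1 (j + 1), vBar α β q a n (j + 1 - p) * vBar α β q a n p := by
    rw [powCoeff_succ, Finset.Nat.sum_antidiagonal_eq_sum_range_succ_mk, Finset.sum_range_succ,
      Finset.range_eq_Ico, Finset.sum_eq_sum_Ico_succ_bot (by omega)]
    simp only [powCoeff_one, h0, zero_mul, Nat.sub_self, mul_zero, zero_add, add_zero]
    refine Finset.sum_congr rfl fun p hp => ?_
    have := Finset.mem_Ico.1 hp
    rw [genSeq, genSeq, if_neg (by omega), if_neg (by omega), mul_comm]
  rw [e0, vBar_succ, vBarFormula, eP]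
  rcases j with _ | j
  · rw [if_pos rfl, hd, compCoeff_eq_sum h0]
    simp [powCoeff_zero, genCoeff]
  · rw [if_neg (by omega), show j + 1 + 1 - 1 = j + 1 by omega]
    congr 1
    have e1 : (fun p => if p = 0 then 0 else vBar α β q a n p) = genSeq α β q a n := rfl
    rw [e1, majorantFun₁_eq α β ha, adomian_eq fun u => (hasSum_shiftCoeff ha _ u).summable,
      compCoeff_eq_sum h0, compCoeff_eq_sum h0]
    have e2 : normL1 q * vBar α β q a n (j + 1) = ∑ p ∈ Finset.range (j + 1 + 1),
        (if p = 1 then normL1 q else 0) * powCoeff (genSeq α β q a n) p (j + 1) := by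
      rw [Finset.sum_eq_single 1]
      · simp [powCoeff_one, genSeq]
      · intro p _ hp; simp [hp]
      · intro hp; simp at hp
    rw [e2, ← Finset.sum_add_distrib, Finset.mul_sum]
    refine Finset.sum_congr rfl fun p _ => ?_
    rcases p with _ | p
    · simp [powCoeff_zero]
    · simp only [genCoeff, Nat.succ_ne_zero, if_false]; ring

/-- The bound on `1/R` is the choice `t = 1/2`; it depends on `n` only through `v̄₀` and `‖u0‖`,
which permits a uniform estimate. -/
theorem vBar_asymptotics (α β : ℝ) (q : ℝ → ℝ) {a : ℕ → ℝ}
    (ha : ∀ u : ℝ, Summable fun p : ℕ => a p * u ^ p) (n : ℕ) :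
    0 < genRadius α β q a n ∧
    invR α β q a n ≤ 4 * ((1 + v0 α β n) * (normL1 q * v0 α β n +
      majorantFun a (supNorm (u0 α β n) + 1) * v0 α β n + normL1 q +
      majorantFun a (supNorm (u0 α β n) + 1))) ∧
    ∃ c : ℝ, 0 < c ∧ ∀ m, vBar α β q a n (m + 1) ≤ alphaSeq c (1 / 2) (m + 1) *
      invR α β q a n ^ (m + 1) := by
  have hQ := normL1_nonneg q
  have hw := v0_nonneg α β n
  have hs := supNorm_nonneg (u0 α β n)
  obtain ⟨h1, h2, c, hc, h3⟩ := coeff_asymptotics (V := genSeq α β q a n) rfl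
    (genCoeff_nonneg hQ hw hs a) (fun u => (hasSum_genCoeff _ _ _ ha u).summable)
    (genSeq_recurrence α β q ha n)
  refine ⟨h1, ?_, c, hc, h3⟩
  have h := h2 (1 / 2) (by norm_num)
  refine h.trans ?_
  rw [show (1 / 2 : ℝ) * (1 - 1 / 2) = 1 / 4 by norm_num, div_div_eq_mul_div, div_one, mul_comm]
  refine mul_le_mul_of_nonneg_left ?_ (by norm_num)
  refine (powerFun_genCoeff_le hw hs ha _).trans ?_
  refine mul_le_mul_of_nonneg_left ?_ (by linarith)
  have := majorantFun_mono ha (s := supNorm (u0 α β n) + 1 / 2) (t := supNorm (u0 α β n) + 1)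
    (by linarith) (by linarith)
  linarith

theorem vBar_nonneg (α β : ℝ) (q : ℝ → ℝ) {a : ℕ → ℝ}
    (ha : ∀ u : ℝ, Summable fun p : ℕ => a p * u ^ p) (n j : ℕ) : 0 ≤ vBar α β q a n j := by
  rcases j with _ | j
  · exact v0_nonneg α β n
  · exact nonneg_of_recurrence (V := genSeq α β q a n) rfl
      (genCoeff_nonneg (normL1_nonneg q) (v0_nonneg α β n) (supNorm_nonneg (u0 α β n)) a)
      (genSeq_recurrence α β q ha n) (j + 1)

/-! ## The maximum norm -/

/-- Continuity supplies the boundedness without which the real supremum would take a default value.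
-/
theorem abs_le_supNorm {u : ℝ → ℝ} (hu : ContinuousOn u (Set.Icc 0 1)) {x : ℝ}
    (hx : x ∈ Set.Icc (0 : ℝ) 1) : |u x| ≤ supNorm u := by
  obtain ⟨C, hC⟩ := isCompact_Icc.exists_bound_of_continuousOn hu
  exact le_ciSup (f := fun x : Set.Icc (0 : ℝ) 1 => |u x|)
    ⟨C, by rintro _ ⟨y, rfl⟩; exact hC y y.2⟩ ⟨x, hx⟩

theorem supNorm_le {u : ℝ → ℝ} {C : ℝ} (h : ∀ x ∈ Set.Icc (0 : ℝ) 1, |u x| ≤ C) :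
    supNorm u ≤ C := by
  have : Nonempty (Set.Icc (0 : ℝ) 1) := ⟨⟨0, by simp⟩⟩
  exact ciSup_le fun x => h x x.2

/-! ## The basic problem -/

/-- Intermediate value theorem: at `nπ` the function is `-β sin²(nπα)` up to the sign `(-1)ⁿ`, and a
quarter period later the term `x` dominates `β`. -/
theorem exists_char_root {α β : ℝ} (hβ : 0 ≤ β) {n : ℕ} (hn : β ≤ n) :
    ∃ x ∈ Set.Icc (n * Real.pi) (n * Real.pi + Real.pi / 2),
      x * Real.sin x = -β * Real.sin (x * α) * Real.sin (x * (1 - α)) := by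
  have hpi := Real.pi_gt_three
  set g : ℝ → ℝ := fun x => (-1) ^ n * (x * Real.sin x +
    β * Real.sin (x * α) * Real.sin (x * (1 - α))) with hg
  have hc : ContinuousOn g (Set.Icc (n * Real.pi) (n * Real.pi + Real.pi / 2)) := by
    apply Continuous.continuousOn; fun_prop
  have hsq : ((-1 : ℝ) ^ n) * (-1) ^ n = 1 := by rw [← mul_pow]; simp
  have h1 : g (n * Real.pi) ≤ 0 := by
    have e : (n : ℝ) * Real.pi * (1 - α) = n * Real.pi - n * Real.pi * α := by ring
    have : g (n * Real.pi) = -(β * Real.sin (n * Real.pi * α) ^ 2) := by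
      simp only [hg]
      rw [e, Real.sin_nat_mul_pi_sub, Real.sin_nat_mul_pi]
      linear_combination (-(β * Real.sin (n * Real.pi * α) ^ 2)) * hsq
    rw [this]
    have := mul_nonneg hβ (sq_nonneg (Real.sin (n * Real.pi * α)))
    linarith
  have h2 : 0 ≤ g (n * Real.pi + Real.pi / 2) := by
    set x := (n : ℝ) * Real.pi + Real.pi / 2 with hx
    have e : Real.sin x = (-1) ^ n := by
      rw [hx, add_comm, Real.sin_add_nat_mul_pi, Real.sin_pi_div_two, mul_one]
    have hn0 : (0 : ℝ) ≤ n := Nat.cast_nonneg n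
    have hxβ : β ≤ x := by rw [hx]; nlinarith
    have hb : |(-1) ^ n * (β * Real.sin (x * α) * Real.sin (x * (1 - α)))| ≤ β := by
      rw [abs_mul, abs_pow, abs_neg, abs_one, one_pow, one_mul, abs_mul, abs_mul,
        abs_of_nonneg hβ]
      have k1 := Real.abs_sin_le_one (x * α)
      have k2 := Real.abs_sin_le_one (x * (1 - α))
      have := mul_le_one₀ k1 (abs_nonneg _) k2
      rw [mul_assoc]
      exact mul_le_of_le_one_right hβ this
    have : g x = x + (-1) ^ n * (β * Real.sin (x * α) * Real.sin (x * (1 - α))) := by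
      simp only [hg]; rw [e]; linear_combination x * hsq
    rw [this]
    linarith [neg_abs_le ((-1) ^ n * (β * Real.sin (x * α) * Real.sin (x * (1 - α))))]
  obtain ⟨x, hx, hx0⟩ := intermediate_value_Icc (by linarith) hc ⟨h1, h2⟩
  refine ⟨x, hx, ?_⟩
  have := (mul_eq_zero.1 hx0).resolve_left (pow_ne_zero _ (by norm_num))
  linarith

/-- The infimum is attained: below a known root the half-open interval becomes compact, and the root
condition is closed. -/
theorem lam0_mem {α β : ℝ} (hβ : 0 ≤ β) {n : ℕ} (hn : β ≤ n) :
    lam0 α β n ∈ basicRoots α β n := by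
  have hpi := Real.pi_gt_three
  obtain ⟨x, hx, hx0⟩ := exists_char_root (α := α) hβ hn
  have hn0 : (0 : ℝ) ≤ n := Nat.cast_nonneg n
  have hx' : 0 ≤ x := le_trans (by positivity) hx.1
  have hmem : x ^ 2 ∈ basicRoots α β n := by
    refine ⟨⟨?_, ?_⟩, ?_⟩
    · rw [mul_comm, ← mul_pow]; exact pow_le_pow_left₀ (by positivity) hx.1 2
    · rw [← mul_pow]; exact pow_lt_pow_left₀ (by nlinarith [hx.2]) hx' (by norm_num)
    · rw [Real.sqrt_sq hx']; exact hx0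
  set K : Set ℝ := Set.Icc (Real.pi ^ 2 * (n : ℝ) ^ 2) (x ^ 2) ∩
    {l | √l * Real.sin √l = -β * Real.sin (√l * α) * Real.sin (√l * (1 - α))} with hK
  have hcomp : IsCompact K := isCompact_Icc.inter_right
    (isClosed_eq (by fun_prop) (by fun_prop))
  obtain ⟨m, hm⟩ := hcomp.exists_isLeast ⟨x ^ 2, ⟨hmem.1.1, le_rfl⟩, hmem.2⟩
  have hmS : IsLeast (basicRoots α β n) m := by
    refine ⟨⟨⟨hm.1.1.1, hm.1.1.2.trans_lt hmem.1.2⟩, hm.1.2⟩, fun l hl => ?_⟩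
    rcases le_total l (x ^ 2) with h | h
    · exact hm.2 ⟨⟨hl.1.1, h⟩, hl.2⟩
    · exact hm.1.1.2.trans h
  rw [lam0, hmS.csInf_eq]
  exact hmS.1

section Basic

variable {α β : ℝ} {n : ℕ}

theorem nat_mul_pi_le_om (h : lam0 α β n ∈ basicRoots α β n) : n * Real.pi ≤ om α β n := by
  refine Real.le_sqrt_of_sq_le ?_
  rw [mul_pow, mul_comm]; exact h.1.1

theorem om_sq (h : 0 < om α β n) : om α β n ^ 2 = lam0 α β n :=
  Real.sq_sqrt (Real.sqrt_pos.1 h).le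

/-- Continuity of the basic eigenfunction at `α`. When `sin(ω(1 - α)) = 0`, the characteristic
equation forces `sin ω = 0` and then `sin(ωα) = 0`, so both sides vanish. -/
theorem c0_sin (hω : 0 < om α β n) (hroot : lam0 α β n ∈ basicRoots α β n) :
    c0 α β n * Real.sin (om α β n * (1 - α)) = Real.sin (om α β n * α) / om α β n := by
  have hchar : om α β n * Real.sin (om α β n) = -β * Real.sin (om α β n * α) *
    Real.sin (om α β n * (1 - α)) := hroot.2
  unfold c0
  split_ifs with hθ
  · field_simp
  · simp only [not_not] at hθ
    rw [hθ, mul_zero, mul_eq_zero, or_iff_right hω.ne'] at hchar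
    have hc : Real.cos (om α β n) ≠ 0 := fun hc => by
      have := Real.sin_sq_add_cos_sq (om α β n)
      rw [hchar, hc] at this; norm_num at this
    have e : Real.sin (om α β n * (1 - α)) = Real.sin (om α β n) * Real.cos (om α β n * α) -
        Real.cos (om α β n) * Real.sin (om α β n * α) := by
      rw [← Real.sin_sub]; ring_nf
    rw [hθ, hchar] at e
    have : Real.sin (om α β n * α) = 0 := by
      have : Real.cos (om α β n) * Real.sin (om α β n * α) = 0 := by linarith
      exact (mul_eq_zero.1 this).resolve_left hc
    rw [hθ, this]; simp

/-- The jump condition at `α`, obtained from the characteristic equation and the addition formula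
for `ω = ωα + ω(1 - α)`. -/
theorem c0_cos (hω : 0 < om α β n) (hroot : lam0 α β n ∈ basicRoots α β n) :
    om α β n * c0 α β n * Real.cos (om α β n * (1 - α)) =
      -(Real.cos (om α β n * α) + β / om α β n * Real.sin (om α β n * α)) := by
  have hchar : om α β n * Real.sin (om α β n) = -β * Real.sin (om α β n * α) *
    Real.sin (om α β n * (1 - α)) := hroot.2
  have h1 := c0_sin hω hroot
  by_cases hθ : Real.sin (om α β n * (1 - α)) = 0
  · have hsα : Real.sin (om α β n * α) = 0 := by
      rw [hθ, mul_zero, eq_comm, div_eq_zero_iff, or_iff_left hω.ne'] at h1; exact h1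
    rw [c0, if_neg (by simpa using hθ), hsα]
    have e : Real.cos (om α β n * α) = Real.cos (om α β n) * Real.cos (om α β n * (1 - α)) +
        Real.sin (om α β n) * Real.sin (om α β n * (1 - α)) := by
      rw [← Real.cos_sub]; ring_nf
    rw [e, hθ]
    field_simp
    ring
  · have e : Real.sin (om α β n) = Real.sin (om α β n * α) * Real.cos (om α β n * (1 - α)) +
        Real.cos (om α β n * α) * Real.sin (om α β n * (1 - α)) := by
      rw [← Real.sin_add]; ring_nf
    rw [e] at hchar
    apply mul_right_cancel₀ hθ
    have h1' : om α β n * c0 α β n * Real.sin (om α β n * (1 - α)) = Real.sin (om α β n * α) := by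
      rw [mul_assoc, h1]; field_simp
    have h2 : Real.sin (om α β n * α) * Real.cos (om α β n * (1 - α)) +
        Real.cos (om α β n * α) * Real.sin (om α β n * (1 - α)) =
        -(β / om α β n * Real.sin (om α β n * α)) * Real.sin (om α β n * (1 - α)) := by
      field_simp; linarith
    linear_combination Real.cos (om α β n * (1 - α)) * h1' + h2

theorem om_c0_sq (hω : 0 < om α β n) (hroot : lam0 α β n ∈ basicRoots α β n) :
    (om α β n * c0 α β n) ^ 2 = cTilde α β n := by
  have h1 : om α β n * c0 α β n * Real.sin (om α β n * (1 - α)) = Real.sin (om α β n * α) := by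
    rw [mul_assoc, c0_sin hω hroot]; field_simp
  have h2 := c0_cos hω hroot
  have h3 := Real.sin_sq_add_cos_sq (om α β n * (1 - α))
  rw [cTilde, ← neg_sq (Real.cos _ + _), ← h2, ← h1]
  linear_combination (-(om α β n * c0 α β n) ^ 2) * h3

theorem cTilde_pos : 0 < cTilde α β n := by
  unfold cTilde
  set S := Real.sin (om α β n * α)
  have h := Real.sin_sq_add_cos_sq (om α β n * α)
  by_cases hS : S = 0
  · have hS' : Real.sin (om α β n * α) = 0 := hS
    rw [hS'] at h
    simp only [hS, mul_zero, add_zero]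
    linarith
  · positivity

theorem c0_ne_zero (hω : 0 < om α β n) (hroot : lam0 α β n ∈ basicRoots α β n) :
    c0 α β n ≠ 0 := fun h => by
  have := om_c0_sq hω hroot
  rw [h] at this
  have h2 := cTilde_pos (α := α) (β := β) (n := n)
  rw [← this] at h2
  simp at h2

theorem abs_c0 (hω : 0 < om α β n) (hroot : lam0 α β n ∈ basicRoots α β n) :
    |c0 α β n| = √(cTilde α β n) / om α β n := by
  rw [← om_c0_sq hω hroot, Real.sqrt_sq_eq_abs, abs_mul, abs_of_pos hω]
  field_simp

theorem u0_left {x : ℝ} (hx : x ≤ α) : u0 α β n x = Real.sin (om α β n * x) / om α β n :=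
  if_pos hx

theorem u0_right (hω : 0 < om α β n) (hroot : lam0 α β n ∈ basicRoots α β n) {x : ℝ}
    (hx : α ≤ x) : u0 α β n x = c0 α β n * Real.sin (om α β n * (1 - x)) := by
  rcases hx.eq_or_lt with rfl | hx
  · rw [u0_left le_rfl, c0_sin hω hroot]
  · exact if_neg (not_le.2 hx)

theorem continuous_u0 (hω : 0 < om α β n) (hroot : lam0 α β n ∈ basicRoots α β n) :
    Continuous (u0 α β n) := by
  unfold u0
  refine Continuous.if_le (by fun_prop) (by fun_prop) continuous_id continuous_const ?_
  rintro x rfl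
  exact (c0_sin hω hroot).symm

theorem supNorm_u0_le (hω : 0 < om α β n) (hroot : lam0 α β n ∈ basicRoots α β n) :
    supNorm (u0 α β n) ≤ max 1 √(cTilde α β n) / om α β n := by
  refine supNorm_le fun x _ => ?_
  rcases le_total x α with h | h
  · rw [u0_left h, abs_div, abs_of_pos hω]
    gcongr
    exact (Real.abs_sin_le_one _).trans (le_max_left _ _)
  · rw [u0_right hω hroot h, abs_mul, abs_c0 hω hroot, div_mul_eq_mul_div]
    gcongr
    exact (mul_le_of_le_one_right (Real.sqrt_nonneg _) (Real.abs_sin_le_one _)).trans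
      (le_max_right _ _)

/-- At least a quarter wave fits on each side of `α`, so both branches attain their amplitudes. The
lower bound is needed to turn `v̄₀` into the denominator of the eigenvalue estimate. -/
theorem le_supNorm_u0 (hα : α ∈ Set.Ioo (0 : ℝ) 1) (hω : 0 < om α β n)
    (hroot : lam0 α β n ∈ basicRoots α β n)
    (h1 : Real.pi / 2 ≤ om α β n * α) (h2 : Real.pi / 2 ≤ om α β n * (1 - α)) :
    max 1 √(cTilde α β n) / om α β n ≤ supNorm (u0 α β n) := by
  have hc := (continuous_u0 hω hroot).continuousOn (s := Set.Icc (0 : ℝ) 1)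
  have hpi := Real.pi_pos
  have hx : 0 < Real.pi / 2 / om α β n := by positivity
  have e : om α β n * (Real.pi / 2 / om α β n) = Real.pi / 2 := by field_simp
  rw [div_le_iff₀ hω]
  refine max_le ?_ ?_
  · rw [← div_le_iff₀ hω]
    have hxα : Real.pi / 2 / om α β n ≤ α := by rw [div_le_iff₀ hω]; linarith
    have := abs_le_supNorm hc (x := Real.pi / 2 / om α β n) ⟨hx.le, by linarith [hα.2]⟩
    rwa [u0_left hxα, e, Real.sin_pi_div_two, abs_of_pos (by positivity)] at this
  · rw [← div_le_iff₀ hω]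
    have hxα : Real.pi / 2 / om α β n ≤ 1 - α := by rw [div_le_iff₀ hω]; linarith
    have := abs_le_supNorm hc (x := 1 - Real.pi / 2 / om α β n)
      ⟨by linarith [hα.1], by linarith⟩
    rwa [u0_right hω hroot (by linarith), sub_sub_cancel, e, Real.sin_pi_div_two, mul_one,
      abs_c0 hω hroot] at this

theorem sqrt_cTilde_le (hβ : 0 ≤ β) (hω : 1 ≤ om α β n) : √(cTilde α β n) ≤ 2 + β := by
  have hβω : β / om α β n ≤ β := div_le_self hβ hω
  have hβω' : 0 ≤ β / om α β n := by positivity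
  refine Real.sqrt_le_iff.2 ⟨by linarith, ?_⟩
  unfold cTilde
  have h1 := Real.abs_sin_le_one (om α β n * α)
  have h2 := Real.abs_cos_le_one (om α β n * α)
  have h3 : |Real.cos (om α β n * α) + β / om α β n * Real.sin (om α β n * α)| ≤ 1 + β := by
    refine (abs_add_le _ _).trans (add_le_add h2 ?_)
    rw [abs_mul, abs_of_nonneg hβω']
    exact (mul_le_of_le_one_right hβω' h1).trans hβω
  have h4 := sq_le_sq' (by linarith [neg_abs_le (Real.cos (om α β n * α) + β / om α β n * Real.sin (om α β n * α))])
    ((le_abs_self _).trans h3)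
  have h5 : Real.sin (om α β n * α) ^ 2 ≤ 1 := Real.sin_sq_le_one _
  nlinarith

/-- The left branch alone contributes `α/2 - sin(ωα)cos(ωα)/(2ω)`, and the correction is at most
`1/(4ω) ≤ α/4`. -/
theorem le_bigM (hα : α ∈ Set.Ioo (0 : ℝ) 1) (hω : 0 < om α β n)
    (hroot : lam0 α β n ∈ basicRoots α β n) (h : 1 / α ≤ om α β n) : α / 4 ≤ bigM α β n := by
  have hc := continuous_u0 hω hroot
  have hα0 := hα.1
  have h1 : ∫ x in (0 : ℝ)..α, u0 α β n x ^ 2 ≤ ∫ x in (0 : ℝ)..1, u0 α β n x ^ 2 := by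
    refine intervalIntegral.integral_mono_interval le_rfl hα.1.le hα.2.le
      (Eventually.of_forall fun x => sq_nonneg _) ?_
    exact (hc.pow 2).intervalIntegrable _ _
  have h2 : ∫ x in (0 : ℝ)..α, u0 α β n x ^ 2 =
      (∫ x in (0 : ℝ)..α, Real.sin (om α β n * x) ^ 2) / om α β n ^ 2 := by
    rw [← intervalIntegral.integral_div]
    refine intervalIntegral.integral_congr fun x hx => ?_
    rw [Set.uIcc_of_le hα.1.le] at hx
    rw [u0_left hx.2, div_pow]
  have h3 : ∫ x in (0 : ℝ)..α, Real.sin (om α β n * x) ^ 2 =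
      α / 2 - Real.sin (om α β n * α) * Real.cos (om α β n * α) / (2 * om α β n) := by
    rw [intervalIntegral.integral_comp_mul_left (fun y => Real.sin y ^ 2) hω.ne', integral_sin_sq]
    simp
    field_simp
    ring
  unfold bigM
  rw [← om_sq hω]
  have h4 : om α β n ^ 2 * ∫ x in (0 : ℝ)..α, u0 α β n x ^ 2 =
      α / 2 - Real.sin (om α β n * α) * Real.cos (om α β n * α) / (2 * om α β n) := by
    rw [h2, h3]; field_simp
  have h5 : Real.sin (om α β n * α) * Real.cos (om α β n * α) / (2 * om α β n) ≤ α / 4 := by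
    rw [div_le_iff₀ (by positivity)]
    have h6 : Real.sin (om α β n * α) * Real.cos (om α β n * α) ≤ 1 / 2 := by
      nlinarith [Real.sin_sq_add_cos_sq (om α β n * α),
        sq_nonneg (Real.sin (om α β n * α) - Real.cos (om α β n * α))]
    rw [div_le_iff₀ hα.1] at h
    linarith
  have h7 := mul_le_mul_of_nonneg_left h1 (sq_nonneg (om α β n))
  linarith

end Basic

/-! ## Indices for which the estimates hold -/

/-- The index `n` is so large that the basic eigenvalue exists, the basic eigenfunction has an
interior extremum on both sides of `α`, and `Mₙ` is positive. -/
structure Admissible (α β : ℝ) (n : ℕ) : Prop where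
  one_le_om : 1 ≤ om α β n
  root : lam0 α β n ∈ basicRoots α β n
  left : Real.pi / 2 ≤ om α β n * α
  right : Real.pi / 2 ≤ om α β n * (1 - α)
  bigM_pos : 0 < bigM α β n

namespace Admissible

variable {α β : ℝ} {n : ℕ}

theorem om_pos (h : Admissible α β n) : 0 < om α β n := zero_lt_one.trans_le h.one_le_om

/-- The last two entries of the maximum defining `b(n)` are exactly what the prefactor of `λ⁽ʲ⁾`
requires. -/
theorem lam0_div_bigM_mul_supNorm_le (h : Admissible α β n) :
    lam0 α β n / bigM α β n * supNorm (u0 α β n) ≤ bConst α β n := by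
  have hω := h.om_pos
  have hM := h.bigM_pos
  rw [← om_sq hω]
  refine (mul_le_mul_of_nonneg_left (supNorm_u0_le hω h.root) (by positivity)).trans ?_
  have e : om α β n ^ 2 / bigM α β n * (max 1 √(cTilde α β n) / om α β n) =
      max 1 √(cTilde α β n) * (om α β n / bigM α β n) := by field_simp
  rw [e, max_mul_of_nonneg _ _ (by positivity), one_mul, bConst, mul_div_assoc', mul_comm √_]
  exact le_max_right _ _

/-- Each of the three quantities is `Mₙ` times one entry of the maximum `b(n)` times one of the two
amplitudes bounded by `‖u0‖`. -/
theorem le_bigM_mul_v0 (h : Admissible α β n) (hα : α ∈ Set.Ioo (0 : ℝ) 1) :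
    max 1 (max (cTilde α β n) (√(cTilde α β n) * bigM α β n / om α β n)) ≤
      bigM α β n * v0 α β n := by
  have hω := h.om_pos
  have hM := h.bigM_pos
  have hs := le_supNorm_u0 hα hω h.root h.left h.right
  have hs1 : 1 / om α β n ≤ supNorm (u0 α β n) :=
    le_trans (by gcongr; exact le_max_left _ _) hs
  have hs2 : √(cTilde α β n) / om α β n ≤ supNorm (u0 α β n) :=
    le_trans (by gcongr; exact le_max_right _ _) hs
  have hct := cTilde_pos (α := α) (β := β) (n := n)
  have hsq : √(cTilde α β n) * √(cTilde α β n) = cTilde α β n := Real.mul_self_sqrt hct.le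
  have hsnn := supNorm_nonneg (u0 α β n)
  unfold v0
  have key : ∀ x y : ℝ, 0 ≤ y → x ≤ bConst α β n → y ≤ supNorm (u0 α β n) →
      bigM α β n * (x * y) ≤ bigM α β n * (bConst α β n * supNorm (u0 α β n)) := by
    intro x y hy hx hy'
    refine mul_le_mul_of_nonneg_left (mul_le_mul hx hy' hy ?_) hM.le
    exact zero_le_one.trans (one_le_bConst α β n)
  refine max_le ?_ (max_le ?_ ?_)
  · refine le_trans (le_of_eq ?_) (key (om α β n / bigM α β n) (1 / om α β n) (by positivity)
      ((le_max_left _ _).trans (le_max_right _ _)) hs1)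
    field_simp
  · refine le_trans (le_of_eq ?_) (key (om α β n * √(cTilde α β n) / bigM α β n)
      (√(cTilde α β n) / om α β n) (by positivity)
      ((le_max_right _ _).trans (le_max_right _ _)) hs2)
    field_simp
    rw [Real.sq_sqrt hct.le]
  · refine le_trans (le_of_eq ?_) (key 1 (√(cTilde α β n) / om α β n) (by positivity)
      (le_max_left _ _) hs2)
    field_simp

theorem inv_bConst_le (h : Admissible α β n) :
    1 / bConst α β n ≤ bigM α β n *
      min (1 / bigM α β n) (min (1 / om α β n) (1 / (om α β n * √(cTilde α β n)))) := by
  have hω := h.om_pos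
  have hM := h.bigM_pos
  have hct : 0 < √(cTilde α β n) := Real.sqrt_pos.2 cTilde_pos
  rw [mul_min_of_nonneg _ _ hM.le, mul_min_of_nonneg _ _ hM.le]
  refine le_min ?_ (le_min ?_ ?_)
  · rw [mul_one_div_cancel hM.ne']
    exact div_le_one_of_le₀ (one_le_bConst α β n) (zero_le_one.trans (one_le_bConst α β n))
  · rw [mul_one_div, ← inv_div (om α β n), one_div]
    exact inv_anti₀ (by positivity) ((le_max_left _ _).trans (le_max_right _ _))
  · rw [mul_one_div, ← inv_div (om α β n * _), one_div]
    exact inv_anti₀ (by positivity) ((le_max_right _ _).trans (le_max_right _ _))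

end Admissible

theorem aConst_le {α β : ℝ} (hβ : 0 ≤ β) {n : ℕ} (hω : 1 ≤ om α β n) :
    aConst α β n ≤ (3 + β) / om α β n := by
  have hβω : β / om α β n ≤ β := div_le_self hβ hω
  have hω' : 0 < om α β n := by linarith
  have hβω' : 0 ≤ β / om α β n := by positivity
  unfold aConst
  refine div_le_div_of_nonneg_right ?_ hω'.le
  have : √(1 + (1 + β / om α β n) ^ 2) ≤ 2 + β := by
    refine Real.sqrt_le_iff.2 ⟨by linarith, ?_⟩
    nlinarith
  linarith

/-- All quantities entering the bound for `1/R` are uniform in `n`, whereas `a(n) ≤ (3 + β)/ω`. -/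
theorem exists_admissible {α β : ℝ} (hα : α ∈ Set.Ioo (0 : ℝ) 1) (hβ : 0 ≤ β)
    (q : ℝ → ℝ) {a : ℕ → ℝ} (ha : ∀ u : ℝ, Summable fun p : ℕ => a p * u ^ p) :
    ∃ n₀ : ℕ, 0 < n₀ ∧ ∀ n : ℕ, n₀ ≤ n → Admissible α β n ∧ ratio α β q a n < 1 := by
  have hpi := Real.pi_gt_three
  have hα0 := hα.1
  have hα1 : 0 < 1 - α := by linarith [hα.2]
  -- Bound for `v̄₀`: `‖u0‖ ≤ (2 + β)/ω` times `b(n) ≤ ω(2 + β)(1 + 4/α)`, the powers of `ω`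
  -- cancelling.
  set W : ℝ := (2 + β) * (2 + β) * (1 + 4 / α) with hW
  set m : ℝ := majorantFun a (2 + β + 1) with hm
  have hm0 : 0 ≤ m := majorantFun_nonneg a (by linarith)
  have hQ := normL1_nonneg q
  have hW0 : 0 ≤ W := by positivity
  set K : ℝ := 4 * ((1 + W) * (normL1 q * W + m * W + normL1 q + m)) with hK
  have hK0 : 0 ≤ K := by positivity
  -- The summands serve in turn positivity, existence of the root, the quarter waves left and right
  -- of `α` (the left one also `Mₙ ≥ α/4`), and `rₙ < 1`.
  obtain ⟨n₀, hn₀⟩ := exists_nat_ge (1 + β + 1 / α + 1 / (1 - α) + (3 + β) * K)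
  have hp1 : 0 < 1 / α := by positivity
  have hp2 : 0 < 1 / (1 - α) := by positivity
  have hp3 : 0 ≤ (3 + β) * K := by positivity
  have hn₀pos : (0 : ℝ) < n₀ := by linarith
  refine ⟨n₀, by exact_mod_cast hn₀pos, fun n hn => ?_⟩
  have hn' : (n₀ : ℝ) ≤ n := by exact_mod_cast hn
  have hroot := lam0_mem (α := α) hβ (n := n) (by linarith)
  have hπω := nat_mul_pi_le_om hroot
  have hnω : (n : ℝ) * 3 ≤ om α β n :=
    (mul_le_mul_of_nonneg_left hpi.le (Nat.cast_nonneg n)).trans hπω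
  have hω1 : 1 ≤ om α β n := by linarith
  have hω : 0 < om α β n := by linarith
  have hM4 := le_bigM hα hω hroot (by linarith)
  have hM : 0 < bigM α β n := by linarith
  have hadm : Admissible α β n := by
    refine ⟨hω1, hroot, ?_, ?_, hM⟩
    · have h1 : 1 ≤ n * α := by
        rw [← div_le_iff₀ hα0]; linarith
      have h2 := mul_le_mul_of_nonneg_right hπω hα0.le
      have h3 := mul_le_mul_of_nonneg_right h1 Real.pi_pos.le
      linarith
    · have h1 : 1 ≤ n * (1 - α) := by
        rw [← div_le_iff₀ hα1]; linarith
      have h2 := mul_le_mul_of_nonneg_right hπω hα1.le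
      have h3 := mul_le_mul_of_nonneg_right h1 Real.pi_pos.le
      linarith
  refine ⟨hadm, ?_⟩
  have hct := sqrt_cTilde_le (α := α) hβ hω1
  have hmax : max 1 √(cTilde α β n) ≤ 2 + β := max_le (by linarith) hct
  have hs' := supNorm_u0_le hω hroot
  have hs : supNorm (u0 α β n) ≤ (2 + β) / om α β n := hs'.trans (by gcongr)
  have hs2 : supNorm (u0 α β n) ≤ 2 + β := hs.trans (div_le_self (by linarith) hω1)
  have hsnn := supNorm_nonneg (u0 α β n)
  have hMinv : 1 / bigM α β n ≤ 4 / α := by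
    rw [div_le_div_iff₀ hM hα0]; linarith
  have hb : bConst α β n ≤ om α β n * ((2 + β) * (1 + 4 / α)) := by
    have h4 : 0 ≤ 4 / α := by positivity
    refine max_le ?_ (max_le ?_ ?_)
    · exact one_le_mul_of_one_le_of_one_le hω1
        (one_le_mul_of_one_le_of_one_le (by linarith) (by linarith))
    · rw [div_eq_mul_one_div]
      refine mul_le_mul_of_nonneg_left ?_ hω.le
      refine le_trans ?_ (le_mul_of_one_le_left (by linarith) (by linarith))
      linarith
    · rw [div_eq_mul_one_div, mul_assoc]
      refine mul_le_mul_of_nonneg_left ?_ hω.le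
      exact mul_le_mul hct (by linarith) (by positivity) (by linarith)
  have hv0 : v0 α β n ≤ W := by
    unfold v0
    refine (mul_le_mul hb hs hsnn (by positivity)).trans (le_of_eq ?_)
    rw [hW]; field_simp
  have hv0nn := v0_nonneg α β n
  have hmm : majorantFun a (supNorm (u0 α β n) + 1) ≤ m :=
    majorantFun_mono ha (by linarith) (by linarith)
  have hmm0 : 0 ≤ majorantFun a (supNorm (u0 α β n) + 1) := majorantFun_nonneg a (by linarith)
  have hinv : invR α β q a n ≤ K := by
    refine (vBar_asymptotics α β q ha n).2.1.trans ?_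
    rw [hK]
    gcongr
  have hinv0 : 0 ≤ invR α β q a n := ENNReal.toReal_nonneg
  have haC := aConst_le (α := α) hβ hω1
  unfold ratio
  calc _ ≤ (3 + β) / om α β n * K := by gcongr
    _ < 1 := by
      rw [div_mul_eq_mul_div, div_lt_one hω]
      linarith

/-! ## Integrals against an integrable function -/

theorem intervalIntegrable_sub {F : ℝ → ℝ} (hF : IntervalIntegrable F volume 0 1) {x y : ℝ}
    (hx : x ∈ Set.Icc (0 : ℝ) 1) (hy : y ∈ Set.Icc (0 : ℝ) 1) :
    IntervalIntegrable F volume x y := by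
  refine hF.mono_set ?_
  rw [Set.uIcc_of_le zero_le_one]
  exact Set.uIcc_subset_Icc hx hy

theorem abs_integral_mul_le {F k : ℝ → ℝ} (hF : IntervalIntegrable F volume 0 1) {x y K : ℝ}
    (hx : 0 ≤ x) (hxy : x ≤ y) (hy : y ≤ 1) (hK : ∀ t, |k t| ≤ K) :
    |∫ t in x..y, k t * F t| ≤ K * normL1 F := by
  have hK0 : 0 ≤ K := (abs_nonneg _).trans (hK 0)
  have h1 : ‖∫ t in x..y, k t * F t‖ ≤ ∫ t in x..y, K * |F t| := by
    refine intervalIntegral.norm_integral_le_of_norm_le hxy (Eventually.of_forall fun t _ => ?_) ?_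
    · rw [norm_mul]
      exact mul_le_mul_of_nonneg_right (hK t) (abs_nonneg _)
    · exact ((intervalIntegrable_sub hF ⟨hx, hxy.trans hy⟩ ⟨hx.trans hxy, hy⟩).abs).const_mul K
  refine h1.trans ?_
  rw [intervalIntegral.integral_const_mul]
  refine mul_le_mul_of_nonneg_left ?_ hK0
  exact intervalIntegral.integral_mono_interval hx hxy hy
    (Eventually.of_forall fun t => abs_nonneg _) hF.abs

theorem integral_sin_kernel {F : ℝ → ℝ} (hF : IntervalIntegrable F volume 0 1) (ω x : ℝ)
    {b c : ℝ} (hb : b ∈ Set.Icc (0 : ℝ) 1) (hc : c ∈ Set.Icc (0 : ℝ) 1) :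
    ∫ y in b..c, Real.sin (ω * (x - y)) / ω * F y =
      (Real.sin (ω * x) * (∫ y in b..c, Real.cos (ω * y) * F y) -
        Real.cos (ω * x) * ∫ y in b..c, Real.sin (ω * y) * F y) / ω := by
  have hI := intervalIntegrable_sub hF hb hc
  rw [← intervalIntegral.integral_const_mul, ← intervalIntegral.integral_const_mul,
    ← intervalIntegral.integral_sub, ← intervalIntegral.integral_div]
  · refine intervalIntegral.integral_congr fun y _ => ?_
    simp only [mul_sub, Real.sin_sub]
    ring
  · exact (hI.continuousOn_mul (by fun_prop)).const_mul _
  · exact (hI.continuousOn_mul (by fun_prop)).const_mul _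

theorem integral_cos_kernel {F : ℝ → ℝ} (hF : IntervalIntegrable F volume 0 1) (ω x : ℝ)
    {b c : ℝ} (hb : b ∈ Set.Icc (0 : ℝ) 1) (hc : c ∈ Set.Icc (0 : ℝ) 1) :
    ∫ y in b..c, Real.cos (ω * (x - y)) * F y =
      Real.cos (ω * x) * (∫ y in b..c, Real.cos (ω * y) * F y) +
        Real.sin (ω * x) * ∫ y in b..c, Real.sin (ω * y) * F y := by
  have hI := intervalIntegrable_sub hF hb hc
  rw [← intervalIntegral.integral_const_mul, ← intervalIntegral.integral_const_mul,
    ← intervalIntegral.integral_add]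
  · refine intervalIntegral.integral_congr fun y _ => ?_
    simp only [mul_sub, Real.cos_sub]
    ring
  · exact (hI.continuousOn_mul (by fun_prop)).const_mul _
  · exact (hI.continuousOn_mul (by fun_prop)).const_mul _

theorem abs_sin_div_le {ω : ℝ} (hω : 0 < ω) (x : ℝ) : |Real.sin (ω * x) / ω| ≤ |x| := by
  rw [abs_div, abs_of_pos hω, div_le_iff₀ hω]
  refine (Real.abs_sin_le_abs).trans ?_
  rw [abs_mul, abs_of_pos hω, mul_comm]

theorem abs_sin_div_le' {ω : ℝ} (hω : 0 < ω) (x : ℝ) : |Real.sin x / ω| ≤ 1 / ω := by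
  rw [abs_div, abs_of_pos hω]
  gcongr
  exact Real.abs_sin_le_one x

/-- As `F` is only integrable, the primitive of `F` need not be differentiable everywhere; the
kernel vanishing on the diagonal gives a derivative at every point. The integral up to `x` is smooth
in `z`, and the remaining piece over `x..z` is negligible. -/
theorem hasDerivWithinAt_sin_kernel {F : ℝ → ℝ} (hF : IntervalIntegrable F volume 0 1) {ω : ℝ}
    (hω : 0 < ω) {b x : ℝ} (hb : b ∈ Set.Icc (0 : ℝ) 1) (hx : x ∈ Set.Icc (0 : ℝ) 1) :
    HasDerivWithinAt (fun z => ∫ y in b..z, Real.sin (ω * (z - y)) / ω * F y)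
      (∫ y in b..x, Real.cos (ω * (x - y)) * F y) (Set.Icc 0 1) x := by
  set A := ∫ y in b..x, Real.cos (ω * y) * F y with hA
  set B := ∫ y in b..x, Real.sin (ω * y) * F y with hB
  have h1 : HasDerivWithinAt (fun z => (Real.sin (ω * z) * A - Real.cos (ω * z) * B) / ω)
      (Real.cos (ω * x) * A + Real.sin (ω * x) * B) (Set.Icc 0 1) x := by
    have hm : HasDerivAt (fun z => ω * z) ω x := by simpa using (hasDerivAt_id x).const_mul ω
    have := (((hm.sin.mul_const A).sub (hm.cos.mul_const B)).div_const ω).hasDerivWithinAt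
      (s := Set.Icc 0 1)
    refine this.congr_deriv ?_
    field_simp
    ring
  -- On this piece the kernel is at most `|z - x|`, and `∫ |F|` over it tends to zero.
  have h2 : HasDerivWithinAt (fun z => ∫ y in x..z, Real.sin (ω * (z - y)) / ω * F y) 0
      (Set.Icc 0 1) x := by
    rw [hasDerivWithinAt_iff_isLittleO]
    have hc : ContinuousWithinAt (fun z => ∫ y in x..z, |F y|) (Set.Icc 0 1) x := by
      have := intervalIntegral.continuousOn_primitive_interval' (μ := volume) (f := fun y => |F y|)
        (b₁ := 0) (b₂ := 1) (a := x) hF.abs (by rwa [Set.uIcc_of_le zero_le_one])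
      rw [Set.uIcc_of_le zero_le_one] at this
      exact this x hx
    have ht : Tendsto (fun z => |(∫ y in x..z, |F y|)|) (𝓝[Set.Icc 0 1] x) (𝓝 0) := by
      have := hc.tendsto.abs
      simpa using this
    have hO : (fun z => |(∫ y in x..z, |F y|)| * (z - x)) =o[𝓝[Set.Icc 0 1] x] fun z => z - x := by
      have h := ((isLittleO_one_iff ℝ).2 ht).mul_isBigO
        (isBigO_refl (fun z : ℝ => z - x) (𝓝[Set.Icc 0 1] x))
      simpa using h
    refine IsBigO.trans_isLittleO (IsBigO.of_bound 1 ?_) hO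
    filter_upwards [self_mem_nhdsWithin] with z hz
    have hbd : ‖∫ y in x..z, Real.sin (ω * (z - y)) / ω * F y‖ ≤
        |(∫ y in x..z, |z - x| * |F y|)| := by
      refine intervalIntegral.norm_integral_le_abs_of_norm_le
        (ae_restrict_of_forall_mem measurableSet_uIoc fun y hy => ?_)
        ((intervalIntegrable_sub hF hx hz).abs.const_mul _)
      rw [norm_mul]
      refine mul_le_mul_of_nonneg_right ((abs_sin_div_le hω _).trans ?_) (abs_nonneg _)
      rcases Set.mem_uIoc.1 hy with h | h
      · rw [abs_of_nonneg (by linarith), abs_of_nonneg (by linarith)]; linarith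
      · rw [abs_of_nonpos (by linarith), abs_of_nonpos (by linarith)]; linarith
    rw [intervalIntegral.integral_const_mul, abs_mul, abs_abs] at hbd
    simpa [abs_mul, mul_comm] using hbd
  rw [integral_cos_kernel hF ω x hb hx]
  have h3 := h1.add h2
  rw [add_zero] at h3
  refine h3.congr_of_mem (fun z hz => ?_) hx
  simp only [Pi.add_apply]
  rw [← integral_sin_kernel hF ω z hb hx, intervalIntegral.integral_add_adjacent_intervals]
  · exact (intervalIntegrable_sub hF hb hx).continuousOn_mul (by fun_prop)
  · exact (intervalIntegrable_sub hF hx hz).continuousOn_mul (by fun_prop)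

/-! ## The linear problem for a correction -/

section Linear

variable {α β : ℝ} {n : ℕ} {F : ℝ → ℝ}

/-- Expanding the two branches of `u0` about `α` turns orthogonality into a linear relation between
four sine and cosine moments of `F`. By the matching conditions for `u0`, that relation is the
claimed identity multiplied by `c0`, which is nonzero. -/
theorem c_compatibility (hα : α ∈ Set.Ioo (0 : ℝ) 1) (h : Admissible α β n)
    (hF : IntervalIntegrable F volume 0 1) (horth : ∫ x in (0 : ℝ)..1, u0 α β n x * F x = 0) :
    cRhs₁ α β n F * Real.cos (om α β n * (1 - α)) =
      cRhs₂ α β n F * Real.sin (om α β n * (1 - α)) := by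
  have hω := h.om_pos
  have hαI : α ∈ Set.Icc (0 : ℝ) 1 := ⟨hα.1.le, hα.2.le⟩
  have h0I : (0 : ℝ) ∈ Set.Icc (0 : ℝ) 1 := by simp
  have h1I : (1 : ℝ) ∈ Set.Icc (0 : ℝ) 1 := by simp
  have hI1 := intervalIntegrable_sub hF h0I hαI
  have hI2 := intervalIntegrable_sub hF hαI h1I
  set ω := om α β n with hωdef
  have hs1 : IntervalIntegrable (fun y => Real.sin (ω * (α - y)) * F y) volume 0 α :=
    hI1.continuousOn_mul (by fun_prop)
  have hs2 : IntervalIntegrable (fun y => Real.sin (ω * (α - y)) * F y) volume α 1 :=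
    hI2.continuousOn_mul (by fun_prop)
  have hc1 : IntervalIntegrable (fun y => Real.cos (ω * (α - y)) * F y) volume 0 α :=
    hI1.continuousOn_mul (by fun_prop)
  have hc2 : IntervalIntegrable (fun y => Real.cos (ω * (α - y)) * F y) volume α 1 :=
    hI2.continuousOn_mul (by fun_prop)
  set A₁ := ∫ y in (0 : ℝ)..α, Real.sin (ω * (α - y)) * F y with hA₁
  set A₂ := ∫ y in α..1, Real.sin (ω * (α - y)) * F y with hA₂
  set B₁ := ∫ y in (0 : ℝ)..α, Real.cos (ω * (α - y)) * F y with hB₁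
  set B₂ := ∫ y in α..1, Real.cos (ω * (α - y)) * F y with hB₂
  have e1 : cRhs₁ α β n F = (A₁ + A₂) / ω := by
    rw [cRhs₁, hA₁, hA₂, intervalIntegral.integral_add_adjacent_intervals hs1 hs2,
      ← intervalIntegral.integral_div]
    exact intervalIntegral.integral_congr fun y _ => by rw [div_mul_eq_mul_div]
  have e2 : cRhs₂ α β n F = -((B₁ + B₂) / ω) - β * (A₁ / ω ^ 2) := by
    rw [cRhs₂, hB₁, hB₂, intervalIntegral.integral_add_adjacent_intervals hc1 hc2,
      ← intervalIntegral.integral_div, hA₁, ← intervalIntegral.integral_div, om_sq hω]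
    congr 2
    · exact intervalIntegral.integral_congr fun y _ => by rw [div_mul_eq_mul_div]
    · exact intervalIntegral.integral_congr fun y _ => by rw [div_mul_eq_mul_div]
  have hu0 := continuous_u0 hω h.root
  have e3 : ∫ x in (0 : ℝ)..1, u0 α β n x * F x =
      (-(Real.cos (ω * α) / ω) * A₁ + Real.sin (ω * α) / ω * B₁) +
      (c0 α β n * Real.cos (ω * (1 - α)) * A₂ + c0 α β n * Real.sin (ω * (1 - α)) * B₂) := by
    rw [← intervalIntegral.integral_add_adjacent_intervals (b := α)
      (hI1.continuousOn_mul hu0.continuousOn) (hI2.continuousOn_mul hu0.continuousOn)]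
    simp only [hA₁, hA₂, hB₁, hB₂]
    simp only [← intervalIntegral.integral_const_mul]
    rw [← intervalIntegral.integral_add (hs1.const_mul _) (hc1.const_mul _),
      ← intervalIntegral.integral_add (hs2.const_mul _) (hc2.const_mul _)]
    congr 1
    · refine intervalIntegral.integral_congr fun y hy => ?_
      rw [Set.uIcc_of_le hα.1.le] at hy
      have : Real.sin (ω * y) = Real.sin (ω * α) * Real.cos (ω * (α - y)) -
          Real.cos (ω * α) * Real.sin (ω * (α - y)) := by
        rw [← Real.sin_sub]; ring_nf
      rw [u0_left hy.2, ← hωdef, this]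
      ring
    · refine intervalIntegral.integral_congr fun y hy => ?_
      rw [Set.uIcc_of_le hα.2.le] at hy
      have : Real.sin (ω * (1 - y)) = Real.sin (ω * (1 - α)) * Real.cos (ω * (α - y)) +
          Real.cos (ω * (1 - α)) * Real.sin (ω * (α - y)) := by
        rw [← Real.sin_add]; ring_nf
      rw [u0_right hω h.root hy.1, ← hωdef, this]
      ring
  rw [horth] at e3
  have k1 := c0_sin hω h.root
  have k2 := c0_cos hω h.root
  rw [← hωdef] at k1 k2
  have k2' : c0 α β n * Real.cos (ω * (1 - α)) =
      -(Real.cos (ω * α) + β / ω * Real.sin (ω * α)) / ω := by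
    rw [eq_div_iff hω.ne', ← k2]; ring
  apply mul_left_cancel₀ (c0_ne_zero hω h.root)
  rw [e1, e2]
  have g1 : c0 α β n * ((A₁ + A₂) / ω * Real.cos (ω * (1 - α))) =
      (A₁ + A₂) / ω * (c0 α β n * Real.cos (ω * (1 - α))) := by ring
  have g2 : c0 α β n * ((-((B₁ + B₂) / ω) - β * (A₁ / ω ^ 2)) * Real.sin (ω * (1 - α))) =
      (-((B₁ + B₂) / ω) - β * (A₁ / ω ^ 2)) * (c0 α β n * Real.sin (ω * (1 - α))) := by ring
  rw [g1, g2]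
  rw [k1, k2'] at e3 ⊢
  field_simp at e3 ⊢
  linear_combination (-1) * e3

theorem cFormula_spec (hα : α ∈ Set.Ioo (0 : ℝ) 1) (h : Admissible α β n)
    (hF : IntervalIntegrable F volume 0 1) (horth : ∫ x in (0 : ℝ)..1, u0 α β n x * F x = 0) :
    cFormula α β n F * Real.sin (om α β n * (1 - α)) = cRhs₁ α β n F ∧
      cFormula α β n F * Real.cos (om α β n * (1 - α)) = cRhs₂ α β n F := by
  have hcomp := c_compatibility hα h hF horth
  unfold cFormula
  split_ifs with hθ
  · refine ⟨div_mul_cancel₀ _ hθ, ?_⟩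
    rw [div_mul_eq_mul_div, hcomp, mul_div_cancel_right₀ _ hθ]
  · simp only [not_not] at hθ
    have hc : Real.cos (om α β n * (1 - α)) ≠ 0 := fun hc => by
      have := Real.sin_sq_add_cos_sq (om α β n * (1 - α))
      rw [hθ, hc] at this; norm_num at this
    rw [hθ, mul_zero] at hcomp
    rw [hθ, mul_zero]
    exact ⟨((mul_eq_zero.1 hcomp).resolve_right hc).symm, div_mul_cancel₀ _ hc⟩

theorem uFormula_left {x : ℝ} (hx : x ≤ α) : uFormula α β n F x =
    ∫ y in (0 : ℝ)..x, Real.sin (om α β n * (x - y)) / om α β n * F y := if_pos hx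

theorem uFormula_right (hα : α ∈ Set.Ioo (0 : ℝ) 1) (h : Admissible α β n)
    (hF : IntervalIntegrable F volume 0 1) (horth : ∫ x in (0 : ℝ)..1, u0 α β n x * F x = 0)
    {x : ℝ} (hx : α ≤ x) : uFormula α β n F x =
      cFormula α β n F * Real.sin (om α β n * (1 - x)) +
        ∫ y in (1 : ℝ)..x, Real.sin (om α β n * (x - y)) / om α β n * F y := by
  rcases hx.eq_or_lt with rfl | hx
  · have hαI : α ∈ Set.Icc (0 : ℝ) 1 := ⟨hα.1.le, hα.2.le⟩
    have h0I : (0 : ℝ) ∈ Set.Icc (0 : ℝ) 1 := by simp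
    have h1I : (1 : ℝ) ∈ Set.Icc (0 : ℝ) 1 := by simp
    rw [uFormula_left le_rfl, (cFormula_spec hα h hF horth).1, cRhs₁,
      intervalIntegral.integral_add_adjacent_intervals]
    · exact hF.continuousOn_mul (by fun_prop)
    · exact (intervalIntegrable_sub hF h1I hαI).continuousOn_mul (by fun_prop)
  · rw [uFormula, if_neg (not_le.2 hx), intervalIntegral.integral_symm 1 x, sub_neg_eq_add]

theorem hasDerivWithinAt_uFormula_left (hα : α ∈ Set.Ioo (0 : ℝ) 1) (h : Admissible α β n)
    (hF : IntervalIntegrable F volume 0 1) {x : ℝ} (hx : x ∈ Set.Icc 0 α) :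
    HasDerivWithinAt (uFormula α β n F)
      (∫ y in (0 : ℝ)..x, Real.cos (om α β n * (x - y)) * F y) (Set.Icc 0 α) x := by
  have := (hasDerivWithinAt_sin_kernel hF h.om_pos (b := 0) (by simp)
    (x := x) ⟨hx.1, hx.2.trans hα.2.le⟩).mono (Set.Icc_subset_Icc_right hα.2.le)
  exact this.congr_of_mem (fun z hz => uFormula_left hz.2) hx

theorem hasDerivWithinAt_uFormula_right (hα : α ∈ Set.Ioo (0 : ℝ) 1) (h : Admissible α β n)
    (hF : IntervalIntegrable F volume 0 1) (horth : ∫ x in (0 : ℝ)..1, u0 α β n x * F x = 0)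
    {x : ℝ} (hx : x ∈ Set.Icc α 1) :
    HasDerivWithinAt (uFormula α β n F)
      (-(cFormula α β n F * om α β n * Real.cos (om α β n * (1 - x))) +
        ∫ y in (1 : ℝ)..x, Real.cos (om α β n * (x - y)) * F y) (Set.Icc α 1) x := by
  have h1 := (hasDerivWithinAt_sin_kernel hF h.om_pos (b := 1) (by simp)
    (x := x) ⟨hα.1.le.trans hx.1, hx.2⟩).mono (Set.Icc_subset_Icc_left hα.1.le)
  have hm : HasDerivAt (fun z => om α β n * (1 - z)) (om α β n * (-1)) x := by
    simpa using ((hasDerivAt_id x).const_sub 1).const_mul (om α β n)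
  have h2 := (hm.sin.const_mul (cFormula α β n F)).hasDerivWithinAt (s := Set.Icc α 1)
  have h3 := h2.add h1
  refine (h3.congr_deriv (by ring)).congr_of_mem (fun z hz => ?_) hx
  exact uFormula_right hα h hF horth hz.1

theorem continuousOn_uFormula (hα : α ∈ Set.Ioo (0 : ℝ) 1) (h : Admissible α β n)
    (hF : IntervalIntegrable F volume 0 1) (horth : ∫ x in (0 : ℝ)..1, u0 α β n x * F x = 0) :
    ContinuousOn (uFormula α β n F) (Set.Icc 0 1) := by
  rw [← Set.Icc_union_Icc_eq_Icc hα.1.le hα.2.le]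
  refine ContinuousOn.union_of_isClosed ?_ ?_ isClosed_Icc isClosed_Icc
  · exact fun x hx => (hasDerivWithinAt_uFormula_left hα h hF hx).continuousWithinAt
  · exact fun x hx => (hasDerivWithinAt_uFormula_right hα h hF horth hx).continuousWithinAt

/-- Squaring and adding the two equations for `c` removes the trigonometric factors, so no division
by a possibly small sine occurs. -/
theorem abs_cFormula_le (hα : α ∈ Set.Ioo (0 : ℝ) 1) (hβ : 0 ≤ β) (h : Admissible α β n)
    (hF : IntervalIntegrable F volume 0 1) (horth : ∫ x in (0 : ℝ)..1, u0 α β n x * F x = 0) :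
    |cFormula α β n F| ≤ √(1 + (1 + β / om α β n) ^ 2) / om α β n * normL1 F := by
  have hω := h.om_pos
  have hI := normL1_nonneg F
  obtain ⟨h1, h2⟩ := cFormula_spec hα h hF horth
  have b1 : |cRhs₁ α β n F| ≤ 1 / om α β n * normL1 F :=
    abs_integral_mul_le hF le_rfl zero_le_one le_rfl fun t => abs_sin_div_le' hω _
  have b2 : |cRhs₂ α β n F| ≤ (1 + β / om α β n) * (1 / om α β n * normL1 F) := by
    have b3 : |∫ x in (0 : ℝ)..1, Real.cos (om α β n * (α - x)) / om α β n * F x| ≤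
        1 / om α β n * normL1 F :=
      abs_integral_mul_le hF le_rfl zero_le_one le_rfl fun t => by
        rw [abs_div, abs_of_pos hω]; gcongr; exact Real.abs_cos_le_one _
    have b4 : |∫ x in (0 : ℝ)..α, Real.sin (om α β n * (α - x)) / lam0 α β n * F x| ≤
        1 / om α β n ^ 2 * normL1 F :=
      abs_integral_mul_le hF le_rfl hα.1.le hα.2.le fun t => by
        rw [← om_sq hω]; exact abs_sin_div_le' (by positivity) _
    unfold cRhs₂
    refine (abs_sub _ _).trans ?_
    rw [abs_neg, abs_mul, abs_of_nonneg hβ]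
    have b5 := mul_le_mul_of_nonneg_left b4 hβ
    have e : (1 + β / om α β n) * (1 / om α β n * normL1 F) =
      1 / om α β n * normL1 F + β * (1 / om α β n ^ 2 * normL1 F) := by field_simp
    rw [e]
    exact add_le_add b3 b5
  have hsq : cFormula α β n F ^ 2 = cRhs₁ α β n F ^ 2 + cRhs₂ α β n F ^ 2 := by
    rw [← h1, ← h2]
    linear_combination (-(cFormula α β n F) ^ 2) *
      Real.sin_sq_add_cos_sq (om α β n * (1 - α))
  have hn1 : 0 ≤ 1 / om α β n * normL1 F := by positivity
  have q1 := sq_le_sq' (by linarith [neg_abs_le (cRhs₁ α β n F)]) ((le_abs_self _).trans b1)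
  have q2 := sq_le_sq' (by linarith [neg_abs_le (cRhs₂ α β n F)]) ((le_abs_self _).trans b2)
  refine Real.abs_le_sqrt (y := (1 + (1 + β / om α β n) ^ 2) * (1 / om α β n * normL1 F) ^ 2)
    (by rw [hsq]; nlinarith) |>.trans (le_of_eq ?_)
  rw [Real.sqrt_mul (by positivity), Real.sqrt_sq hn1]
  ring

theorem supNorm_uFormula_le (hα : α ∈ Set.Ioo (0 : ℝ) 1) (hβ : 0 ≤ β) (h : Admissible α β n)
    (hF : IntervalIntegrable F volume 0 1) (horth : ∫ x in (0 : ℝ)..1, u0 α β n x * F x = 0) :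
    supNorm (uFormula α β n F) ≤ aConst α β n * normL1 F := by
  have hω := h.om_pos
  have hI := normL1_nonneg F
  have hc := abs_cFormula_le hα hβ h hF horth
  have e : aConst α β n * normL1 F =
      √(1 + (1 + β / om α β n) ^ 2) / om α β n * normL1 F + 1 / om α β n * normL1 F := by
    rw [aConst]; ring
  rw [e]
  refine supNorm_le fun x hx => ?_
  rcases le_total x α with hxα | hxα
  · rw [uFormula_left hxα]
    refine (abs_integral_mul_le hF le_rfl hx.1 hx.2 fun t => abs_sin_div_le' hω _).trans ?_
    exact le_add_of_nonneg_left (by positivity)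
  · rw [uFormula_right hα h hF horth hxα]
    refine (abs_add_le _ _).trans (add_le_add ?_ ?_)
    · rw [abs_mul]
      exact (mul_le_of_le_one_right (abs_nonneg _) (Real.abs_sin_le_one _)).trans hc
    · rw [intervalIntegral.integral_symm, abs_neg]
      exact abs_integral_mul_le hF hx.1 hx.2 le_rfl fun t => abs_sin_div_le' hω _

end Linear

/-! ## Estimates of the corrections -/

theorem continuousOn_powCoeff {u : ℕ → ℝ → ℝ} {K : ℕ} {s : Set ℝ}
    (hu : ∀ i ≤ K, ContinuousOn (u i) s) (p : ℕ) :
    ∀ k ≤ K, ContinuousOn (fun x => powCoeff (fun i => u i x) p k) s := by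
  induction p with
  | zero => intro k _; simp only [powCoeff_zero]; exact continuousOn_const
  | succ p ih =>
    intro k hk
    simp only [powCoeff_succ]
    refine continuousOn_finsetSum _ fun ij hij => ?_
    have := Finset.HasAntidiagonal.mem_antidiagonal.1 hij
    exact (ih _ (by omega)).mul (hu _ (by omega))

/-- Weierstrass test, with the composition coefficients of the maximum norms as majorant. -/
theorem continuousOn_adomian {a : ℕ → ℝ} (ha : ∀ u : ℝ, Summable fun p : ℕ => a p * u ^ p)
    {u : ℕ → ℝ → ℝ} {k : ℕ} (hu : ∀ i ≤ k, ContinuousOn (u i) (Set.Icc 0 1)) :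
    ContinuousOn (fun x => adomian (powerFun a) k (fun p => u p x)) (Set.Icc 0 1) := by
  simp only [adomian_eq ha, compCoeff]
  refine continuousOn_tsum (u := fun p => |a p| * powCoeff (fun i => supNorm (u i)) p k)
    (fun p => continuousOn_const.mul (continuousOn_powCoeff hu p k le_rfl))
    (summable_mul_powCoeff (summable_abs_mul_pow ha) _ k) fun p x hx => ?_
  rw [norm_mul]
  exact mul_le_mul_of_nonneg_left
    (abs_powCoeff_le p (fun i hi => abs_le_supNorm (hu i hi) hx) k le_rfl) (abs_nonneg _)

theorem abs_adomian_le_supNorm {a : ℕ → ℝ} (ha : ∀ u : ℝ, Summable fun p : ℕ => a p * u ^ p)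
    {u : ℕ → ℝ → ℝ} {k : ℕ} (hu : ∀ i ≤ k, ContinuousOn (u i) (Set.Icc 0 1)) {x : ℝ}
    (hx : x ∈ Set.Icc (0 : ℝ) 1) :
    |adomian (powerFun a) k (fun p => u p x)| ≤
      adomian (majorantFun a) k (fun p => supNorm (u p)) :=
  abs_adomian_le ha fun i hi => abs_le_supNorm (hu i hi) hx

theorem continuousOn_intervalIntegrable {f : ℝ → ℝ} (hf : ContinuousOn f (Set.Icc 0 1)) :
    IntervalIntegrable f volume 0 1 :=
  ContinuousOn.intervalIntegrable (by rwa [Set.uIcc_of_le zero_le_one])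

theorem intervalIntegrable_mul_continuousOn {q f : ℝ → ℝ} (hq : IntervalIntegrable q volume 0 1)
    (hf : ContinuousOn f (Set.Icc 0 1)) : IntervalIntegrable (fun x => q x * f x) volume 0 1 :=
  hq.mul_continuousOn (by rwa [Set.uIcc_of_le zero_le_one])

theorem normL1_add_le {f g : ℝ → ℝ} (hf : IntervalIntegrable f volume 0 1)
    (hg : IntervalIntegrable g volume 0 1) :
    normL1 (fun x => f x + g x) ≤ normL1 f + normL1 g := by
  unfold normL1
  rw [← intervalIntegral.integral_add hf.abs hg.abs]
  exact intervalIntegral.integral_mono_on zero_le_one (hf.add hg).abs (hf.abs.add hg.abs)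
    fun x _ => abs_add_le _ _

theorem normL1_le_of_abs_le {f g : ℝ → ℝ} (hf : IntervalIntegrable f volume 0 1)
    (hg : IntervalIntegrable g volume 0 1)
    (h : ∀ x ∈ Set.Icc (0 : ℝ) 1, |f x| ≤ g x) : normL1 f ≤ ∫ x in (0 : ℝ)..1, g x :=
  intervalIntegral.integral_mono_on zero_le_one hf.abs hg h

theorem abs_integral_le_normL1 (f : ℝ → ℝ) : |∫ x in (0 : ℝ)..1, f x| ≤ normL1 f := by
  unfold normL1
  exact intervalIntegral.abs_integral_le_integral_abs zero_le_one

theorem normL1_mul_le {q f : ℝ → ℝ} (hq : IntervalIntegrable q volume 0 1)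
    (hf : ContinuousOn f (Set.Icc 0 1)) {C : ℝ} (hC : ∀ x ∈ Set.Icc (0 : ℝ) 1, |f x| ≤ C) :
    normL1 (fun x => q x * f x) ≤ normL1 q * C := by
  refine (normL1_le_of_abs_le (intervalIntegrable_mul_continuousOn hq hf)
    (hq.abs.mul_const C) fun x hx => ?_).trans_eq ?_
  · rw [abs_mul]; exact mul_le_mul_of_nonneg_left (hC x hx) (abs_nonneg _)
  · rw [intervalIntegral.integral_mul_const, normL1]

theorem normL1_le_const {f : ℝ → ℝ} (hf : ContinuousOn f (Set.Icc 0 1)) {C : ℝ}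
    (hC : ∀ x ∈ Set.Icc (0 : ℝ) 1, |f x| ≤ C) : normL1 f ≤ C := by
  refine (normL1_le_of_abs_le (continuousOn_intervalIntegrable hf)
    (intervalIntegrable_const (c := C)) hC).trans_eq (by simp)

/-! ### Bounds for the right-hand sides and the eigenvalue corrections, and orthogonality. -/

section Rhs

variable {α β : ℝ} {n : ℕ} {q : ℝ → ℝ} {a : ℕ → ℝ} {lam : ℕ → ℝ} {u : ℕ → ℝ → ℝ} {j : ℕ}

theorem intervalIntegrable_rhs (hq : IntervalIntegrable q volume 0 1)
    (ha : ∀ u : ℝ, Summable fun p : ℕ => a p * u ^ p)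
    (hu : ∀ i ≤ j, ContinuousOn (u i) (Set.Icc 0 1)) :
    IntervalIntegrable (rhs q (powerFun a) lam u (j + 1)) volume 0 1 := by
  unfold rhs
  refine IntervalIntegrable.add (IntervalIntegrable.add ?_ ?_) ?_
  · refine continuousOn_intervalIntegrable (ContinuousOn.neg ?_)
    refine continuousOn_finsetSum _ fun p hp => continuousOn_const.mul (hu p ?_)
    simp at hp; omega
  · exact intervalIntegrable_mul_continuousOn hq (hu _ (by omega))
  · exact continuousOn_intervalIntegrable (continuousOn_adomian ha fun i hi => hu i (by omega))

theorem normL1_rhs_le (hq : IntervalIntegrable q volume 0 1)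
    (ha : ∀ u : ℝ, Summable fun p : ℕ => a p * u ^ p)
    (hu : ∀ i ≤ j, ContinuousOn (u i) (Set.Icc 0 1)) :
    normL1 (rhs q (powerFun a) lam u (j + 1)) ≤
      ∑ p ∈ Finset.range (j + 1), |lam (j + 1 - p)| * supNorm (u p) +
        normL1 q * supNorm (u j) + adomian (majorantFun a) j (fun p => supNorm (u p)) := by
  have hsum : ContinuousOn (fun x => -∑ p ∈ Finset.range (j + 1), lam (j + 1 - p) * u p x)
      (Set.Icc 0 1) := by
    refine ContinuousOn.neg (continuousOn_finsetSum _ fun p hp => continuousOn_const.mul (hu p ?_))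
    simp at hp; omega
  have hA := continuousOn_adomian ha (k := j) (u := u) hu
  have hqu := intervalIntegrable_mul_continuousOn hq (hu j le_rfl)
  refine (normL1_add_le (f := fun x => -(∑ p ∈ Finset.range (j + 1), lam (j + 1 - p) * u p x) +
    q x * u j x) (g := fun x => adomian (powerFun a) j (fun p => u p x))
    ((continuousOn_intervalIntegrable hsum).add hqu) (continuousOn_intervalIntegrable hA)).trans ?_
  refine add_le_add ((normL1_add_le (continuousOn_intervalIntegrable hsum) hqu).trans
    (add_le_add ?_ ?_)) ?_
  · refine normL1_le_const hsum fun x hx => ?_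
    rw [abs_neg]
    refine (Finset.abs_sum_le_sum_abs _ _).trans (Finset.sum_le_sum fun p hp => ?_)
    rw [abs_mul]
    refine mul_le_mul_of_nonneg_left (abs_le_supNorm (hu p ?_) hx) (abs_nonneg _)
    simp at hp; omega
  · exact normL1_mul_le hq (hu j le_rfl) fun x hx => abs_le_supNorm (hu j le_rfl) hx
  · exact normL1_le_const hA fun x hx => abs_adomian_le_supNorm ha hu hx

theorem abs_lamFormula_le (h : Admissible α β n) (hq : IntervalIntegrable q volume 0 1)
    (ha : ∀ u : ℝ, Summable fun p : ℕ => a p * u ^ p)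
    (hu : ∀ i ≤ j, ContinuousOn (u i) (Set.Icc 0 1)) :
    |lamFormula α β q (powerFun a) n lam u (j + 1)| ≤ bConst α β n *
      (∑ p ∈ Finset.Ico 1 (j + 1), |lam (j + 1 - p)| * supNorm (u p) +
        normL1 q * supNorm (u j) + adomian (majorantFun a) j (fun p => supNorm (u p))) := by
  have hω := h.om_pos
  have hM := h.bigM_pos
  have hc0 := (continuous_u0 hω h.root).continuousOn (s := Set.Icc (0 : ℝ) 1)
  set s := supNorm (u0 α β n) with hs
  have hs0 : 0 ≤ s := supNorm_nonneg _
  set B := ∑ p ∈ Finset.Ico 1 (j + 1), |lam (j + 1 - p)| * supNorm (u p) +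
        normL1 q * supNorm (u j) + adomian (majorantFun a) j (fun p => supNorm (u p)) with hB
  have hA := continuousOn_adomian ha (k := j) (u := u) hu
  have e1 : |∑ p ∈ Finset.Ico 1 (j + 1), lam (j + 1 - p) *
      ∫ x in (0 : ℝ)..1, u0 α β n x * u p x| ≤
      (∑ p ∈ Finset.Ico 1 (j + 1), |lam (j + 1 - p)| * supNorm (u p)) * s := by
    rw [Finset.sum_mul]
    refine (Finset.abs_sum_le_sum_abs _ _).trans (Finset.sum_le_sum fun p hp => ?_)
    have hp' := hu p (by simp at hp; omega)
    rw [abs_mul, mul_assoc]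
    refine mul_le_mul_of_nonneg_left ?_ (abs_nonneg _)
    refine (abs_integral_le_normL1 _).trans (normL1_le_const (hc0.mul hp') fun x hx => ?_)
    rw [Pi.mul_apply, abs_mul, mul_comm]
    exact mul_le_mul (abs_le_supNorm hp' hx) (abs_le_supNorm hc0 hx) (abs_nonneg _)
      (supNorm_nonneg _)
  have e2 : |∫ x in (0 : ℝ)..1, q x * u j x * u0 α β n x| ≤ normL1 q * supNorm (u j) * s := by
    simp only [mul_assoc]
    refine (abs_integral_le_normL1 _).trans
      (normL1_mul_le hq ((hu j le_rfl).mul hc0) fun x hx => ?_)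
    rw [Pi.mul_apply, abs_mul]
    exact mul_le_mul (abs_le_supNorm (hu j le_rfl) hx) (abs_le_supNorm hc0 hx) (abs_nonneg _)
      (supNorm_nonneg _)
  have e3 : |∫ x in (0 : ℝ)..1, adomian (powerFun a) j (fun p => u p x) * u0 α β n x| ≤
      adomian (majorantFun a) j (fun p => supNorm (u p)) * s := by
    refine (abs_integral_le_normL1 _).trans (normL1_le_const (hA.mul hc0) fun x hx => ?_)
    rw [Pi.mul_apply, abs_mul]
    have := abs_adomian_le_supNorm ha hu hx
    exact mul_le_mul this (abs_le_supNorm hc0 hx) (abs_nonneg _) ((abs_nonneg _).trans this)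
  have hB0 : 0 ≤ B := by
    have hx0 : (0 : ℝ) ∈ Set.Icc (0 : ℝ) 1 := by simp
    refine add_nonneg (add_nonneg (Finset.sum_nonneg fun p _ =>
      mul_nonneg (abs_nonneg _) (supNorm_nonneg _)) (mul_nonneg (normL1_nonneg _)
        (supNorm_nonneg _))) ((abs_nonneg _).trans (abs_adomian_le_supNorm ha hu hx0))
  have hl : 0 ≤ lam0 α β n / bigM α β n := by rw [← om_sq hω]; positivity
  unfold lamFormula
  rw [abs_mul, abs_of_nonneg hl, Nat.add_sub_cancel]
  refine (mul_le_mul_of_nonneg_left (?_ : _ ≤ B * s) hl).trans ?_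
  · refine (abs_add_le _ _).trans ?_
    rw [hB, add_mul, add_mul]
    refine add_le_add ((abs_add_le _ _).trans (add_le_add ?_ e2)) e3
    rwa [abs_neg]
  · rw [mul_comm B, ← mul_assoc]
    exact mul_le_mul_of_nonneg_right h.lam0_div_bigM_mul_supNorm_le hB0

/-- The term `p = 0` contributes `-λ⁽ʲ⁾ Mₙ / λ⁽⁰⁾`, and the formula for `λ⁽ʲ⁾` is this condition
solved for it. -/
theorem orthogonal_rhs (h : Admissible α β n) (hq : IntervalIntegrable q volume 0 1)
    (ha : ∀ u : ℝ, Summable fun p : ℕ => a p * u ^ p)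
    (hu : ∀ i ≤ j, ContinuousOn (u i) (Set.Icc 0 1)) (hu0 : u 0 = u0 α β n)
    (hlam : lam (j + 1) = lamFormula α β q (powerFun a) n lam u (j + 1)) :
    ∫ x in (0 : ℝ)..1, u0 α β n x * rhs q (powerFun a) lam u (j + 1) x = 0 := by
  have hω := h.om_pos
  have hM := h.bigM_pos
  have hc0 := (continuous_u0 hω h.root).continuousOn (s := Set.Icc (0 : ℝ) 1)
  have hA := continuousOn_adomian ha (k := j) (u := u) hu
  have hl0 : lam0 α β n ≠ 0 := by rw [← om_sq hω]; positivity
  have i1 : ∀ p ∈ Finset.range (j + 1), IntervalIntegrable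
      (fun x => lam (j + 1 - p) * (u0 α β n x * u p x)) volume 0 1 := fun p hp =>
    (continuousOn_intervalIntegrable (hc0.mul (hu p (by simp at hp; omega)))).const_mul _
  have i2 : IntervalIntegrable (fun x => q x * u j x * u0 α β n x) volume 0 1 := by
    simp only [mul_assoc]
    exact intervalIntegrable_mul_continuousOn hq ((hu j le_rfl).mul hc0)
  have i3 : IntervalIntegrable (fun x => adomian (powerFun a) j (fun p => u p x) * u0 α β n x)
    volume 0 1 := continuousOn_intervalIntegrable (hA.mul hc0)
  have i1' : IntervalIntegrable (fun x => ∑ p ∈ Finset.range (j + 1),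
      lam (j + 1 - p) * (u0 α β n x * u p x)) volume 0 1 := by
    have := IntervalIntegrable.sum (Finset.range (j + 1)) i1
    rwa [Finset.sum_fn] at this
  have e : ∀ x, u0 α β n x * rhs q (powerFun a) lam u (j + 1) x =
      -(∑ p ∈ Finset.range (j + 1), lam (j + 1 - p) * (u0 α β n x * u p x)) +
      q x * u j x * u0 α β n x + adomian (powerFun a) j (fun p => u p x) * u0 α β n x := by
    intro x
    rw [rhs, Nat.add_sub_cancel, mul_add, mul_add, mul_neg, Finset.mul_sum]
    congr 1
    · congr 1
      · congr 1
        exact Finset.sum_congr rfl fun p _ => by ring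
      · ring
    · ring
  have i1n : IntervalIntegrable (fun x => -∑ p ∈ Finset.range (j + 1),
      lam (j + 1 - p) * (u0 α β n x * u p x)) volume 0 1 := i1'.neg
  simp only [e]
  rw [intervalIntegral.integral_add (i1n.add i2) i3, intervalIntegral.integral_add i1n i2,
    intervalIntegral.integral_neg, intervalIntegral.integral_finsetSum i1]
  simp only [intervalIntegral.integral_const_mul]
  rw [Finset.range_eq_Ico, Finset.sum_eq_sum_Ico_succ_bot (by omega), hu0]
  have e2 : ∫ x in (0 : ℝ)..1, u0 α β n x * u0 α β n x = bigM α β n / lam0 α β n := by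
    rw [bigM, mul_div_cancel_left₀ _ hl0]
    exact intervalIntegral.integral_congr fun x _ => (sq _).symm
  rw [e2, Nat.sub_zero, hlam, lamFormula, Nat.add_sub_cancel]
  field_simp
  ring

end Rhs

theorem aConst_pos {α β : ℝ} {n : ℕ} (h : Admissible α β n) : 0 < aConst α β n := by
  have := h.om_pos
  unfold aConst
  positivity

/-! ### The majorant induction. -/

section Corrections

variable {α β : ℝ} {n : ℕ} {q : ℝ → ℝ} {a : ℕ → ℝ}

/-- The factor `1 + v̄₀` is spent on `L` in the convolution and kept in front of the other terms,
while `b(n)` is absorbed once by `U` in each term. The powers of `a(n)` add up to `j` everywhere. -/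
theorem majorant_step (h : Admissible α β n) (ha0 : a 0 = 0)
    (ha : ∀ u : ℝ, Summable fun p : ℕ => a p * u ^ p) {U L : ℕ → ℝ} {j : ℕ}
    (hU0 : U 0 = supNorm (u0 α β n)) (hUnn : ∀ i, 0 ≤ U i)
    (hU : ∀ i ≤ j, bConst α β n * U i ≤ aConst α β n ^ i * vBar α β q a n i)
    (hL : ∀ i, i + 1 ≤ j →
      (1 + v0 α β n) * L (i + 1) ≤ aConst α β n ^ i * vBar α β q a n (i + 1)) :
    (1 + v0 α β n) * (bConst α β n * (∑ p ∈ Finset.Ico 1 (j + 1), L (j + 1 - p) * U p +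
        normL1 q * U j + adomian (majorantFun a) j U)) ≤
      aConst α β n ^ j * vBar α β q a n (j + 1) := by
  set A := aConst α β n with hA
  have hApos : 0 < A := aConst_pos h
  have hb := one_le_bConst α β n
  have hv0 := v0_nonneg α β n
  have hQ := normL1_nonneg q
  have hvnn := vBar_nonneg α β q ha n
  have hs := supNorm_nonneg (u0 α β n)
  have ha' := summable_abs_mul_pow ha
  rw [vBar_succ, vBarFormula]
  rcases j with _ | j
  · rw [if_pos rfl]
    have e1 : adomian (majorantFun a) 0 U = majorantFun a (supNorm (u0 α β n)) := by
      rw [majorantFun_eq, adomian_eq ha', compCoeff]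
      simp only [powCoeff_apply_zero, hU0]
      rfl
    have e2 : deriv (majorantFun₁ α β a n) 0 = shiftCoeff a (supNorm (u0 α β n)) 1 :=
      deriv_shift ha _
    rw [e1, e2, hU0]
    simp only [zero_add, Finset.Ico_self, Finset.sum_empty, pow_zero, one_mul]
    refine mul_le_mul_of_nonneg_left ?_ (by linarith)
    -- In the first step no entry of positive index can absorb `b(n)`; `Ñ(s) ≤ s Ñ'(s)` provides the
    -- factor `‖u0‖` that combines with it to `v̄₀`.
    have h1 := mul_le_mul_of_nonneg_left (majorantFun_le_mul ha0 ha hs)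
      (zero_le_one.trans hb)
    unfold v0
    linarith
  · rw [if_neg (by omega), show j + 1 + 1 - 1 = j + 1 by omega]
    have t1 : (1 + v0 α β n) * (bConst α β n *
        ∑ p ∈ Finset.Ico 1 (j + 1 + 1), L (j + 1 + 1 - p) * U p) ≤
        A ^ (j + 1) * ∑ p ∈ Finset.Ico 1 (j + 1 + 1),
          vBar α β q a n (j + 1 + 1 - p) * vBar α β q a n p := by
      rw [Finset.mul_sum, Finset.mul_sum, Finset.mul_sum]
      refine Finset.sum_le_sum fun p hp => ?_
      have hp := Finset.mem_Ico.1 hp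
      obtain ⟨i, hi⟩ : ∃ i, j + 1 + 1 - p = i + 1 := ⟨j + 1 - p, by omega⟩
      have h1 := hL i (by omega)
      have h2 := hU p (by omega)
      rw [hi, show j + 1 = i + p by omega, pow_add]
      have := mul_le_mul h1 h2 (mul_nonneg (zero_le_one.trans hb) (hUnn p))
        (mul_nonneg (by positivity) (hvnn _))
      linarith
    have t2 : bConst α β n * (normL1 q * U (j + 1)) ≤
        A ^ (j + 1) * (normL1 q * vBar α β q a n (j + 1)) := by
      have := mul_le_mul_of_nonneg_left (hU (j + 1) le_rfl) hQ
      linarith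
    have t3 : bConst α β n * adomian (majorantFun a) (j + 1) U ≤
        A ^ (j + 1) * adomian (majorantFun₁ α β a n) (j + 1)
          (fun p => if p = 0 then 0 else vBar α β q a n p) := by
      have e : majorantFun₁ α β a n = fun u => majorantFun a (supNorm (u0 α β n) + u) := rfl
      -- The shift restores `‖u0‖` as entry `0`, and by homogeneity the power of `a(n)` moves into
      -- the sequence, leaving that entry unchanged.
      rw [e, adomian_shift, majorantFun_eq, ← adomian_scale ha', ← majorantFun_eq]
      refine mul_adomian_le ha hb hUnn ?_ (by omega) fun i hi1 hi2 => ?_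
      · simp [hU0]
      · simp only [show i ≠ 0 by omega, if_false]
        exact hU i hi2
    have hk : 0 ≤ 1 + v0 α β n := by linarith
    have t23 := mul_le_mul_of_nonneg_left (add_le_add t2 t3) hk
    linarith

/-- Continuity and both bounds must be proved together: `F⁽ʲ⁾` already contains `λ⁽ʲ⁾`, and solving
for `u⁽ʲ⁾` needs the orthogonality. -/
theorem fd_estimates (hα : α ∈ Set.Ioo (0 : ℝ) 1) (hβ : 0 ≤ β) (h : Admissible α β n)
    (hq : IntervalIntegrable q volume 0 1) (ha0 : a 0 = 0)
    (ha : ∀ u : ℝ, Summable fun p : ℕ => a p * u ^ p) (j : ℕ) :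
    ContinuousOn (fdU α β q (powerFun a) n j) (Set.Icc 0 1) ∧
    bConst α β n * supNorm (fdU α β q (powerFun a) n j) ≤
      aConst α β n ^ j * vBar α β q a n j ∧
    (∀ i, j = i + 1 → (1 + v0 α β n) * |fdLam α β q (powerFun a) n j| ≤
      aConst α β n ^ i * vBar α β q a n j) := by
  have hω := h.om_pos
  induction j using Nat.strong_induction_on with
  | _ j ih =>
  rcases j with _ | j
  · refine ⟨?_, ?_, fun i hi => by omega⟩
    · rw [fdU_zero]; exact (continuous_u0 hω h.root).continuousOn
    · rw [fdU_zero, vBar_zero, pow_zero, one_mul, v0]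
  · set lam := fdLam α β q (powerFun a) n with hlam
    set u := fdU α β q (powerFun a) n with hu
    have hc : ∀ i ≤ j, ContinuousOn (u i) (Set.Icc 0 1) := fun i hi => (ih i (by omega)).1
    have hlj : lam (j + 1) = lamFormula α β q (powerFun a) n lam u (j + 1) :=
      fdLam_succ α β q (powerFun a) n j
    have huj : u (j + 1) = uFormula α β n (rhs q (powerFun a) lam u (j + 1)) :=
      fdU_succ α β q (powerFun a) n j
    have hF := intervalIntegrable_rhs (lam := lam) hq ha hc
    have horth := orthogonal_rhs h hq ha hc (fdU_zero α β q (powerFun a) n) hlj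
    have hlle := abs_lamFormula_le (lam := lam) h hq ha hc
    have hFle := normL1_rhs_le (lam := lam) hq ha hc
    have hule := supNorm_uFormula_le hα hβ h hF horth
    have hstep := majorant_step (q := q) (j := j) h ha0 ha (U := fun i => supNorm (u i))
      (L := fun i => |lam i|) rfl (fun i => supNorm_nonneg _)
      (fun i hi => (ih i (by omega)).2.1) (fun i hi => (ih (i + 1) (by omega)).2.2 i rfl)
    rw [← hlj] at hlle
    rw [← huj] at hule
    rw [Finset.range_eq_Ico, Finset.sum_eq_sum_Ico_succ_bot (by omega), Nat.sub_zero] at hFle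
    set B := ∑ p ∈ Finset.Ico 1 (j + 1), |lam (j + 1 - p)| * supNorm (u p) +
        normL1 q * supNorm (u j) + adomian (majorantFun a) j (fun p => supNorm (u p)) with hB
    have hv0 := v0_nonneg α β n
    have hApos := aConst_pos h
    have hb := one_le_bConst α β n
    refine ⟨?_, ?_, fun i hi => ?_⟩
    · rw [huj]; exact continuousOn_uFormula hα h hF horth
    · have hFle' : normL1 (rhs q (powerFun a) lam u (j + 1)) ≤
          |lam (j + 1)| * supNorm (u0 α β n) + B := by
        have : u 0 = u0 α β n := rfl
        rw [this] at hFle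
        refine hFle.trans (le_of_eq ?_)
        rw [hB]; ring
      -- Origin of `1 + v̄₀`: with `|λ⁽ʲ⁾| ≤ b B`, the right-hand side has norm at most `(b ‖u0‖ +
      -- 1) B`.
      have h1 := mul_le_mul_of_nonneg_right hlle (supNorm_nonneg (u0 α β n))
      have h2 : normL1 (rhs q (powerFun a) lam u (j + 1)) ≤ (1 + v0 α β n) * B := by
        refine hFle'.trans ?_
        rw [v0]
        linarith
      calc bConst α β n * supNorm (u (j + 1))
          ≤ bConst α β n * (aConst α β n * ((1 + v0 α β n) * B)) := by
            refine mul_le_mul_of_nonneg_left (hule.trans ?_) (by linarith)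
            exact mul_le_mul_of_nonneg_left h2 hApos.le
        _ = aConst α β n * ((1 + v0 α β n) * (bConst α β n * B)) := by ring
        _ ≤ aConst α β n * (aConst α β n ^ j * vBar α β q a n (j + 1)) :=
            mul_le_mul_of_nonneg_left hstep hApos.le
        _ = _ := by ring
    · obtain rfl : i = j := by omega
      exact (mul_le_mul_of_nonneg_left hlle (by linarith)).trans hstep

end Corrections

/-! ## Solutions of the full problem from solutions of the integral equation -/

/-- `A cos (ω x) + ∫_b^x cos (ω (x - y)) G y dy + B ω cos (ω (1 - x))`, in a form which
separates the variables. -/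
def derivBranch (ω A B b : ℝ) (G : ℝ → ℝ) (x : ℝ) : ℝ :=
  Real.cos (ω * x) * (A + ∫ y in b..x, Real.cos (ω * y) * G y) +
    Real.sin (ω * x) * (∫ y in b..x, Real.sin (ω * y) * G y) +
    B * ω * Real.cos (ω * (1 - x))

theorem absolutelyContinuous_derivBranch {G : ℝ → ℝ} (hG : IntervalIntegrable G volume 0 1)
    (ω A B : ℝ) {b c d : ℝ} (hc : c ∈ Set.Icc (0 : ℝ) 1) (hd : d ∈ Set.Icc (0 : ℝ) 1)
    (hb : b ∈ Set.Icc (0 : ℝ) 1) :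
    AbsolutelyContinuousOnInterval (derivBranch ω A B b G) c d := by
  suffices h : AbsolutelyContinuousOnInterval (derivBranch ω A B b G) 0 1 by
    refine h.mono ?_
    rw [Set.uIcc_of_le zero_le_one]
    exact Set.uIcc_subset_Icc hc hd
  have hb' : b ∈ Set.uIcc (0 : ℝ) 1 := by rwa [Set.uIcc_of_le zero_le_one]
  have hsm : ∀ f : ℝ → ℝ, ContDiff ℝ 1 f → AbsolutelyContinuousOnInterval f 0 1 :=
    fun f hf => hf.contDiffOn.absolutelyContinuousOnInterval
  have hC := (hG.continuousOn_mul (g := fun y => Real.cos (ω * y))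
    (by fun_prop)).absolutelyContinuousOnInterval_intervalIntegral hb'
  have hS := (hG.continuousOn_mul (g := fun y => Real.sin (ω * y))
    (by fun_prop)).absolutelyContinuousOnInterval_intervalIntegral hb'
  exact (((hsm (fun x => Real.cos (ω * x)) (by fun_prop)).mul
    ((hsm (fun _ => A) (by fun_prop)).add hC)).add
    ((hsm (fun x => Real.sin (ω * x)) (by fun_prop)).mul hS)).add
    (hsm (fun x => B * ω * Real.cos (ω * (1 - x))) (by fun_prop))

/-- With the variables separated, Lebesgue differentiation of the two primitives gives the
derivative almost everywhere; `sin² + cos² = 1` collects the term `G x`. -/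
theorem ae_hasDerivAt_derivBranch {G : ℝ → ℝ} (hG : IntervalIntegrable G volume 0 1)
    {ω : ℝ} (hω : 0 < ω) (A B : ℝ) {b : ℝ} (hb : b ∈ Set.Icc (0 : ℝ) 1) :
    ∀ᵐ x, x ∈ Set.Icc (0 : ℝ) 1 → HasDerivAt (derivBranch ω A B b G)
      (G x - ω ^ 2 * (A * Real.sin (ω * x) / ω - B * Real.sin (ω * (1 - x)) +
        ∫ y in b..x, Real.sin (ω * (x - y)) / ω * G y)) x := by
  have h01 := Set.uIcc_of_le (zero_le_one' ℝ)
  filter_upwards [(hG.continuousOn_mul (g := fun y => Real.cos (ω * y))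
    (by fun_prop)).ae_hasDerivAt_integral, (hG.continuousOn_mul (g := fun y => Real.sin (ω * y))
    (by fun_prop)).ae_hasDerivAt_integral] with x h1 h2 hx
  rw [h01] at h1 h2
  have h1 := h1 hx b hb
  have h2 := h2 hx b hb
  have hm : HasDerivAt (fun z => ω * z) ω x := by simpa using (hasDerivAt_id x).const_mul ω
  have hm' : HasDerivAt (fun z => ω * (1 - z)) (ω * (-1)) x := by
    simpa using ((hasDerivAt_id x).const_sub 1).const_mul ω
  have h3 := ((hm.cos.mul (h1.const_add A)).add (hm.sin.mul h2)).add (hm'.cos.const_mul (B * ω))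
  refine h3.congr_deriv ?_
  rw [integral_sin_kernel hG ω x hb hx]
  have hsc := Real.sin_sq_add_cos_sq (ω * x)
  field_simp
  linear_combination G x * hsc

/-- Variation of constants gives `u'' = G - λ⁽⁰⁾u` on each side. The jump at `α` is the sum of the
jump identity for `u0` and the second equation for the coefficient `C`, which holds thanks to
orthogonality. -/
theorem isSolution_of_eq {α β : ℝ} (hα : α ∈ Set.Ioo (0 : ℝ) 1) {n : ℕ} (h : Admissible α β n)
    {q N G u : ℝ → ℝ} {lam : ℝ} (hG : IntervalIntegrable G volume 0 1)
    (horth : ∫ x in (0 : ℝ)..1, u0 α β n x * G x = 0)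
    (hu : ∀ x ∈ Set.Icc (0 : ℝ) 1, u x = u0 α β n x + uFormula α β n G x)
    (hGu : ∀ x ∈ Set.Icc (0 : ℝ) 1, G x = -((lam - lam0 α β n) * u x) + q x * u x + N (u x)) :
    IsSolution α β q N lam u := by
  have hω := h.om_pos
  have hα0 := hα.1
  have hα1 := hα.2
  have hαI : α ∈ Set.Icc (0 : ℝ) 1 := ⟨hα.1.le, hα.2.le⟩
  have h0I : (0 : ℝ) ∈ Set.Icc (0 : ℝ) 1 := by simp
  have h1I : (1 : ℝ) ∈ Set.Icc (0 : ℝ) 1 := by simp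
  set ω := om α β n with hωdef
  set C := cFormula α β n G with hC
  have hul : ∀ x ∈ Set.Icc 0 α, u x = Real.sin (ω * x) / ω +
      ∫ y in (0 : ℝ)..x, Real.sin (ω * (x - y)) / ω * G y := fun x hx => by
    rw [hu x ⟨hx.1, hx.2.trans hα1.le⟩, u0_left hx.2, uFormula_left hx.2]
  have hur : ∀ x ∈ Set.Icc α 1, u x = (c0 α β n + C) * Real.sin (ω * (1 - x)) +
      ∫ y in (1 : ℝ)..x, Real.sin (ω * (x - y)) / ω * G y := fun x hx => by
    rw [hu x ⟨hα0.le.trans hx.1, hx.2⟩, u0_right hω h.root hx.1,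
      uFormula_right hα h hG horth hx.1]
    ring
  have hm : ∀ x, HasDerivAt (fun z => ω * z) ω x := fun x => by
    simpa using (hasDerivAt_id x).const_mul ω
  have hm' : ∀ x, HasDerivAt (fun z => ω * (1 - z)) (ω * (-1)) x := fun x => by
    simpa using ((hasDerivAt_id x).const_sub 1).const_mul ω
  refine ⟨?_, ?_, ?_, derivBranch ω 1 0 0 G, derivBranch ω 0 (-(c0 α β n + C)) 1 G,
    fun x hx => ?_, fun x hx => ?_, absolutelyContinuous_derivBranch hG ω _ _ h0I hαI h0I,
    absolutelyContinuous_derivBranch hG ω _ _ hαI h1I h1I, ?_, ?_, ?_, ?_⟩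
  · exact ((continuous_u0 hω h.root).continuousOn.add
      (continuousOn_uFormula hα h hG horth)).congr hu
  · rw [hul 0 ⟨le_rfl, hα0.le⟩]; simp
  · rw [hur 1 ⟨hα1.le, le_rfl⟩]; simp
  · have hxI : x ∈ Set.Icc (0 : ℝ) 1 := ⟨hx.1, hx.2.trans hα1.le⟩
    have h1 := hasDerivWithinAt_uFormula_left hα h hG hx
    have h2 := ((hm x).sin.div_const ω).hasDerivWithinAt (s := Set.Icc 0 α)
    refine ((h2.add h1).congr_deriv ?_).congr_of_mem (fun z hz => ?_) hx
    · rw [integral_cos_kernel hG ω x h0I hxI, derivBranch]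
      field_simp
      ring
    · simp only [Pi.add_apply]
      rw [hul z hz, uFormula_left hz.2]
  · have hxI : x ∈ Set.Icc (0 : ℝ) 1 := ⟨hα0.le.trans hx.1, hx.2⟩
    have h1 := hasDerivWithinAt_uFormula_right hα h hG horth hx
    have h2 := ((hm' x).sin.const_mul (c0 α β n)).hasDerivWithinAt (s := Set.Icc α 1)
    refine ((h2.add h1).congr_deriv ?_).congr_of_mem (fun z hz => ?_) hx
    · rw [integral_cos_kernel hG ω x h1I hxI, derivBranch]
      ring
    · simp only [Pi.add_apply]
      rw [hur z hz, uFormula_right hα h hG horth hz.1]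
      ring
  · filter_upwards [ae_hasDerivAt_derivBranch hG hω 1 0 h0I] with x hx hxα
    have hxI : x ∈ Set.Icc (0 : ℝ) 1 := ⟨hxα.1.le, hxα.2.le.trans hα1.le⟩
    refine (hx hxI).congr_deriv ?_
    rw [om_sq hω, one_mul, zero_mul, sub_zero, ← hul x ⟨hxα.1.le, hxα.2.le⟩, hGu x hxI]
    ring
  · filter_upwards [ae_hasDerivAt_derivBranch hG hω 0 (-(c0 α β n + C)) h1I] with x hx hxα
    have hxI : x ∈ Set.Icc (0 : ℝ) 1 := ⟨hα0.le.trans hxα.1.le, hxα.2.le⟩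
    refine (hx hxI).congr_deriv ?_
    rw [om_sq hω, zero_mul, zero_div, zero_sub, neg_mul, neg_neg,
      ← hur x ⟨hxα.1.le, hxα.2.le⟩, hGu x hxI]
    ring
  · simp [derivBranch]
  · have k2 := c0_cos hω h.root
    have k3 := (cFormula_spec hα h hG horth).2
    rw [← hC, ← hωdef] at k3
    rw [← hωdef] at k2
    have hcos : ∀ {b c : ℝ}, b ∈ Set.Icc (0 : ℝ) 1 → c ∈ Set.Icc (0 : ℝ) 1 →
        IntervalIntegrable (fun y => Real.cos (ω * (α - y)) * G y) volume b c := fun hb hc =>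
      (intervalIntegrable_sub hG hb hc).continuousOn_mul (by fun_prop)
    have e1 : derivBranch ω 1 0 0 G α = Real.cos (ω * α) +
        ∫ y in (0 : ℝ)..α, Real.cos (ω * (α - y)) * G y := by
      rw [integral_cos_kernel hG ω α h0I hαI, derivBranch]; ring
    have e2 : derivBranch ω 0 (-(c0 α β n + C)) 1 G α =
        -(c0 α β n + C) * ω * Real.cos (ω * (1 - α)) +
        ∫ y in (1 : ℝ)..α, Real.cos (ω * (α - y)) * G y := by
      rw [integral_cos_kernel hG ω α h1I hαI, derivBranch]; ring
    have e3 : (∫ y in (0 : ℝ)..1, Real.cos (ω * (α - y)) * G y) +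
        ∫ y in (1 : ℝ)..α, Real.cos (ω * (α - y)) * G y =
        ∫ y in (0 : ℝ)..α, Real.cos (ω * (α - y)) * G y :=
      intervalIntegral.integral_add_adjacent_intervals (hcos h0I h1I) (hcos h1I hαI)
    have e4 : cRhs₂ α β n G = -((∫ y in (0 : ℝ)..1, Real.cos (ω * (α - y)) * G y) / ω) -
        β * ((∫ y in (0 : ℝ)..α, Real.sin (ω * (α - y)) / ω * G y) / ω) := by
      rw [cRhs₂, ← intervalIntegral.integral_div, ← intervalIntegral.integral_div, ← om_sq hω]
      congr 2
      · exact intervalIntegral.integral_congr fun y _ => by rw [div_mul_eq_mul_div]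
      · refine intervalIntegral.integral_congr fun y _ => ?_
        rw [← hωdef]
        field_simp
    rw [e4] at k3
    rw [e1, e2, hul α ⟨hα0.le, le_rfl⟩, ← e3]
    have k3' : C * ω * Real.cos (ω * (1 - α)) =
        -(∫ y in (0 : ℝ)..1, Real.cos (ω * (α - y)) * G y) -
        β * (∫ y in (0 : ℝ)..α, Real.sin (ω * (α - y)) / ω * G y) := by
      rw [mul_right_comm, k3]
      field_simp
    linear_combination (-1) * k2 - k3'

/-! ## Summation of the corrections -/

/-- Summation and integration commute because the `L₁` norms are summable and the kernel is bounded.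
-/
theorem hasSum_integral_kernel {F : ℕ → ℝ → ℝ} {G k : ℝ → ℝ} {K : ℝ}
    (hF : ∀ j, IntervalIntegrable (F j) volume 0 1) (hs : Summable fun j => normL1 (F j))
    (hG : ∀ x ∈ Set.Icc (0 : ℝ) 1, HasSum (fun j => F j x) (G x))
    (hk : Continuous k) (hK : ∀ t, |k t| ≤ K) {b c : ℝ} (hb : b ∈ Set.Icc (0 : ℝ) 1)
    (hc : c ∈ Set.Icc (0 : ℝ) 1) :
    HasSum (fun j => ∫ y in b..c, k y * F j y) (∫ y in b..c, k y * G y) := by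
  have key : ∀ {b c : ℝ}, b ∈ Set.Icc (0 : ℝ) 1 → c ∈ Set.Icc (0 : ℝ) 1 → b ≤ c →
      HasSum (fun j => ∫ y in b..c, k y * F j y) (∫ y in b..c, k y * G y) := by
    intro b c hb hc hbc
    simp only [intervalIntegral.integral_of_le hbc]
    have hint : ∀ j, IntegrableOn (fun y => k y * F j y) (Set.Ioc b c) := fun j =>
      (intervalIntegrable_iff_integrableOn_Ioc_of_le hbc).1
        ((intervalIntegrable_sub (hF j) hb hc).continuousOn_mul hk.continuousOn)
    have h := hasSum_integral_of_summable_integral_norm (μ := volume.restrict (Set.Ioc b c))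
      (F := fun j y => k y * F j y) hint ?_
    · have e : ∫ y in Set.Ioc b c, k y * G y = ∫ y in Set.Ioc b c, ∑' j, k y * F j y :=
        setIntegral_congr_fun measurableSet_Ioc fun y hy =>
          ((hG y ⟨hb.1.trans hy.1.le, hy.2.trans hc.2⟩).mul_left (k y)).tsum_eq.symm
      rw [e]
      exact h
    · refine (hs.mul_left K).of_nonneg_of_le (fun j => integral_nonneg fun _ => norm_nonneg _)
        fun j => ?_
      have := abs_integral_mul_le (F := fun y => |F j y|) (k := fun y => |k y|) (K := K)
        (hF j).abs hb.1 hbc hc.2 (fun t => by rw [abs_abs]; exact hK t)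
      have e : normL1 (fun y => |F j y|) = normL1 (F j) := by simp [normL1]
      rw [e, intervalIntegral.integral_of_le hbc] at this
      simp only [norm_mul, Real.norm_eq_abs]
      exact (le_abs_self _).trans this
  rcases le_total b c with hbc | hbc
  · exact key hb hc hbc
  · simp only [intervalIntegral.integral_symm c b]
    exact (key hc hb hbc).neg

section Linear

variable {α β : ℝ} {n : ℕ} {F : ℕ → ℝ → ℝ} {G : ℝ → ℝ}

theorem hasSum_cFormula (hα : α ∈ Set.Ioo (0 : ℝ) 1) (h : Admissible α β n)
    (hF : ∀ j, IntervalIntegrable (F j) volume 0 1) (hs : Summable fun j => normL1 (F j))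
    (hG : ∀ x ∈ Set.Icc (0 : ℝ) 1, HasSum (fun j => F j x) (G x)) :
    HasSum (fun j => cFormula α β n (F j)) (cFormula α β n G) := by
  have hω := h.om_pos
  have hαI : α ∈ Set.Icc (0 : ℝ) 1 := ⟨hα.1.le, hα.2.le⟩
  have h1 : HasSum (fun j => cRhs₁ α β n (F j)) (cRhs₁ α β n G) :=
    hasSum_integral_kernel hF hs hG (by fun_prop) (fun t => abs_sin_div_le' hω _) (by simp)
      (by simp)
  have h2 : HasSum (fun j => cRhs₂ α β n (F j)) (cRhs₂ α β n G) := by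
    refine HasSum.sub (HasSum.neg ?_) (HasSum.mul_left β ?_)
    · refine hasSum_integral_kernel hF hs hG (K := 1 / om α β n) (by fun_prop) (fun t => ?_)
        (by simp) (by simp)
      rw [abs_div, abs_of_pos hω]; gcongr; exact Real.abs_cos_le_one _
    · refine hasSum_integral_kernel hF hs hG (K := 1 / om α β n ^ 2) (by fun_prop) (fun t => ?_)
        (by simp) hαI
      rw [← om_sq hω]; exact abs_sin_div_le' (by positivity) _
  unfold cFormula
  split_ifs
  · exact h1.div_const _
  · exact h2.div_const _

theorem hasSum_uFormula (hα : α ∈ Set.Ioo (0 : ℝ) 1) (h : Admissible α β n)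
    (hF : ∀ j, IntervalIntegrable (F j) volume 0 1) (hs : Summable fun j => normL1 (F j))
    (hG : ∀ x ∈ Set.Icc (0 : ℝ) 1, HasSum (fun j => F j x) (G x)) {x : ℝ}
    (hx : x ∈ Set.Icc (0 : ℝ) 1) :
    HasSum (fun j => uFormula α β n (F j) x) (uFormula α β n G x) := by
  have hk : Continuous fun y => Real.sin (om α β n * (x - y)) / om α β n := by fun_prop
  have hK : ∀ y, |Real.sin (om α β n * (x - y)) / om α β n| ≤ 1 / om α β n :=
    fun y => abs_sin_div_le' h.om_pos _
  unfold uFormula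
  split_ifs
  · exact hasSum_integral_kernel hF hs hG hk hK (by simp) hx
  · exact ((hasSum_cFormula hα h hF hs hG).mul_right _).sub
      (hasSum_integral_kernel hF hs hG hk hK hx (by simp))

end Linear

theorem summable_normL1_rhs {q : ℝ → ℝ} {a lam : ℕ → ℝ} {u : ℕ → ℝ → ℝ}
    (hq : IntervalIntegrable q volume 0 1)
    (ha : ∀ u : ℝ, Summable fun p : ℕ => a p * u ^ p)
    (hu : ∀ i, ContinuousOn (u i) (Set.Icc 0 1)) (hU : Summable fun i => supNorm (u i))
    (hL : Summable fun i => |lam i|) :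
    Summable fun j => normL1 (rhs q (powerFun a) lam u (j + 1)) := by
  have hU' : Summable fun i => |supNorm (u i)| := hU.abs
  have hA := (hasSum_adomian (summable_abs_mul_pow ha) hU').summable
  have hL1 : Summable fun i => |lam (i + 1)| := (summable_nat_add_iff 1).2 hL
  have hC : Summable fun j => ∑ p ∈ Finset.range (j + 1), |lam (j + 1 - p)| * supNorm (u p) := by
    have := summable_norm_sum_mul_range_of_summable_norm
      (f := fun i => supNorm (u i)) (g := fun i => |lam (i + 1)|) (by simpa using hU')
      (by simpa using hL1)
    refine this.of_norm.congr fun j => Finset.sum_congr rfl fun p hp => ?_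
    simp only [Finset.mem_range] at hp
    rw [show j - p + 1 = j + 1 - p by omega, mul_comm]
  refine ((hC.add (hU.mul_left (normL1 q))).add hA).of_nonneg_of_le
    (fun j => normL1_nonneg _) fun j => ?_
  exact normL1_rhs_le hq ha fun i _ => hu i

/-- The linear terms form a Cauchy product and the Adomian polynomials sum to `N` of the sum. -/
theorem hasSum_rhs {q : ℝ → ℝ} {a lam : ℕ → ℝ} {u : ℕ → ℝ → ℝ}
    (ha : ∀ u : ℝ, Summable fun p : ℕ => a p * u ^ p)
    (hL : Summable fun i => |lam i|) {x : ℝ} (hU : Summable fun i => |u i x|) :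
    HasSum (fun j => rhs q (powerFun a) lam u (j + 1) x)
      (-((∑' i, lam i - lam 0) * ∑' i, u i x) + q x * (∑' i, u i x) +
        powerFun a (∑' i, u i x)) := by
  have hL1 : Summable fun i => |lam (i + 1)| := (summable_nat_add_iff 1).2 hL
  refine HasSum.add (HasSum.add (HasSum.neg ?_) ?_) ?_
  -- The convolution involves only eigenvalue corrections of index at least one, whence `λ - λ⁽⁰⁾`.
  · have e : ∑' i, lam i - lam 0 = ∑' i, lam (i + 1) := by
      rw [hL.of_abs.tsum_eq_zero_add]; ring
    rw [e, mul_comm, tsum_mul_tsum_eq_tsum_sum_range_of_summable_norm (by simpa using hU)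
      (by simpa using hL1)]
    have := (summable_norm_sum_mul_range_of_summable_norm
      (f := fun i => u i x) (g := fun i => lam (i + 1)) (by simpa using hU)
      (by simpa using hL1)).of_norm.hasSum
    refine this.congr_fun fun j => Finset.sum_congr rfl fun p hp => ?_
    simp only [Finset.mem_range] at hp
    rw [show j - p + 1 = j + 1 - p by omega, mul_comm]
  · simpa using hU.of_abs.hasSum.mul_left (q x)
  · simpa using hasSum_adomian ha hU

theorem isSolution_tsum {α β : ℝ} {n : ℕ} {q : ℝ → ℝ} {a : ℕ → ℝ}
    (hα : α ∈ Set.Ioo (0 : ℝ) 1) (h : Admissible α β n)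
    (hq : IntervalIntegrable q volume 0 1)
    (ha : ∀ u : ℝ, Summable fun p : ℕ => a p * u ^ p)
    (hu : ∀ i, ContinuousOn (fdU α β q (powerFun a) n i) (Set.Icc 0 1))
    (hU : Summable fun i => supNorm (fdU α β q (powerFun a) n i))
    (hL : Summable fun i => |fdLam α β q (powerFun a) n i|) :
    IsSolution α β q (powerFun a) (∑' i, fdLam α β q (powerFun a) n i)
      (fun x => ∑' i, fdU α β q (powerFun a) n i x) := by
  set lam := fdLam α β q (powerFun a) n with hlam
  set u := fdU α β q (powerFun a) n with hudef
  set v : ℝ → ℝ := fun x => ∑' i, u i x with hv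
  set G : ℝ → ℝ := fun x => -((∑' i, lam i - lam 0) * v x) + q x * v x + powerFun a (v x) with hG
  have hux : ∀ x ∈ Set.Icc (0 : ℝ) 1, Summable fun i => |u i x| := fun x hx =>
    hU.of_nonneg_of_le (fun _ => abs_nonneg _) fun i => abs_le_supNorm (hu i) hx
  have hFG : ∀ x ∈ Set.Icc (0 : ℝ) 1,
      HasSum (fun j => rhs q (powerFun a) lam u (j + 1) x) (G x) := fun x hx =>
    hasSum_rhs ha hL (hux x hx)
  have hF : ∀ j, IntervalIntegrable (rhs q (powerFun a) lam u (j + 1)) volume 0 1 := fun j =>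
    intervalIntegrable_rhs hq ha fun i _ => hu i
  have hs := summable_normL1_rhs hq ha hu hU hL
  have hvc : ContinuousOn v (Set.Icc 0 1) := continuousOn_tsum hu hU fun i x hx =>
    abs_le_supNorm (hu i) hx
  -- Continuity of `N(v)` comes from its Adomian series, which converges uniformly.
  have hNc : ContinuousOn (fun x => powerFun a (v x)) (Set.Icc 0 1) := by
    have hA := (hasSum_adomian (summable_abs_mul_pow ha) hU.abs).summable
    refine (continuousOn_tsum (fun k => continuousOn_adomian ha (k := k) fun i _ => hu i) hA
      fun k x hx => abs_adomian_le_supNorm ha (fun i _ => hu i) hx).congr fun x hx => ?_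
    exact (hasSum_adomian ha (hux x hx)).tsum_eq.symm
  have hGi : IntervalIntegrable G volume 0 1 :=
    ((continuousOn_intervalIntegrable (continuousOn_const.mul hvc).neg).add
      (intervalIntegrable_mul_continuousOn hq hvc)).add (continuousOn_intervalIntegrable hNc)
  have hω := h.om_pos
  have hc0 := continuous_u0 hω h.root
  have horthj : ∀ j, ∫ x in (0 : ℝ)..1,
      u0 α β n x * rhs q (powerFun a) lam u (j + 1) x = 0 := fun j =>
    orthogonal_rhs h hq ha (fun i _ => hu i) rfl (fdLam_succ α β q (powerFun a) n j)
  have horth : ∫ x in (0 : ℝ)..1, u0 α β n x * G x = 0 := by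
    -- The kernel must be bounded on the whole line, so `u0` is frozen outside `[0, 1]`.
    set k : ℝ → ℝ := fun x => u0 α β n (max 0 (min x 1)) with hk
    have hkc : Continuous k := by fun_prop
    have hkK : ∀ t, |k t| ≤ supNorm (u0 α β n) := fun t =>
      abs_le_supNorm hc0.continuousOn ⟨le_max_left _ _, max_le zero_le_one (min_le_right _ _)⟩
    have hke : ∀ f : ℝ → ℝ, ∫ x in (0 : ℝ)..1, k x * f x = ∫ x in (0 : ℝ)..1, u0 α β n x * f x :=
      fun f => intervalIntegral.integral_congr fun x hx => by
        rw [Set.uIcc_of_le zero_le_one] at hx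
        simp [hk, hx.1, hx.2]
    have := hasSum_integral_kernel hF hs hFG hkc hkK (b := 0) (c := 1) (by simp) (by simp)
    simp only [hke, horthj] at this
    exact this.unique hasSum_zero
  refine isSolution_of_eq hα h hGi horth (fun x hx => ?_) fun x _ => rfl
  have h1 := hasSum_uFormula hα h hF hs hFG hx
  have h2 : ∀ j, u (j + 1) = uFormula α β n (rhs q (powerFun a) lam u (j + 1)) :=
    fdU_succ α β q (powerFun a) n
  simp only [hv]
  rw [(hux x hx).of_abs.tsum_eq_zero_add, ← h1.tsum_eq]
  simp only [h2]
  rfl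

/-! ## Error estimates -/

theorem alphaSeq_nonneg {c ε : ℝ} (hc : 0 < c) (j : ℕ) : 0 ≤ alphaSeq c ε j := by
  unfold alphaSeq; positivity

theorem alphaSeq_antitone {c ε : ℝ} (hc : 0 < c) (hε : 0 < ε) {i j : ℕ} (hi : 1 ≤ i)
    (hij : i ≤ j) : alphaSeq c ε j ≤ alphaSeq c ε i := by
  unfold alphaSeq
  have : (0 : ℝ) < i := by exact_mod_cast hi
  gcongr

theorem tendsto_alphaSeq (c : ℝ) {ε : ℝ} (hε : 0 < ε) :
    Tendsto (fun m : ℕ => alphaSeq c ε (m + 1)) atTop (𝓝 0) := by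
  have h1 : Tendsto (fun m : ℕ => ((m + 1 : ℕ) : ℝ) ^ (1 + ε)) atTop atTop :=
    (tendsto_rpow_atTop (by linarith)).comp
      (tendsto_natCast_atTop_atTop.comp (tendsto_add_atTop_nat 1))
  exact h1.const_div_atTop c

/-- Since `αⱼ` decreases, its value at `m + 1` can be taken out of the tail, leaving a geometric
series. -/
theorem tail_le {f : ℕ → ℝ} {K c ε r : ℝ} (hf : ∀ j, 0 ≤ f j) (hK : 0 ≤ K) (hc : 0 < c)
    (hε : 0 < ε) (hr0 : 0 ≤ r) (hr : r < 1)
    (h : ∀ m, f (m + 1) ≤ K * alphaSeq c ε (m + 1) * r ^ m) :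
    Summable f ∧ ∀ m, ∑' i, f (m + 1 + i) ≤ K * alphaSeq c ε (m + 1) * r ^ m / (1 - r) := by
  have hbd : ∀ m i, f (m + 1 + i) ≤ K * alphaSeq c ε (m + 1) * r ^ m * r ^ i := by
    intro m i
    have h1 := h (m + i)
    rw [show m + i + 1 = m + 1 + i by omega] at h1
    refine h1.trans ?_
    rw [pow_add, ← mul_assoc]
    have := alphaSeq_antitone hc hε (i := m + 1) (j := m + 1 + i) (by omega) (by omega)
    gcongr
  have hg : ∀ m, Summable fun i => K * alphaSeq c ε (m + 1) * r ^ m * r ^ i := fun m =>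
    (summable_geometric_of_lt_one hr0 hr).mul_left _
  have hsm : ∀ m, Summable fun i => f (m + 1 + i) := fun m =>
    (hg m).of_nonneg_of_le (fun i => hf _) (hbd m)
  refine ⟨(summable_nat_add_iff 1).1 ((hsm 0).congr fun i => by rw [zero_add, add_comm]),
    fun m => ?_⟩
  refine ((hsm m).tsum_le_tsum (hbd m) (hg m)).trans_eq ?_
  rw [tsum_mul_left, tsum_geometric_of_lt_one hr0 hr, div_eq_mul_inv]

theorem sub_sum_range_eq_tsum {f : ℕ → ℝ} (hf : Summable f) (m : ℕ) :
    ∑' i, f i - ∑ j ∈ Finset.range (m + 1), f j = ∑' i, f (m + 1 + i) := by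
  rw [← hf.sum_add_tsum_nat_add (m + 1)]
  simp only [add_comm _ (m + 1)]
  ring

theorem fd_coeff_bounds {α β : ℝ} {n : ℕ} {q : ℝ → ℝ} {a : ℕ → ℝ}
    (hα : α ∈ Set.Ioo (0 : ℝ) 1) (hβ : 0 ≤ β) (h : Admissible α β n)
    (hq : IntervalIntegrable q volume 0 1) (ha0 : a 0 = 0)
    (ha : ∀ u : ℝ, Summable fun p : ℕ => a p * u ^ p) :
    ∃ c : ℝ, 0 < c ∧ ∀ m : ℕ,
      supNorm (fdU α β q (powerFun a) n (m + 1)) ≤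
        ratio α β q a n / bConst α β n * alphaSeq c (1 / 2) (m + 1) * ratio α β q a n ^ m ∧
      |fdLam α β q (powerFun a) n (m + 1)| ≤
        invR α β q a n / (1 + v0 α β n) * alphaSeq c (1 / 2) (m + 1) *
          ratio α β q a n ^ m := by
  obtain ⟨-, -, c, hc, hv⟩ := vBar_asymptotics α β q ha n
  refine ⟨c, hc, fun m => ?_⟩
  obtain ⟨-, hU, hL⟩ := fd_estimates hα hβ h hq ha0 ha (m + 1)
  have hL := hL m rfl
  have hb : 0 < bConst α β n := zero_lt_one.trans_le (one_le_bConst α β n)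
  have hv0 : 0 < 1 + v0 α β n := by linarith [v0_nonneg α β n]
  have hA := aConst_pos h
  constructor
  · have h1 := hU.trans (mul_le_mul_of_nonneg_left (hv m) (pow_nonneg hA.le (m + 1)))
    rw [mul_comm, ← le_div_iff₀ hb] at h1
    refine h1.trans (le_of_eq ?_)
    rw [ratio, mul_pow]
    ring
  · have h1 := hL.trans (mul_le_mul_of_nonneg_left (hv m) (pow_nonneg hA.le m))
    rw [mul_comm, ← le_div_iff₀ hv0] at h1
    refine h1.trans (le_of_eq ?_)
    rw [ratio, mul_pow]
    ring

theorem tail_le_uBound {α β : ℝ} {n : ℕ} (q : ℝ → ℝ) (a : ℕ → ℝ) (h : Admissible α β n)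
    (hr0 : 0 ≤ ratio α β q a n) (hr : ratio α β q a n < 1) {c ε : ℝ} (hc : 0 < c) (m : ℕ) :
    ratio α β q a n / bConst α β n * alphaSeq c ε (m + 1) * ratio α β q a n ^ m /
      (1 - ratio α β q a n) ≤ uBound α β q a c ε n m := by
  have h1r : 0 < 1 - ratio α β q a n := by linarith
  have hα := alphaSeq_nonneg (ε := ε) hc (m + 1)
  unfold uBound bigC
  calc _ = (alphaSeq c ε (m + 1) * ratio α β q a n ^ (m + 1) / (1 - ratio α β q a n)) *
        (1 / bConst α β n) := by rw [pow_succ]; ring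
    _ ≤ (alphaSeq c ε (m + 1) * ratio α β q a n ^ (m + 1) / (1 - ratio α β q a n)) *
        (bigM α β n * min (1 / bigM α β n)
          (min (1 / om α β n) (1 / (om α β n * √(cTilde α β n))))) := by
        gcongr
        exact h.inv_bConst_le
    _ = _ := by ring

/-- Equivalent to `1 / (1 + v̄₀) ≤ Mₙ / (Mₙ + X)` up to common factors, which is the lower bound `Mₙ
v̄₀ ≥ X`. -/
theorem tail_le_lamBound {α β : ℝ} {n : ℕ} (q : ℝ → ℝ) (a : ℕ → ℝ)
    (hα : α ∈ Set.Ioo (0 : ℝ) 1) (h : Admissible α β n)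
    (hr0 : 0 ≤ ratio α β q a n) (hr : ratio α β q a n < 1) {c ε : ℝ} (hc : 0 < c) (m : ℕ) :
    invR α β q a n / (1 + v0 α β n) * alphaSeq c ε (m + 1) * ratio α β q a n ^ m /
      (1 - ratio α β q a n) ≤ lamBound α β q a c ε n m := by
  have h1r : 0 < 1 - ratio α β q a n := by linarith
  have hα' := alphaSeq_nonneg (ε := ε) hc (m + 1)
  have hM := h.bigM_pos
  have hv0 : 0 < 1 + v0 α β n := by linarith [v0_nonneg α β n]
  have hinv : 0 ≤ invR α β q a n := ENNReal.toReal_nonneg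
  unfold lamBound bigC
  set X := max 1 (max (cTilde α β n) (√(cTilde α β n) * bigM α β n / om α β n)) with hX
  have hX1 : 1 ≤ X := le_max_left _ _
  have hle : 1 / (1 + v0 α β n) ≤ bigM α β n / (bigM α β n + X) := by
    rw [div_le_div_iff₀ hv0 (by linarith)]
    have := h.le_bigM_mul_v0 hα
    linarith
  calc _ = (invR α β q a n * alphaSeq c ε (m + 1) * ratio α β q a n ^ m /
        (1 - ratio α β q a n)) * (1 / (1 + v0 α β n)) := by ring
    _ ≤ (invR α β q a n * alphaSeq c ε (m + 1) * ratio α β q a n ^ m /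
        (1 - ratio α β q a n)) * (bigM α β n / (bigM α β n + X)) := by
        gcongr
    _ = _ := by ring

/-- The gain over `r ^ m` comes from `α_{m+1} → 0`, which is why the bound had to keep the exact
rate. -/
theorem isLittleO_of_bound {e : ℕ → ℝ} {K c ε r : ℝ} (hε : 0 < ε)
    (h : ∀ m, |e m| ≤ K * alphaSeq c ε (m + 1) * r ^ m) :
    e =o[atTop] (fun m : ℕ => r ^ m) := by
  have ht : Tendsto (fun m : ℕ => K * alphaSeq c ε (m + 1)) atTop (𝓝 0) := by
    simpa using (tendsto_alphaSeq c hε).const_mul K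
  have h1 := ((isLittleO_one_iff ℝ).2 ht).mul_isBigO
    (isBigO_refl (fun m : ℕ => r ^ m) atTop)
  simp only [one_mul] at h1
  refine IsBigO.trans_isLittleO (IsBigO.of_bound 1 (Eventually.of_forall fun m => ?_)) h1
  rw [one_mul, Real.norm_eq_abs, Real.norm_eq_abs]
  exact (h m).trans (le_abs_self _)

end FDMethod
end

/-! ### Assembly of the main theorem. -/

open FDMethod
theorem theorem3 (α β : ℝ) (hα : α ∈ Set.Ioo (0 : ℝ) 1) (hβ : 0 ≤ β)
    (q : ℝ → ℝ) (hq : IntervalIntegrable q volume 0 1)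
    (a : ℕ → ℝ) (ha0 : a 0 = 0) (ha : ∀ u : ℝ, Summable fun p : ℕ => a p * u ^ p) :
    ∃ n₀ : ℕ, 0 < n₀ ∧ ∀ n : ℕ, n₀ ≤ n →
      -- the basic eigenvalue is the root of the characteristic equation
      lam0 α β n ∈ basicRoots α β n ∧
      -- the generating function has a positive radius of convergence, and `rₙ < 1`
      0 < genRadius α β q a n ∧ ratio α β q a n < 1 ∧
      -- both equations for the coefficients `c^{(j)}` hold, and the corrections are continuous
      (∀ j : ℕ, 1 ≤ j →
        fdC α β q (powerFun a) n j * Real.sin (om α β n * (1 - α)) =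
            cRhs₁ α β n (fdF α β q (powerFun a) n j) ∧
        fdC α β q (powerFun a) n j * Real.cos (om α β n * (1 - α)) =
            cRhs₂ α β n (fdF α β q (powerFun a) n j)) ∧
      (∀ j : ℕ, ContinuousOn (fdU α β q (powerFun a) n j) (Set.Icc 0 1)) ∧
      -- the series of corrections converge absolutely
      (Summable fun j : ℕ => |fdLam α β q (powerFun a) n j|) ∧
      (Summable fun j : ℕ => supNorm (fdU α β q (powerFun a) n j)) ∧
      -- the approximations converge to an exact solution, with the error estimates
      ∃ (lam : ℝ) (u : ℝ → ℝ), IsSolution α β q (powerFun a) lam u ∧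
        (∃ c ε : ℝ, 0 < c ∧ 0 < ε ∧ ∀ m : ℕ,
          supNorm (fun x => u x - fdUApprox α β q (powerFun a) n m x) ≤
              ∑' i : ℕ, supNorm (fdU α β q (powerFun a) n (m + 1 + i)) ∧
          ∑' i : ℕ, supNorm (fdU α β q (powerFun a) n (m + 1 + i)) ≤
              uBound α β q a c ε n m ∧
          |lam - fdLamApprox α β q (powerFun a) n m| ≤
              ∑' i : ℕ, |fdLam α β q (powerFun a) n (m + 1 + i)| ∧
          ∑' i : ℕ, |fdLam α β q (powerFun a) n (m + 1 + i)| ≤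
              lamBound α β q a c ε n m) ∧
        -- superexponential convergence: faster than the geometric progression `rₙ ^ m`
        (fun m : ℕ => supNorm (fun x => u x - fdUApprox α β q (powerFun a) n m x))
            =o[atTop] (fun m : ℕ => ratio α β q a n ^ m) ∧
        (fun m : ℕ => lam - fdLamApprox α β q (powerFun a) n m)
            =o[atTop] (fun m : ℕ => ratio α β q a n ^ m) := by
  obtain ⟨n₀, hn₀, hadm⟩ := exists_admissible hα hβ q ha
  refine ⟨n₀, hn₀, fun n hn => ?_⟩
  obtain ⟨h, hr⟩ := hadm n hn
  have hest := fd_estimates hα hβ h hq ha0 ha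
  have hcont : ∀ j, ContinuousOn (fdU α β q (powerFun a) n j) (Set.Icc 0 1) :=
    fun j => (hest j).1
  have hb : 0 < bConst α β n := zero_lt_one.trans_le (one_le_bConst α β n)
  have hv0 : 0 < 1 + v0 α β n := by linarith [v0_nonneg α β n]
  have hinv : 0 ≤ invR α β q a n := ENNReal.toReal_nonneg
  have hr0 : 0 ≤ ratio α β q a n := mul_nonneg (aConst_pos h).le hinv
  obtain ⟨c, hc, hbd⟩ := fd_coeff_bounds hα hβ h hq ha0 ha
  obtain ⟨hUs, hUt⟩ := tail_le (fun j => supNorm_nonneg (fdU α β q (powerFun a) n j))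
    (by positivity) hc one_half_pos hr0 hr fun m => (hbd m).1
  obtain ⟨hLs, hLt⟩ := tail_le (fun j => abs_nonneg (fdLam α β q (powerFun a) n j))
    (by positivity) hc one_half_pos hr0 hr fun m => (hbd m).2
  have hUe : ∀ m, supNorm (fun x => ∑' i, fdU α β q (powerFun a) n i x -
      fdUApprox α β q (powerFun a) n m x) ≤
      ∑' i : ℕ, supNorm (fdU α β q (powerFun a) n (m + 1 + i)) := fun m => by
    refine supNorm_le fun x hx => ?_
    have hsm : Summable fun i => |fdU α β q (powerFun a) n i x| :=
      hUs.of_nonneg_of_le (fun _ => abs_nonneg _) fun i => abs_le_supNorm (hcont i) hx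
    have hsU : Summable fun i => supNorm (fdU α β q (powerFun a) n (m + 1 + i)) := by
      simpa only [add_comm] using (summable_nat_add_iff (m + 1)).2 hUs
    rw [fdUApprox, sub_sum_range_eq_tsum hsm.of_abs]
    rw [← Real.norm_eq_abs]
    exact tsum_of_norm_bounded hsU.hasSum fun i => abs_le_supNorm (hcont _) hx
  have hLe : ∀ m, |∑' i, fdLam α β q (powerFun a) n i -
      fdLamApprox α β q (powerFun a) n m| ≤
      ∑' i : ℕ, |fdLam α β q (powerFun a) n (m + 1 + i)| := fun m => by
    have hsL : Summable fun i => |fdLam α β q (powerFun a) n (m + 1 + i)| := by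
      simpa only [add_comm] using (summable_nat_add_iff (m + 1)).2 hLs
    rw [fdLamApprox, sub_sum_range_eq_tsum hLs.of_abs]
    rw [← Real.norm_eq_abs]
    exact tsum_of_norm_bounded hsL.hasSum fun i => le_rfl
  refine ⟨h.root, (vBar_asymptotics α β q ha n).1, hr, fun j hj => ?_, hcont, hLs, hUs,
    ∑' i, fdLam α β q (powerFun a) n i, fun x => ∑' i, fdU α β q (powerFun a) n i x,
    isSolution_tsum hα h hq ha hcont hUs hLs, ⟨c, 1 / 2, hc, one_half_pos, fun m =>
      ⟨hUe m, (hUt m).trans (tail_le_uBound q a h hr0 hr hc m), hLe m,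
        (hLt m).trans (tail_le_lamBound q a hα h hr0 hr hc m)⟩⟩, ?_, ?_⟩
  · obtain ⟨j, rfl⟩ := Nat.exists_eq_add_of_le' hj
    exact cFormula_spec hα h (intervalIntegrable_rhs hq ha fun i _ => hcont i)
      (orthogonal_rhs h hq ha (fun i _ => hcont i) rfl (fdLam_succ α β q (powerFun a) n j))
  · refine isLittleO_of_bound (c := c) (ε := 1 / 2)
      (K := ratio α β q a n / bConst α β n / (1 - ratio α β q a n)) one_half_pos fun m => ?_
    rw [abs_of_nonneg (supNorm_nonneg _)]
    exact ((hUe m).trans (hUt m)).trans (le_of_eq (by ring))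
  · refine isLittleO_of_bound (c := c) (ε := 1 / 2)
      (K := invR α β q a n / (1 + v0 α β n) / (1 - ratio α β q a n)) one_half_pos fun m => ?_
    exact ((hLe m).trans (hLt m)).trans (le_of_eq (by ring))
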